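/- Let $S$ be a noetherian scheme, $S\hookrightarrow\widetilde S$ a closed immersion whose ideal sheaf $\mathfrak a$ satisfies $\mathfrak a^2=0$, $\widetilde X\to\widetilde S$ a smooth morphism and $\widetilde D\subset\widetilde X$ a relative simple normal crossings divisor over $\widetilde S$. Put $(X,D)=(\widetilde X,\widetilde D)\times_{\widetilde S}S$ and $\mathcal I=\mathfrak a\,\mathcal O_{\widetilde X}$, the ideal of $X$ in $\widetilde X$. Let $(V,\nabla,\mathrm{Fil})$ be a filtered de Rham bundle over $(X,D)/S$: $V$ is a vector bundle, $\nabla\colon V\to V\otimes\Omega^1_{X/S}(\log D)$ is an integrable logarithmic connection, and $\mathrm{Fil}$ is a finite decreasing filtration of $V$ by subbundles (locally direct summands, $\mathrm{Fil}^{-N}=V$ and $\mathrm{Fil}^{N+1}=0$ for some $N$) with $\nabla(\mathrm{Fil}^\ell)\subset\mathrm{Fil}^{\ell-1}\otimes\Omega^1_{X/S}(\log D)$ for all $\ell$. Let $(\widetilde V,\widetilde\nabla)$ be a lift of $(V,\nabla)$ to $(\widetilde X,\widetilde D)/\widetilde S$: a vector bundle with integrable logarithmic connection and an identification of its restriction to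 $X$ with $(V,\nabla)$. Let $\mathrm{Fil}^\ell\mathcal End(V)=\{\varphi:\varphi(\mathrm{Fil}^m)\subset\mathrm{Fil}^{m+\ell}\text{ for all }m\}$, write $(-)_{\mathcal I}=(-)\otimes\mathcal I$, and equip $\mathcal End(V)_{\mathcal I}$ with the connection $\nabla^{\mathrm{End}}\otimes 1+1\otimes d$. Let $\mathscr C=\mathrm{DR}(\mathcal End(V,\nabla)_{\mathcal I})/\mathrm{Fil}^0$, the complex with terms $$\mathscr C^p=\frac{\mathcal End(V)_{\mathcal I}}{(\mathrm{Fil}^{-p}\mathcal End(V))_{\mathcal I}}\otimes\Omega^p_{X/S}(\log D)\qquad(p\ge 0)$$ and the induced differential $\overline\nabla$. Hypercohomology $\mathbb H^i(\mathscr C)$ is the colimit of Čech hypercohomology over open covers; a 1-cocycle on a cover $(U_x)$ is a pair $(a,b)$, $a_{xy}\in\mathscr C^0(U_{xy})$, $b_x\in\mathscr C^1(U_x)$, with $a_{yz}-a_{xz}+a_{xy}=0$, $\overline\nabla a_{xy}=b_y-b_x$, $\overline\nabla b_x=0$, and coboundaries are the pairs $(g_y-g_x,\overline\nabla g_x)$.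 Let $\iota\colon\mathcal End(V)_{\mathcal I}\cong\mathcal I\cdot\mathcal End(\widetilde V)$ be the isomorphism $\varphi\otimes r\mapsto r\widetilde\varphi$, $\widetilde\varphi$ any local lift of $\varphi$. A lift of $\mathrm{Fil}$ is a finite decreasing filtration of $\widetilde V$ by subbundles which restricts to $\mathrm{Fil}$ on $X$ and is Griffiths transverse for $\widetilde\nabla$. A system of local lifts consists of an open cover $(U_x)$, indexed by the points $x$ of $\widetilde X$ with $x\in U_x$, and on each $U_x$ a connection $\widetilde\nabla_x$ on $\widetilde V|_{U_x}$ lifting $\nabla$ (not necessarily integrable) and a filtration $\widetilde{\mathrm{Fil}}_x$ lifting $\mathrm{Fil}$ which is Griffiths transverse for $\widetilde\nabla_x$. Then the following hold. 1. Systems of local lifts exist. For every such system there is exactly one 1-cocycle $(a,b)$ of $\mathscr C$ on its cover such that $b_x$ is the class of $\iota^{-1}(\widetilde\nabla_x-\widetilde\nabla)$ for all $x$, and on every open subset $O$ of an overlap $U_{xy}$, for every homomorphism $f\colon(\widetilde V,\widetilde{\mathrm{Fil}}_x)|_O\to(\widetilde V,\widetilde{\mathrm{Fil}}_y)|_O$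 lifting $\mathrm{id}_V$, $a_{xy}|_O$ is the class of $\iota^{-1}(\mathrm{id}-f)$. The class $c(\mathrm{Fil})\in\mathbb H^1(\mathscr C)$ of this cocycle does not depend on the system of local lifts, and $c(\mathrm{Fil})=0$ if and only if $\mathrm{Fil}$ has a lift to a Griffiths transverse filtration on $(\widetilde V,\widetilde\nabla)$. 2. If $\mathrm{Fil}$ has a lift, then the set of lifts of $\mathrm{Fil}$ on the fixed $(\widetilde V,\widetilde\nabla)$ is a torsor under $\mathbb H^0(\mathscr C)$, in such a way that the difference $\widetilde{\mathrm{Fil}}'-\widetilde{\mathrm{Fil}}$ of two lifts is the global section of $\mathscr C^0$ that is given by the class of $\iota^{-1}(\mathrm{id}-f)$ for every local homomorphism $f\colon(\widetilde V,\widetilde{\mathrm{Fil}})|_O\to(\widetilde V,\widetilde{\mathrm{Fil}}')|_O$ lifting $\mathrm{id}_V$; such $f$ exist in a neighbourhood of every point. -/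

import Mathlib

open AlgebraicGeometry CategoryTheory Limits TopologicalSpace
open scoped TensorProduct

universe u

namespace HodgeDef

noncomputable section

theorem ker_le_of_isPushout {R A B P : CommRingCat.{u}} {f : R ⟶ A} {p : R ⟶ B} {l : A ⟶ P} {r : B ⟶ P}
    (h : IsPushout f p l r) (hp : Function.Surjective p) :
    RingHom.ker l.hom ≤ (RingHom.ker p.hom).map f.hom := by
  intro x hx
  let q : A ⟶ CommRingCat.of (A ⧸ (RingHom.ker p.hom).map f.hom) :=
    CommRingCat.ofHom (Ideal.Quotient.mk _)
  let m : B →+* (A ⧸ (RingHom.ker p.hom).map f.hom) :=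
    RingHom.liftOfSurjective p.hom hp ⟨(f ≫ q).hom, fun a ha => by
      have : f.hom a ∈ (RingHom.ker p.hom).map f.hom := Ideal.mem_map_of_mem _ ha
      simpa [q, Ideal.Quotient.eq_zero_iff_mem] using this⟩
  have hm : f ≫ q = p ≫ CommRingCat.ofHom m := by
    ext a
    have := RingHom.liftOfRightInverse_comp_apply p.hom (Function.surjInv hp)
      (Function.rightInverse_surjInv hp) ⟨(f ≫ q).hom, fun a ha => by
      have : f.hom a ∈ (RingHom.ker p.hom).map f.hom := Ideal.mem_map_of_mem _ ha
      simpa [q, Ideal.Quotient.eq_zero_iff_mem] using this⟩ a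
    exact this.symm
  have h2 := congrArg (fun t => t.hom x) (h.inl_desc q (CommRingCat.ofHom m) hm)
  have hx' : l.hom x = 0 := hx
  have h3 : Ideal.Quotient.mk ((RingHom.ker p.hom).map f.hom) x = 0 := by
    have : (h.desc q (CommRingCat.ofHom m) hm).hom (l.hom x) = q.hom x := h2
    rw [hx', map_zero] at this
    exact this.symm
  exact Ideal.Quotient.eq_zero_iff_mem.mp h3

theorem ideal_comap_isAffine {X Y : Scheme.{u}} [IsAffine X] [IsAffine Y] (I : Y.IdealSheafData) (g : X ⟶ Y) :
   (I.comap g).ideal ⟨⊤, isAffineOpen_top X⟩ ≤ (I.ideal ⟨⊤, isAffineOpen_top Y⟩).map g.appTop.hom := by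
  have : IsAffine I.subscheme := isAffine_of_isAffineHom I.subschemeι
  have h := isPushout_appTop_of_isPullback (IsPullback.of_hasPullback g I.subschemeι)
  have := Scheme.Hom.app_surjective I.subschemeι ⊤ (isAffineOpen_top Y)
  have hk := Scheme.IdealSheafData.ker_subschemeι_app I ⟨⊤, isAffineOpen_top Y⟩
  rw [Scheme.IdealSheafData.comap, Scheme.Hom.ker_apply, ← hk]
  exact ker_le_of_isPushout h this

theorem ideal_eq_comap_ι {X : Scheme.{u}} (J : X.IdealSheafData) (U : X.affineOpens)
    (hU : IsAffineOpen (⊤ : U.1.toScheme.Opens)) :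
    J.ideal U = ((J.comap U.1.ι).ideal ⟨⊤, hU⟩).comap (U.1.ι.appLE U ⊤ (by simp)).hom := by
  have e := Scheme.IdealSheafData.ideal_comap_of_isOpenImmersion J U.1.ι ⟨⊤, hU⟩
  rw [e, Ideal.comap_comap, ← CommRingCat.hom_comp]
  have hle : U.1.ι ''ᵁ (⊤ : U.1.toScheme.Opens) = U.1 := by simp
  have e2 : U.1.ι.appLE U ⊤ (by simp) ≫ (U.1.ι.appIso ⊤).inv =
      X.presheaf.map (homOfLE hle.le).op := by
    rw [Iso.comp_inv_eq, Scheme.Hom.appIso_hom', Scheme.Hom.map_appLE]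
  rw [e2]
  apply le_antisymm
  · exact J.ideal_le_comap_ideal (U := ⟨U.1.ι ''ᵁ (⊤ : U.1.toScheme.Opens), _⟩) (V := U) hle.le
  · intro x hx
    have h3 := J.ideal_le_comap_ideal (U := U) (V := ⟨U.1.ι ''ᵁ (⊤ : U.1.toScheme.Opens), hU.image_of_isOpenImmersion _⟩) hle.ge hx
    have h4 : (X.presheaf.map (homOfLE hle.le).op ≫ X.presheaf.map (homOfLE hle.ge).op) = 𝟙 _ := by
      rw [← X.presheaf.map_comp, ← X.presheaf.map_id]; rfl
    have h5 := congrArg (fun t => t.hom x) h4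
    have h6 : (X.presheaf.map (homOfLE hle.ge).op).hom
      ((X.presheaf.map (homOfLE hle.le).op).hom x) = x := h5
    have h7 : (X.presheaf.map (homOfLE hle.ge).op).hom
      ((X.presheaf.map (homOfLE hle.le).op).hom x) ∈ J.ideal U := h3
    rwa [h6] at h7

theorem bijective_ι_appLE {X : Scheme.{u}} (U : X.Opens) :
    Function.Bijective (U.ι.appLE U ⊤ (by simp)).hom := by
  have hle : U.ι ''ᵁ (⊤ : U.toScheme.Opens) = U := by simp
  have e2 : U.ι.appLE U ⊤ (by simp) =
      X.presheaf.map (eqToHom hle).op ≫ (U.ι.appIso ⊤).hom := by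
    rw [Scheme.Hom.appIso_hom', Scheme.Hom.map_appLE]
  rw [e2]
  exact ConcreteCategory.bijective_of_isIso (X.presheaf.map (eqToHom hle).op ≫ (U.ι.appIso ⊤).hom)

theorem ideal_comap_le {X Y : Scheme.{u}} (I : Y.IdealSheafData) (g : X ⟶ Y)
    (U : X.affineOpens) (V : Y.affineOpens) (h : (U : X.Opens) ≤ g ⁻¹ᵁ V) :
    (I.comap g).ideal U ≤ (I.ideal V).map (g.appLE V U h).hom := by
  have : IsAffine U.1.toScheme := U.2
  have : IsAffine V.1.toScheme := V.2
  have hU := isAffineOpen_top U.1.toScheme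
  have hV := isAffineOpen_top V.1.toScheme
  have h1 := ideal_comap_isAffine (I.comap V.1.ι) (g.resLE V U h)
  rw [← Scheme.IdealSheafData.comap_comp, Scheme.Hom.resLE_comp_ι,
    Scheme.IdealSheafData.comap_comp] at h1
  have a := ideal_eq_comap_ι (I.comap g) U hU
  have b := ideal_eq_comap_ι I V hV
  have comm : V.1.ι.appLE V ⊤ (by simp) ≫ (g.resLE V U h).appTop =
      g.appLE V U h ≫ U.1.ι.appLE U ⊤ (by simp) := by
    have e : (g.resLE V U h).appTop = (g.resLE V U h).appLE ⊤ ⊤ le_top := by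
      rw [Scheme.Hom.appTop, Scheme.Hom.app_eq_appLE]; rfl
    rw [e]
    refine (Scheme.Hom.appLE_comp_appLE _ _ _ _ _ _ _).trans
      (Eq.trans ?_ (Scheme.Hom.appLE_comp_appLE _ _ _ _ _ _ _).symm)
    simp only [Scheme.Hom.resLE_comp_ι]
  have isoU := bijective_ι_appLE U.1
  have isoV := bijective_ι_appLE V.1
  have b' : (I.comap V.1.ι).ideal ⟨⊤, hV⟩ =
      (I.ideal V).map (V.1.ι.appLE V ⊤ (by simp)).hom := by
    rw [b, Ideal.map_comap_of_surjective _ isoV.2]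
  rw [b', Ideal.map_map, ← CommRingCat.hom_comp, comm, CommRingCat.hom_comp, ← Ideal.map_map] at h1
  rw [a]
  refine (Ideal.comap_mono h1).trans ?_
  rw [Ideal.comap_map_of_bijective _ isoU]

theorem appLE_comp_app {A B C E : Scheme.{u}} {p : A ⟶ B} {g : B ⟶ C} {q : A ⟶ E} {k : E ⟶ C}
    (w : p ≫ g = q ≫ k) {U : B.Opens} {V : C.Opens} (h : U ≤ g ⁻¹ᵁ V)
    (h' : p ⁻¹ᵁ U ≤ q ⁻¹ᵁ (k ⁻¹ᵁ V)) :
    g.appLE V U h ≫ p.app U = k.app V ≫ q.appLE (k ⁻¹ᵁ V) (p ⁻¹ᵁ U) h' := by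
  rw [Scheme.Hom.app_eq_appLE, Scheme.Hom.app_eq_appLE]
  refine (Scheme.Hom.appLE_comp_appLE _ _ _ _ _ _ _).trans
    (Eq.trans ?_ (Scheme.Hom.appLE_comp_appLE _ _ _ _ _ _ _).symm)
  simp only [w]

theorem le_ideal_comap {X Y : Scheme.{u}} (I : Y.IdealSheafData) (g : X ⟶ Y)
    (U : X.affineOpens) (V : Y.affineOpens) (h : (U : X.Opens) ≤ g ⁻¹ᵁ V)
    (x : Γ(Y, V)) (hx : x ∈ I.ideal V) : (g.appLE V U h).hom x ∈ (I.comap g).ideal U := by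
  rw [Scheme.IdealSheafData.comap, Scheme.Hom.ker_apply, RingHom.mem_ker]
  have h' : pullback.fst g I.subschemeι ⁻¹ᵁ U.1 ≤
      pullback.snd g I.subschemeι ⁻¹ᵁ (I.subschemeι ⁻¹ᵁ V.1) := by
    rw [← Scheme.Hom.comp_preimage, ← pullback.condition, Scheme.Hom.comp_preimage]
    exact (TopologicalSpace.Opens.map (pullback.fst g I.subschemeι).base).monotone h
  have e := congrArg (fun t => t.hom x)
    (appLE_comp_app (pullback.condition (f := g) (g := I.subschemeι)) h h')
  rw [← Scheme.IdealSheafData.ker_subschemeι_app, RingHom.mem_ker] at hx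
  refine (show _ = _ from e).trans ?_
  change (Scheme.Hom.appLE _ _ _ _).hom ((I.subschemeι.app V.1).hom x) = 0
  rw [hx, map_zero]

/-! ### Restriction maps and charts -/

/-- Restriction of functions. -/
def resO {X : Scheme.{u}} {U W : X.Opens} (h : W ≤ U) : Γ(X, U) →+* Γ(X, W) :=
  (X.presheaf.map (homOfLE h).op).hom

/-- Restriction of sections of a sheaf of modules. -/
def resM {X : Scheme.{u}} (V : X.Modules) {U W : X.Opens} (h : W ≤ U) : Γ(V, U) →+ Γ(V, W) :=
  (V.presheaf.map (homOfLE h).op).hom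

/-- A chart of `f : X ⟶ S`: an affine open `U` of `X` mapping into an affine open `V` of `S`. -/
structure AffChart {X S : Scheme.{u}} (f : X ⟶ S) where
  U : X.Opens
  affU : IsAffineOpen U
  V : S.Opens
  affV : IsAffineOpen V
  le : U ≤ f ⁻¹ᵁ V

/-- `D` is a relative strict normal crossings divisor on the smooth scheme `X` over `S`: Zariski
locally there are étale coordinates `t : Fin n → Γ(X, U)` over `S` such that the ideal of `D` is
generated by the product of some of them. -/
def IsRelSNC {X S : Scheme.{u}} (f : X ⟶ S) (D : X.IdealSheafData) : Prop :=
  ∀ x : X, ∃ c : AffChart f, x ∈ c.U ∧ ∃ (n : ℕ) (t : Fin n → Γ(X, c.U)) (s : Finset (Fin n)),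
    (MvPolynomial.eval₂Hom (f.appLE c.V c.U c.le).hom t).Etale ∧
      D.ideal ⟨c.U, c.affU⟩ = Ideal.span {∏ k ∈ s, t k}

/-- Logarithmic derivations on a chart: the derivations of `Γ(X, U)` over the base that preserve
the ideal of `D`. These are the sections over `U` of the dual of `Ω¹_{X/S}(log D)`; sections of
`F ⊗ Ω^p_{X/S}(log D)` are the alternating `p`-forms on logarithmic derivations with values
in `F`. -/
def LogDer {X S : Scheme.{u}} (f : X ⟶ S) (D : X.IdealSheafData) (c : AffChart f) :
    Submodule Γ(X, c.U) (Derivation ℤ Γ(X, c.U) Γ(X, c.U)) where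
  carrier := {θ | (∀ b : Γ(S, c.V), θ ((f.appLE c.V c.U c.le).hom b) = 0) ∧
    ∀ x ∈ D.ideal ⟨c.U, c.affU⟩, θ x ∈ D.ideal ⟨c.U, c.affU⟩}
  add_mem' := fun ha hb => ⟨fun x => by simp [ha.1 x, hb.1 x],
    fun x hx => Ideal.add_mem _ (ha.2 x hx) (hb.2 x hx)⟩
  zero_mem' := ⟨fun _ => rfl, fun _ _ => Ideal.zero_mem _⟩
  smul_mem' := fun r _ ha => ⟨fun x => by simp [ha.1 x], fun x hx => Ideal.mul_mem_left _ r (ha.2 x hx)⟩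

/-- The Lie bracket of logarithmic derivations. -/
def LogDer.bracket {X S : Scheme.{u}} {f : X ⟶ S} {D : X.IdealSheafData} {c : AffChart f}
    (θ η : LogDer f D c) : LogDer f D c :=
  ⟨⁅θ.1, η.1⁆, fun b => by
    rw [Derivation.commutator_apply, θ.2.1 b, η.2.1 b, map_zero, map_zero, sub_zero], fun x hx => by
    rw [Derivation.commutator_apply]
    exact Ideal.sub_mem _ (θ.2.2 _ (η.2.2 x hx)) (η.2.2 _ (θ.2.2 x hx))⟩

/-- `θ'` is the restriction of `θ` to a smaller chart. -/
def DerRes {X S : Scheme.{u}} {f : X ⟶ S} {D : X.IdealSheafData} {c c' : AffChart f}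
    (h : c'.U ≤ c.U) (θ : LogDer f D c) (θ' : LogDer f D c') : Prop :=
  ∀ g : Γ(X, c.U), θ'.1 (resO h g) = resO h (θ.1 g)

/-! ### Vector bundles, logarithmic connections, filtrations -/

/-- Locally free of finite rank. -/
def IsVectorBundle {X : Scheme.{u}} (V : X.Modules) : Prop :=
  ∀ x : X, ∃ U : X.Opens, x ∈ U ∧ ∃ (n : ℕ) (e : Fin n → Γ(V, U)), ∀ (W : X.Opens) (h : W ≤ U),
    LinearIndependent Γ(X, W) (fun k => resM V h (e k)) ∧
      Submodule.span Γ(X, W) (Set.range fun k => resM V h (e k)) = ⊤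

/-- A connection `∇ : V → V ⊗ Ω¹_{X/S}(log D)` on the open subset `O`, given by its contractions
`∇_θ` with logarithmic derivations on the charts contained in `O`. -/
structure LogConnection {X S : Scheme.{u}} (f : X ⟶ S) (D : X.IdealSheafData) (V : X.Modules)
    (O : X.Opens) where
  nab : ∀ c : AffChart f, c.U ≤ O → LogDer f D c → Γ(V, c.U) →+ Γ(V, c.U)
  add : ∀ c h θ η v, nab c h (θ + η) v = nab c h θ v + nab c h η v
  smul : ∀ c h (r : Γ(X, c.U)) θ v, nab c h (r • θ) v = r • nab c h θ v
  leibniz : ∀ c h θ (r : Γ(X, c.U)) (v : Γ(V, c.U)),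
    nab c h θ (r • v) = θ.1 r • v + r • nab c h θ v
  res : ∀ c h c' h' (hc : c'.U ≤ c.U) θ θ', DerRes hc θ θ' → ∀ v,
    nab c' h' θ' (resM V hc v) = resM V hc (nab c h θ v)

/-- Vanishing of the curvature. -/
def LogConnection.Integrable {X S : Scheme.{u}} {f : X ⟶ S} {D : X.IdealSheafData} {V : X.Modules}
    {O : X.Opens} (N : LogConnection f D V O) : Prop :=
  ∀ c h θ η v, N.nab c h θ (N.nab c h η v) - N.nab c h η (N.nab c h θ v) =
    N.nab c h (LogDer.bracket θ η) v

/-- A finite decreasing filtration of `V` over the open subset `O` by subsheaves of modules that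
are locally direct summands. -/
structure Filtration {X : Scheme.{u}} (V : X.Modules) (O : X.Opens) where
  fil : ℤ → ∀ U : X.Opens, U ≤ O → Submodule Γ(X, U) Γ(V, U)
  res : ∀ l U hU W hW (h : W ≤ U), ∀ v ∈ fil l U hU, resM V h v ∈ fil l W hW
  sheaf : ∀ l U hU (v : Γ(V, U)),
    (∀ x ∈ U, ∃ (W : X.Opens) (h : W ≤ U), x ∈ W ∧ resM V h v ∈ fil l W (h.trans hU)) →
      v ∈ fil l U hU
  anti : ∀ l m, l ≤ m → ∀ U hU, fil m U hU ≤ fil l U hU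
  summand : ∀ (l : ℤ), ∀ x ∈ O, ∃ (U : X.Opens) (hU : U ≤ O), x ∈ U ∧
    ∃ G : ∀ W : X.Opens, Submodule Γ(X, W) Γ(V, W),
      (∀ W (_ : W ≤ U) W' (h : W' ≤ W) (v : Γ(V, W)), v ∈ G W → resM V h v ∈ G W') ∧
      ∀ W (hW : W ≤ U), IsCompl (fil l W (hW.trans hU)) (G W)
  bounded : ∃ N : ℕ, ∀ U hU, fil (-N) U hU = ⊤ ∧ fil (N + 1) U hU = ⊥

/-- Griffiths transversality `∇(Fil^l) ⊆ Fil^{l-1} ⊗ Ω¹(log D)`. -/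
def Griffiths {X S : Scheme.{u}} {f : X ⟶ S} {D : X.IdealSheafData} {V : X.Modules}
    {O : X.Opens} (N : LogConnection f D V O) (F : Filtration V O) : Prop :=
  ∀ (c : AffChart f) (h : c.U ≤ O) (θ : LogDer f D c) (l : ℤ) (v : Γ(V, c.U)),
    v ∈ F.fil l c.U h → N.nab c h θ v ∈ F.fil (l - 1) c.U h

/-- A filtered de Rham bundle over `(X, D)/S`: a vector bundle with an integrable logarithmic
connection and a Griffiths transverse filtration. -/
structure FilteredDeRhamBundle {X S : Scheme.{u}} (f : X ⟶ S) (D : X.IdealSheafData) where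
  V : X.Modules
  vb : IsVectorBundle V
  con : LogConnection f D V ⊤
  integrable : con.Integrable
  F : Filtration V ⊤
  griffiths : Griffiths con F

/-! ### The square-zero thickening -/

/-- A square-zero thickening `j : S ⟶ T` of a Noetherian scheme `S`, a smooth scheme `g : Y ⟶ T`
with a relative strict normal crossings divisor `D`, and the base change `f : X ⟶ S` of `g`. -/
structure LogThickening where
  (S T X Y : Scheme.{u})
  (j : S ⟶ T) (g : Y ⟶ T) (i : X ⟶ Y) (f : X ⟶ S)
  isPullback : IsPullback i f g j
  noetherian : IsNoetherian S
  closed : IsClosedImmersion j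
  sq_zero : j.ker ^ 2 = ⊥
  smooth : Smooth g
  D : Y.IdealSheafData
  snc : IsRelSNC g D

namespace LogThickening

variable (P : LogThickening.{u})

/-- The base change of the divisor to `X`. -/
def D₀ : P.X.IdealSheafData := P.D.comap P.i

theorem closed_i : IsClosedImmersion P.i := by
  have := P.closed
  exact MorphismProperty.of_isPullback P.isPullback.flip P.closed

/-- Reduction of functions from `Y` to `X`. -/
def red (U : P.Y.Opens) : Γ(P.Y, U) →+* Γ(P.X, P.i ⁻¹ᵁ U) := (P.i.app U).hom

/-- The sections over `U` of the ideal of `X` in `Y`. -/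
def I (U : P.Y.Opens) : Ideal Γ(P.Y, U) := RingHom.ker (P.red U)

theorem red_surjective {U : P.Y.Opens} (hU : IsAffineOpen U) : Function.Surjective (P.red U) := by
  have := P.closed_i
  exact P.i.app_surjective U hU

/-- The restriction to `X/S` of a chart of `Y/T`. -/
def chart₀ (c : AffChart P.g) : AffChart P.f where
  U := P.i ⁻¹ᵁ c.U
  affU := by
    have := P.closed_i
    exact c.affU.preimage P.i
  V := P.j ⁻¹ᵁ c.V
  affV := by
    have := P.closed
    exact c.affV.preimage P.j
  le := by
    rw [← Scheme.Hom.comp_preimage, ← P.isPullback.w, Scheme.Hom.comp_preimage]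
    exact (TopologicalSpace.Opens.map P.i.base).monotone c.le

theorem I_le (c : AffChart P.g) :
    P.I c.U ≤ (RingHom.ker (P.j.app c.V).hom).map (P.g.appLE c.V c.U c.le).hom := by
  have := P.closed_i
  have := P.closed
  have e : P.i.ker = P.j.ker.comap P.g := by
    rw [← Scheme.IdealSheafData.ker_fst_of_isClosedImmersion, ← P.isPullback.isoPullback_hom_fst,
      Scheme.Hom.ker_comp_of_isIso]
  have h := ideal_comap_le P.j.ker P.g ⟨c.U, c.affU⟩ ⟨c.V, c.affV⟩ c.le
  rw [← e, Scheme.Hom.ker_apply, Scheme.Hom.ker_apply] at h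
  exact h

theorem LogDer_I (c : AffChart P.g) (θ : LogDer P.g P.D c) (x : Γ(P.Y, c.U)) (hx : x ∈ P.I c.U) :
    θ.1 x ∈ P.I c.U := by
  have hm : ∀ b ∈ RingHom.ker (P.j.app c.V).hom, (P.g.appLE c.V c.U c.le).hom b ∈ P.I c.U := by
    intro b hb
    have e := appLE_comp_app P.isPullback.w c.le (P.chart₀ c).le
    have h := congrArg (fun t => t.hom b) e
    have hb' : (P.j.app c.V).hom b = 0 := hb
    change (P.i.app c.U).hom _ = 0
    simpa [hb'] using h
  have h := P.I_le c hx
  refine Submodule.span_induction (p := fun x _ => θ.1 x ∈ P.I c.U) ?_ ?_ ?_ ?_ h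
  · rintro _ ⟨b, hb, rfl⟩
    rw [show θ.1 _ = 0 from θ.2.1 b]
    exact Ideal.zero_mem _
  · rw [map_zero]
    exact Ideal.zero_mem _
  · intro x y _ _ h1 h2
    rw [map_add]
    exact Ideal.add_mem _ h1 h2
  · intro r x hx h1
    rw [smul_eq_mul, Derivation.leibniz]
    refine Ideal.add_mem _ (Ideal.mul_mem_left _ _ h1) ?_
    have hx' : x ∈ P.I c.U := (Ideal.span_le.mpr (by rintro _ ⟨b, hb, rfl⟩; exact hm b hb)) hx
    exact Ideal.mul_mem_right _ _ hx'

/-- The derivation of `X` induced by a derivation of `Y`. -/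
def redDer (c : AffChart P.g) (θ : LogDer P.g P.D c) :
    Derivation ℤ Γ(P.X, P.i ⁻¹ᵁ c.U) Γ(P.X, P.i ⁻¹ᵁ c.U) :=
  Derivation.liftOfSurjective (f := (P.red c.U).toIntAlgHom) (P.red_surjective c.affU)
    (d := θ.1) (fun x hx => P.LogDer_I c θ x hx)

theorem redDer_apply (c : AffChart P.g) (θ : LogDer P.g P.D c) (x : Γ(P.Y, c.U)) :
    P.redDer c θ (P.red c.U x) = P.red c.U (θ.1 x) :=
  Derivation.liftOfSurjective_apply (f := (P.red c.U).toIntAlgHom) (P.red_surjective c.affU)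
    (d := θ.1) (fun x hx => P.LogDer_I c θ x hx) x

/-- The logarithmic derivation of `X` induced by a logarithmic derivation of `Y`. -/
def redLog (c : AffChart P.g) (θ : LogDer P.g P.D c) : LogDer P.f P.D₀ (P.chart₀ c) :=
  ⟨P.redDer c θ, by
    intro b
    obtain ⟨b, rfl⟩ := (show Function.Surjective (P.j.app c.V).hom by
      have := P.closed
      exact P.j.app_surjective c.V c.affV) b
    have e := appLE_comp_app P.isPullback.w c.le (P.chart₀ c).le
    have h : P.red c.U ((P.g.appLE c.V c.U c.le).hom b) =
      (P.f.appLE (P.chart₀ c).V (P.chart₀ c).U (P.chart₀ c).le).hom ((P.j.app c.V).hom b) :=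
      congrArg (fun t => t.hom b) e
    rw [← h]
    refine (P.redDer_apply c θ _).trans ?_
    rw [θ.2.1 b]
    exact map_zero _, by
    have hle : (P.D.comap P.i).ideal ⟨P.i ⁻¹ᵁ c.U, (P.chart₀ c).affU⟩ ≤
        (P.D.ideal ⟨c.U, c.affU⟩).map (P.red c.U) := by
      have h := ideal_comap_le P.D P.i ⟨P.i ⁻¹ᵁ c.U, (P.chart₀ c).affU⟩ ⟨c.U, c.affU⟩ le_rfl
      rwa [← Scheme.Hom.app_eq_appLE] at h
    have hge : ∀ d ∈ P.D.ideal ⟨c.U, c.affU⟩, P.red c.U d ∈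
        (P.D.comap P.i).ideal ⟨P.i ⁻¹ᵁ c.U, (P.chart₀ c).affU⟩ := by
      intro d hd
      have h := le_ideal_comap P.D P.i ⟨P.i ⁻¹ᵁ c.U, (P.chart₀ c).affU⟩ ⟨c.U, c.affU⟩ le_rfl d hd
      rwa [← Scheme.Hom.app_eq_appLE] at h
    intro x hx
    obtain ⟨y, hy, rfl⟩ := (Ideal.mem_map_iff_of_surjective _ (P.red_surjective c.affU)).mp (hle hx)
    have h := hge _ (θ.2.2 y hy)
    rw [← P.redDer_apply] at h
    exact h⟩

/-! ### The complex `𝒞 = DR(End(V, ∇)_I) / Fil^0` on charts -/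

variable (E : FilteredDeRhamBundle P.f P.D₀)

/-- Sections of `V` over the part of `X` in `U`, as a module over `Γ(Y, U)`. -/
abbrev M (U : P.Y.Opens) := Γ((Scheme.Modules.pushforward P.i).obj E.V, U)

theorem smul_M (U : P.Y.Opens) (r : Γ(P.Y, U)) (v : Γ(E.V, P.i ⁻¹ᵁ U)) :
    (r • (show P.M E U from v) : P.M E U) = (P.red U r • v : Γ(E.V, P.i ⁻¹ᵁ U)) := rfl

/-- `∇_θ` on the sections of `V`, for a logarithmic derivation `θ` of `Y`. -/
def nab (c : AffChart P.g) (θ : LogDer P.g P.D c) : P.M E c.U →+ P.M E c.U :=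
  E.con.nab (P.chart₀ c) le_top (P.redLog c θ)

theorem nab_smul (c : AffChart P.g) (θ : LogDer P.g P.D c) (r : Γ(P.Y, c.U)) (v : P.M E c.U) :
    P.nab E c θ (r • v) = θ.1 r • v + r • P.nab E c θ v := by
  have h := E.con.leibniz (P.chart₀ c) le_top (P.redLog c θ) (P.red c.U r) v
  refine (show P.nab E c θ (r • v) = _ from h).trans ?_
  have e : (P.redLog c θ).1 (P.red c.U r) = P.red c.U (θ.1 r) := P.redDer_apply c θ r
  rw [e]
  rfl

/-- The filtration of `V`. -/
def filM (l : ℤ) (U : P.Y.Opens) : Submodule Γ(P.Y, U) (P.M E U) where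
  carrier := {v | v ∈ E.F.fil l (P.i ⁻¹ᵁ U) le_top}
  add_mem' := fun ha hb => Submodule.add_mem _ ha hb
  zero_mem' := Submodule.zero_mem _
  smul_mem' := fun r _ hv => Submodule.smul_mem (E.F.fil l (P.i ⁻¹ᵁ U) le_top) (P.red U r) hv

/-- Endomorphisms of `V`. -/
abbrev EndV (U : P.Y.Opens) := Module.End Γ(P.Y, U) (P.M E U)

/-- `Fil^l End(V)`. -/
def filEnd (l : ℤ) (U : P.Y.Opens) : Submodule Γ(P.Y, U) (P.EndV E U) where
  carrier := {φ | ∀ m, ∀ v ∈ P.filM E m U, φ v ∈ P.filM E (m + l) U}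
  add_mem' := fun ha hb m v hv => Submodule.add_mem _ (ha m v hv) (hb m v hv)
  zero_mem' := fun _ _ _ => Submodule.zero_mem _
  smul_mem' := fun r _ hφ m v hv => Submodule.smul_mem _ r (hφ m v hv)

/-- `End(V)_I = End(V) ⊗ I`. -/
abbrev A (U : P.Y.Opens) := P.EndV E U ⊗[Γ(P.Y, U)] P.I U

/-- `(Fil^l End(V))_I = Fil^l End(V) ⊗ I`, inside `End(V)_I`. -/
def filA (l : ℤ) (U : P.Y.Opens) : Submodule Γ(P.Y, U) (P.A E U) :=
  LinearMap.range (TensorProduct.map (P.filEnd E l U).subtype (LinearMap.id (M := P.I U)))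

theorem filA_anti {l m : ℤ} (h : l ≤ m) (U : P.Y.Opens) : P.filA E m U ≤ P.filA E l U := by
  have hle : P.filEnd E m U ≤ P.filEnd E l U := fun φ hφ n v hv =>
    E.F.anti (n + l) (n + m) (by omega) _ le_top (hφ n v hv)
  rintro _ ⟨x, rfl⟩
  refine ⟨TensorProduct.map (Submodule.inclusion hle) LinearMap.id x, ?_⟩
  rw [← LinearMap.comp_apply, ← TensorProduct.map_comp]
  rfl

/-- The commutator `[∇_θ, φ]`. -/
def comm (c : AffChart P.g) (θ : LogDer P.g P.D c) (φ : P.EndV E c.U) : P.EndV E c.U where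
  toFun v := P.nab E c θ (φ v) - φ (P.nab E c θ v)
  map_add' v w := by
    rw [map_add, map_add, map_add, map_add]
    abel
  map_smul' r v := by
    rw [map_smul, nab_smul, nab_smul, map_add, map_smul, map_smul, RingHom.id_apply, smul_sub]
    abel

/-- The action of `θ` on the ideal of `X` in `Y`. -/
def derI (c : AffChart P.g) (θ : LogDer P.g P.D c) : P.I c.U →+ P.I c.U where
  toFun a := ⟨θ.1 a, P.LogDer_I c θ a a.2⟩
  map_zero' := Subtype.ext (map_zero θ.1)
  map_add' a b := Subtype.ext (map_add θ.1 a.1 b.1)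

/-- The connection on `End(V)_I`, contracted with `θ`: `φ ⊗ a ↦ [∇_θ, φ] ⊗ a + φ ⊗ θ(a)`. -/
def nabA (c : AffChart P.g) (θ : LogDer P.g P.D c) : P.A E c.U →+ P.A E c.U :=
  TensorProduct.liftAddHom
    { toFun := fun φ =>
        { toFun := fun a => P.comm E c θ φ ⊗ₜ a + φ ⊗ₜ P.derI c θ a
          map_zero' := by
            rw [map_zero, TensorProduct.tmul_zero, TensorProduct.tmul_zero, add_zero]
          map_add' := fun a b => by
            rw [map_add, TensorProduct.tmul_add, TensorProduct.tmul_add]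
            abel }
      map_zero' := by
        ext a
        have : P.comm E c θ 0 = 0 := by
          ext v
          change P.nab E c θ 0 - 0 = 0
          rw [map_zero, sub_zero]
        simp [this]
      map_add' := fun φ ψ => by
        ext a
        have : P.comm E c θ (φ + ψ) = P.comm E c θ φ + P.comm E c θ ψ := by
          ext v
          change P.nab E c θ (φ v + ψ v) - (φ _ + ψ _) =
            (P.nab E c θ (φ v) - φ _) + (P.nab E c θ (ψ v) - ψ _)
          rw [map_add]
          abel
        change P.comm E c θ (φ + ψ) ⊗ₜ a + (φ + ψ) ⊗ₜ P.derI c θ a =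
          (P.comm E c θ φ ⊗ₜ a + φ ⊗ₜ P.derI c θ a) + (P.comm E c θ ψ ⊗ₜ a + ψ ⊗ₜ P.derI c θ a)
        rw [this, TensorProduct.add_tmul, TensorProduct.add_tmul]
        abel }
    (fun r φ a => by
      have h1 : P.comm E c θ (r • φ) = θ.1 r • φ + r • P.comm E c θ φ := by
        ext v
        change P.nab E c θ (r • φ v) - r • φ (P.nab E c θ v) =
          θ.1 r • φ v + r • (P.nab E c θ (φ v) - φ (P.nab E c θ v))
        rw [nab_smul, smul_sub]
        abel
      have h2 : P.derI c θ (r • a) = θ.1 r • a + r • P.derI c θ a := by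
        apply Subtype.ext
        change θ.1 (r * a.1) = θ.1 r * a.1 + r * θ.1 a.1
        rw [Derivation.leibniz, smul_eq_mul, smul_eq_mul]
        ring
      change P.comm E c θ (r • φ) ⊗ₜ a + (r • φ) ⊗ₜ P.derI c θ a =
        P.comm E c θ φ ⊗ₜ (r • a) + φ ⊗ₜ P.derI c θ (r • a)
      rw [h1, h2, TensorProduct.add_tmul, TensorProduct.tmul_add, TensorProduct.smul_tmul,
        TensorProduct.smul_tmul, TensorProduct.smul_tmul]
      abel)

theorem nabA_tmul (c : AffChart P.g) (θ : LogDer P.g P.D c) (φ : P.EndV E c.U) (a : P.I c.U) :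
    P.nabA E c θ (φ ⊗ₜ a) = P.comm E c θ φ ⊗ₜ a + φ ⊗ₜ P.derI c θ a := rfl

theorem nabA_filA (c : AffChart P.g) (θ : LogDer P.g P.D c) (l : ℤ) (x : P.A E c.U)
    (hx : x ∈ P.filA E l c.U) : P.nabA E c θ x ∈ P.filA E (l - 1) c.U := by
  have key : ∀ (k : ℤ) (φ : P.EndV E c.U) (a : P.I c.U), φ ∈ P.filEnd E k c.U →
      φ ⊗ₜ a ∈ P.filA E k c.U := fun k φ a h => ⟨(⟨φ, h⟩ : P.filEnd E k c.U) ⊗ₜ a, rfl⟩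
  obtain ⟨y, rfl⟩ := hx
  induction y using TensorProduct.induction_on with
  | zero => rw [map_zero, map_zero]; exact Submodule.zero_mem _
  | add y z hy hz => rw [map_add, map_add]; exact Submodule.add_mem _ hy hz
  | tmul φ a =>
    rw [TensorProduct.map_tmul, nabA_tmul]
    refine Submodule.add_mem _ (key _ _ _ ?_) (P.filA_anti E (by omega) _ (key _ _ _ φ.2))
    intro m v hv
    refine Submodule.sub_mem _ ?_ ?_
    · have h := E.griffiths (P.chart₀ c) le_top (P.redLog c θ) (m + l) (φ.1 v) (φ.2 m v hv)
      rw [show m + (l - 1) = m + l - 1 by ring]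
      exact h
    · have h := E.griffiths (P.chart₀ c) le_top (P.redLog c θ) m v hv
      rw [show m + (l - 1) = m - 1 + l by ring]
      exact φ.2 (m - 1) _ h

/-- `End(V)_I / (Fil^{-p} End(V))_I`; the degree `p` term of `𝒞` is its tensor product with
`Ω^p(log D)`. -/
def Q (p : ℤ) (U : P.Y.Opens) : Type u := P.A E U ⧸ P.filA E (-p) U

instance (p : ℤ) (U : P.Y.Opens) : AddCommGroup (P.Q E p U) :=
  inferInstanceAs (AddCommGroup (P.A E U ⧸ P.filA E (-p) U))

instance (p : ℤ) (U : P.Y.Opens) : Module Γ(P.Y, U) (P.Q E p U) :=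
  inferInstanceAs (Module Γ(P.Y, U) (P.A E U ⧸ P.filA E (-p) U))

/-- The class of an element of `End(V)_I`. -/
def mkQ (p : ℤ) (U : P.Y.Opens) : P.A E U →ₗ[Γ(P.Y, U)] P.Q E p U := Submodule.mkQ _

/-- The projection `End(V)_I / Fil^{-p} → End(V)_I / Fil^{-p-1}`. -/
def projQ (p : ℤ) (U : P.Y.Opens) : P.Q E p U →ₗ[Γ(P.Y, U)] P.Q E (p + 1) U :=
  Submodule.factor (P.filA_anti E (by omega) U)

/-- The connection on `𝒞`, contracted with `θ`. -/
def nabQ (p : ℤ) (c : AffChart P.g) (θ : LogDer P.g P.D c) : P.Q E p c.U →+ P.Q E (p + 1) c.U :=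
  QuotientAddGroup.map (P.filA E (-p) c.U).toAddSubgroup (P.filA E (-(p + 1)) c.U).toAddSubgroup
    (P.nabA E c θ) (fun x hx => by
      have h := P.nabA_filA E c θ (-p) x hx
      rw [show -p - 1 = -(p + 1) by ring] at h
      exact h)

/-! ### Cochains -/

/-- The graph of the restriction map of `End(V)_I` from `U` to `W`. -/
def relA {U W : P.Y.Opens} (h : W ≤ U) : AddSubgroup (P.A E U × P.A E W) :=
  AddSubgroup.closure {x | ∃ (φ : P.EndV E U) (ψ : P.EndV E W) (a : P.I U) (b : P.I W),
    (∀ v, ψ (resM ((Scheme.Modules.pushforward P.i).obj E.V) h v) =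
      resM ((Scheme.Modules.pushforward P.i).obj E.V) h (φ v)) ∧
    b.1 = resO h a.1 ∧ x = (φ ⊗ₜ a, ψ ⊗ₜ b)}

/-- `y` is the restriction of `x`, for sections of `End(V)_I / Fil^{-p}`. -/
def ResQ {p : ℤ} {U W : P.Y.Opens} (h : W ≤ U) (x : P.Q E p U) (y : P.Q E p W) : Prop :=
  ∃ α β, (α, β) ∈ P.relA E h ∧ P.mkQ E p U α = x ∧ P.mkQ E p W β = y

theorem ResQ.add {p : ℤ} {U W : P.Y.Opens} {h : W ≤ U} {x x' : P.Q E p U} {y y' : P.Q E p W}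
    (H : P.ResQ E h x y) (H' : P.ResQ E h x' y') : P.ResQ E h (x + x') (y + y') := by
  obtain ⟨α, β, m, rfl, rfl⟩ := H
  obtain ⟨α', β', m', rfl, rfl⟩ := H'
  exact ⟨α + α', β + β', AddSubgroup.add_mem _ m m', map_add _ _ _, map_add _ _ _⟩

theorem ResQ.neg {p : ℤ} {U W : P.Y.Opens} {h : W ≤ U} {x : P.Q E p U} {y : P.Q E p W}
    (H : P.ResQ E h x y) : P.ResQ E h (-x) (-y) := by
  obtain ⟨α, β, m, rfl, rfl⟩ := H
  exact ⟨-α, -β, AddSubgroup.neg_mem _ m, map_neg _ _, map_neg _ _⟩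

theorem ResQ.zero {p : ℤ} {U W : P.Y.Opens} (h : W ≤ U) :
    P.ResQ E h (0 : P.Q E p U) (0 : P.Q E p W) :=
  ⟨0, 0, AddSubgroup.zero_mem _, map_zero _, map_zero _⟩

/-- The charts of `Y/T` contained in the open subset `O`. -/
abbrev ChartsIn (O : P.Y.Opens) := {c : AffChart P.g // c.U ≤ O}

/-- Sections over `O` of `𝒞⁰ = End(V)_I / Fil^0`: compatible families of sections on charts. -/
def secs₀ (O : P.Y.Opens) : AddSubgroup (∀ c : P.ChartsIn O, P.Q E 0 c.1.U) where
  carrier := {s | ∀ (c c' : P.ChartsIn O) (h : c'.1.U ≤ c.1.U), P.ResQ E h (s c) (s c')}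
  add_mem' := fun hs ht c c' h => (hs c c' h).add P E (ht c c' h)
  zero_mem' := fun _ _ h => ResQ.zero P E h
  neg_mem' := fun hs c c' h => (hs c c' h).neg P E

/-- Sections over `O` of `𝒞¹ = (End(V)_I / Fil^{-1}) ⊗ Ω¹(log D)`: compatible families of linear
forms on the logarithmic derivations. -/
def secs₁ (O : P.Y.Opens) : AddSubgroup
    (∀ c : P.ChartsIn O, LogDer P.g P.D c.1 →ₗ[Γ(P.Y, c.1.U)] P.Q E 1 c.1.U) where
  carrier := {s | ∀ (c c' : P.ChartsIn O) (h : c'.1.U ≤ c.1.U) (θ : LogDer P.g P.D c.1)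
    (θ' : LogDer P.g P.D c'.1), DerRes h θ θ' → P.ResQ E h (s c θ) (s c' θ')}
  add_mem' := fun hs ht c c' h θ θ' hθ => (hs c c' h θ θ' hθ).add P E (ht c c' h θ θ' hθ)
  zero_mem' := fun _ _ h _ _ _ => ResQ.zero P E h
  neg_mem' := fun hs c c' h θ θ' hθ => (hs c c' h θ θ' hθ).neg P E

/-- The group of sections of `𝒞⁰` over `O`. -/
def C₀ (O : P.Y.Opens) : Type u := P.secs₀ E O

/-- The group of sections of `𝒞¹` over `O`. -/
def C₁ (O : P.Y.Opens) : Type u := P.secs₁ E O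

instance (O : P.Y.Opens) : AddCommGroup (P.C₀ E O) := inferInstanceAs (AddCommGroup (P.secs₀ E O))

instance (O : P.Y.Opens) : AddCommGroup (P.C₁ E O) := inferInstanceAs (AddCommGroup (P.secs₁ E O))

/-- The value of a section of `𝒞⁰` on a chart. -/
def ev₀ {O : P.Y.Opens} (c : AffChart P.g) (h : c.U ≤ O) : P.C₀ E O →+ P.Q E 0 c.U where
  toFun s := s.1 ⟨c, h⟩
  map_zero' := rfl
  map_add' _ _ := rfl

/-- The value of a section of `𝒞¹` on a logarithmic derivation on a chart. -/
def ev₁ {O : P.Y.Opens} (c : AffChart P.g) (h : c.U ≤ O) (θ : LogDer P.g P.D c) :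
    P.C₁ E O →+ P.Q E 1 c.U where
  toFun s := s.1 ⟨c, h⟩ θ
  map_zero' := rfl
  map_add' _ _ := rfl

/-- Restriction of sections of `𝒞⁰`. -/
def resC₀ {O O' : P.Y.Opens} (h : O' ≤ O) : P.C₀ E O →+ P.C₀ E O' where
  toFun s := ⟨fun c => s.1 ⟨c.1, c.2.trans h⟩,
    fun c c' hc => s.2 ⟨c.1, c.2.trans h⟩ ⟨c'.1, c'.2.trans h⟩ hc⟩
  map_zero' := rfl
  map_add' _ _ := rfl

/-- Restriction of sections of `𝒞¹`. -/
def resC₁ {O O' : P.Y.Opens} (h : O' ≤ O) : P.C₁ E O →+ P.C₁ E O' where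
  toFun s := ⟨fun c => s.1 ⟨c.1, c.2.trans h⟩, fun c c' hc θ θ' hθ =>
    s.2 ⟨c.1, c.2.trans h⟩ ⟨c'.1, c'.2.trans h⟩ hc θ θ' hθ⟩
  map_zero' := rfl
  map_add' _ _ := rfl

/-- The hypercohomology group `ℍ⁰(𝒞)`: global sections of `𝒞⁰` killed by the differential. -/
def H₀ : AddSubgroup (P.C₀ E ⊤) where
  carrier := {s | ∀ (c : AffChart P.g) (θ : LogDer P.g P.D c),
    P.nabQ E 0 c θ (P.ev₀ E c le_top s) = 0}
  add_mem' := fun hs ht c θ => by rw [map_add, map_add, hs, ht, add_zero]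
  zero_mem' := fun c θ => by rw [map_zero, map_zero]
  neg_mem' := fun hs c θ => by rw [map_neg, map_neg, hs, neg_zero]

/-- An open cover of `Y` indexed by the points of `Y`, each point lying in its own member. These
covers are cofinal among all open covers. -/
structure Cover where
  U : P.Y → P.Y.Opens
  mem : ∀ y, y ∈ U y

/-- Covers are ordered by refinement. -/
instance : Preorder P.Cover where
  le a b := ∀ y, b.U y ≤ a.U y
  le_refl _ _ := le_rfl
  le_trans _ _ _ h h' y := (h' y).trans (h y)

instance : Nonempty P.Cover := ⟨⟨fun _ => ⊤, fun _ => trivial⟩⟩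

instance : IsDirectedOrder P.Cover :=
  ⟨fun a b => ⟨⟨fun y => a.U y ⊓ b.U y, fun y => ⟨a.mem y, b.mem y⟩⟩,
    fun _ => inf_le_left, fun _ => inf_le_right⟩⟩

/-- Čech cochains of total degree `1`: sections `a x y` of `𝒞⁰` on `U x ∩ U y` and `b x` of `𝒞¹`
on `U x`. -/
abbrev Cochain (𝒰 : P.Cover) :=
  (∀ x y : P.Y, P.C₀ E (𝒰.U x ⊓ 𝒰.U y)) × (∀ x : P.Y, P.C₁ E (𝒰.U x))

/-- Čech cocycles of total degree `1`: pairs with `δ a = 0`, `∇ a = δ b` and `∇ b = 0`. -/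
def Z₁ (𝒰 : P.Cover) : AddSubgroup (P.Cochain E 𝒰) where
  carrier := {z |
    (∀ (x y w : P.Y) (c : AffChart P.g) (hx : c.U ≤ 𝒰.U x) (hy : c.U ≤ 𝒰.U y) (hw : c.U ≤ 𝒰.U w),
      P.ev₀ E c (le_inf hy hw) (z.1 y w) - P.ev₀ E c (le_inf hx hw) (z.1 x w) +
        P.ev₀ E c (le_inf hx hy) (z.1 x y) = 0) ∧
    (∀ (x y : P.Y) (c : AffChart P.g) (hx : c.U ≤ 𝒰.U x) (hy : c.U ≤ 𝒰.U y) (θ : LogDer P.g P.D c),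
      P.nabQ E 0 c θ (P.ev₀ E c (le_inf hx hy) (z.1 x y)) =
        P.ev₁ E c hy θ (z.2 y) - P.ev₁ E c hx θ (z.2 x)) ∧
    (∀ (x : P.Y) (c : AffChart P.g) (hx : c.U ≤ 𝒰.U x) (θ η : LogDer P.g P.D c),
      P.nabQ E 1 c θ (P.ev₁ E c hx η (z.2 x)) - P.nabQ E 1 c η (P.ev₁ E c hx θ (z.2 x)) -
        P.projQ E 1 c.U (P.ev₁ E c hx (LogDer.bracket θ η) (z.2 x)) = 0)}
  add_mem' := fun {z z'} h h' => by
    refine ⟨fun x y w c hx hy hw => ?_, fun x y c hx hy θ => ?_, fun x c hx θ η => ?_⟩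
    · rw [← add_zero (0 : P.Q E 0 c.U)]
      nth_rewrite 1 [← h.1 x y w c hx hy hw]
      rw [← h'.1 x y w c hx hy hw]
      simp only [Prod.fst_add, Pi.add_apply, map_add]
      abel
    · simp only [Prod.fst_add, Prod.snd_add, Pi.add_apply, map_add]
      rw [h.2.1 x y c hx hy θ, h'.2.1 x y c hx hy θ]
      abel
    · rw [← add_zero (0 : P.Q E (1 + 1) c.U)]
      nth_rewrite 1 [← h.2.2 x c hx θ η]
      rw [← h'.2.2 x c hx θ η]
      simp only [Prod.snd_add, Pi.add_apply, map_add]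
      abel
  zero_mem' := by
    refine ⟨fun x y w c hx hy hw => ?_, fun x y c hx hy θ => ?_, fun x c hx θ η => ?_⟩ <;>
    simp only [Prod.fst_zero, Prod.snd_zero, Pi.zero_apply, map_zero, sub_zero, add_zero]
  neg_mem' := fun {z} h => by
    refine ⟨fun x y w c hx hy hw => ?_, fun x y c hx hy θ => ?_, fun x c hx θ η => ?_⟩
    · refine Eq.trans ?_ (neg_eq_zero.mpr (h.1 x y w c hx hy hw))
      simp only [Prod.fst_neg, Pi.neg_apply, map_neg]
      abel
    · simp only [Prod.fst_neg, Prod.snd_neg, Pi.neg_apply, map_neg]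
      rw [h.2.1 x y c hx hy θ]
      abel
    · refine Eq.trans ?_ (neg_eq_zero.mpr (h.2.2 x c hx θ η))
      simp only [Prod.snd_neg, Pi.neg_apply, map_neg]
      abel

/-- Čech coboundaries: the cocycles `(δ g, ∇ g)`. -/
def B₁ (𝒰 : P.Cover) : AddSubgroup (P.Z₁ E 𝒰) where
  carrier := {z | ∃ g : ∀ x : P.Y, P.C₀ E (𝒰.U x),
    (∀ (x y : P.Y) (c : AffChart P.g) (hx : c.U ≤ 𝒰.U x) (hy : c.U ≤ 𝒰.U y),
      P.ev₀ E c (le_inf hx hy) (z.1.1 x y) = P.ev₀ E c hy (g y) - P.ev₀ E c hx (g x)) ∧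
    (∀ (x : P.Y) (c : AffChart P.g) (hx : c.U ≤ 𝒰.U x) (θ : LogDer P.g P.D c),
      P.ev₁ E c hx θ (z.1.2 x) = P.nabQ E 0 c θ (P.ev₀ E c hx (g x)))}
  add_mem' := fun {z z'} h h' => by
    obtain ⟨g, h1, h2⟩ := h
    obtain ⟨g', h1', h2'⟩ := h'
    refine ⟨g + g', fun x y c hx hy => ?_, fun x c hx θ => ?_⟩
    · simp only [AddSubgroup.coe_add, Prod.fst_add, Pi.add_apply, map_add]
      rw [h1 x y c hx hy, h1' x y c hx hy]
      abel
    · simp only [AddSubgroup.coe_add, Prod.snd_add, Pi.add_apply, map_add]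
      rw [h2 x c hx θ, h2' x c hx θ]
  zero_mem' := by
    refine ⟨0, fun x y c hx hy => ?_, fun x c hx θ => ?_⟩ <;>
    simp only [AddSubgroup.coe_zero, Prod.fst_zero, Prod.snd_zero, Pi.zero_apply, map_zero, sub_zero]
  neg_mem' := fun {z} h => by
    obtain ⟨g, h1, h2⟩ := h
    refine ⟨-g, fun x y c hx hy => ?_, fun x c hx θ => ?_⟩
    · simp only [AddSubgroup.coe_neg, Prod.fst_neg, Pi.neg_apply, map_neg]
      rw [h1 x y c hx hy]
      abel
    · simp only [AddSubgroup.coe_neg, Prod.snd_neg, Pi.neg_apply, map_neg]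
      rw [h2 x c hx θ]

/-- The Čech hypercohomology group of degree `1` of a cover. -/
abbrev CechH₁ (𝒰 : P.Cover) := P.Z₁ E 𝒰 ⧸ P.B₁ E 𝒰

/-- Restriction of cocycles to a finer cover. -/
def resZ₁ {𝒰 𝒱 : P.Cover} (h : 𝒰 ≤ 𝒱) : P.Z₁ E 𝒰 →+ P.Z₁ E 𝒱 where
  toFun z := ⟨(fun x y => P.resC₀ E (inf_le_inf (h x) (h y)) (z.1.1 x y),
      fun x => P.resC₁ E (h x) (z.1.2 x)),
    fun x y w c hx hy hw => z.2.1 x y w c (hx.trans (h x)) (hy.trans (h y)) (hw.trans (h w)),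
    fun x y c hx hy θ => z.2.2.1 x y c (hx.trans (h x)) (hy.trans (h y)) θ,
    fun x c hx θ η => z.2.2.2 x c (hx.trans (h x)) θ η⟩
  map_zero' := rfl
  map_add' _ _ := rfl

/-- Restriction of Čech cohomology classes to a finer cover. -/
def resH₁ (𝒰 𝒱 : P.Cover) (h : 𝒰 ≤ 𝒱) : P.CechH₁ E 𝒰 →+ P.CechH₁ E 𝒱 :=
  QuotientAddGroup.map (P.B₁ E 𝒰) (P.B₁ E 𝒱) (P.resZ₁ E h) (by
    rintro z ⟨g, h1, h2⟩
    exact ⟨fun x => P.resC₀ E (h x) (g x),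
      fun x y c hx hy => h1 x y c (hx.trans (h x)) (hy.trans (h y)),
      fun x c hx θ => h2 x c (hx.trans (h x)) θ⟩)

instance : DirectedSystem (P.CechH₁ E) (P.resH₁ E · · ·) where
  map_self 𝒰 x := by
    obtain ⟨z, rfl⟩ := QuotientAddGroup.mk_surjective x
    rfl
  map_map 𝒰 𝒱 𝒲 h h' x := by
    obtain ⟨z, rfl⟩ := QuotientAddGroup.mk_surjective x
    rfl

/-- The hypercohomology group `ℍ¹(𝒞)`: the colimit of Čech hypercohomology over all covers. -/
abbrev H₁ := DirectLimit (P.CechH₁ E) (P.resH₁ E)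

/-- The class of a Čech cocycle. -/
def cls {𝒰 : P.Cover} (z : P.Z₁ E 𝒰) : P.H₁ E :=
  Quotient.mk _ ⟨𝒰, QuotientAddGroup.mk z⟩

/-! ### Lifts -/

/-- A lift of the de Rham bundle underlying `E` to `(Y, D)/T`: a vector bundle `W` with an
integrable logarithmic connection together with an identification, given by the reduction map `ρ`,
of its restriction to `X` with `(V, ∇)`. -/
structure DeRhamLift where
  W : P.Y.Modules
  vb : IsVectorBundle W
  con : LogConnection P.g P.D W ⊤
  integrable : con.Integrable
  ρ : W ⟶ (Scheme.Modules.pushforward P.i).obj E.V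
  surj : ∀ U : P.Y.Opens, IsAffineOpen U → Function.Surjective (ρ.app U)
  ker : ∀ U : P.Y.Opens, IsAffineOpen U → ∀ w : Γ(W, U),
    ρ.app U w = 0 ↔ w ∈ (P.I U) • (⊤ : Submodule Γ(P.Y, U) Γ(W, U))
  lifts : ∀ (c : AffChart P.g) (θ : LogDer P.g P.D c) (w : Γ(W, c.U)),
    ρ.app c.U (con.nab c le_top θ w) = P.nab E c θ (ρ.app c.U w)

variable {P E} (L : P.DeRhamLift E)

/-- A logarithmic connection on `W` over `O` lifts `∇`. -/
def ConLifts {O : P.Y.Opens} (N : LogConnection P.g P.D L.W O) : Prop :=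
  ∀ (c : AffChart P.g) (h : c.U ≤ O) (θ : LogDer P.g P.D c) (w : Γ(L.W, c.U)),
    L.ρ.app c.U (N.nab c h θ w) = P.nab E c θ (L.ρ.app c.U w)

/-- A filtration of `W` over `O` lifts the filtration of `V`: it restricts to it on `X`. -/
def FilLifts {O : P.Y.Opens} (F : Filtration L.W O) : Prop :=
  ∀ (l : ℤ) (U : P.Y.Opens) (hU : U ≤ O), IsAffineOpen U → ∀ v : P.M E U,
    v ∈ P.filM E l U ↔ ∃ w ∈ F.fil l U hU, L.ρ.app U w = v

/-- A Hodge filtration on the lifted de Rham bundle that lifts the given one. -/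
structure HodgeLift where
  F : Filtration L.W ⊤
  lifts : FilLifts L F
  griffiths : Griffiths L.con F

/-- A local lift over `O`: a connection, not necessarily integrable, and a filtration lifting the
given ones and satisfying Griffiths transversality. -/
structure LocalLift (O : P.Y.Opens) where
  con : LogConnection P.g P.D L.W O
  con_lifts : ConLifts L con
  F : Filtration L.W O
  lifts : FilLifts L F
  griffiths : Griffiths con F

/-- A system of local lifts on the members of a cover. -/
structure LocalSystem where
  𝒰 : P.Cover
  loc : ∀ y, LocalLift L (𝒰.U y)

/-- Local isomorphisms of filtered bundles lifting the identity of `(V, Fil)`. Since the ideal of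
`X` in `Y` has square zero, such an endomorphism of `W` is automatically an isomorphism that
identifies the two filtrations. -/
structure LocalIso {O₁ O₂ : P.Y.Opens} (F₁ : Filtration L.W O₁) (F₂ : Filtration L.W O₂)
    (O : P.Y.Opens) (h₁ : O ≤ O₁) (h₂ : O ≤ O₂) where
  map : ∀ U : P.Y.Opens, U ≤ O → Module.End Γ(P.Y, U) Γ(L.W, U)
  res : ∀ U hU U' hU' (h : U' ≤ U) (w : Γ(L.W, U)),
    map U' hU' (resM L.W h w) = resM L.W h (map U hU w)
  lifts : ∀ U hU (w : Γ(L.W, U)), L.ρ.app U (map U hU w) = L.ρ.app U w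
  fil : ∀ l U hU, ∀ w ∈ F₁.fil l U (hU.trans h₁), map U hU w ∈ F₂.fil l U (hU.trans h₂)

/-- The graph of the isomorphism `ι : End(V)_I ≅ I · End(W)`, `ι(φ ⊗ a) = a φ'` for any lift `φ'` of
`φ`. -/
def relι (U : P.Y.Opens) : AddSubgroup (P.A E U × Module.End Γ(P.Y, U) Γ(L.W, U)) :=
  AddSubgroup.closure {x | ∃ (φ : P.EndV E U) (a : P.I U) (φ' : Module.End Γ(P.Y, U) Γ(L.W, U)),
    (∀ w, L.ρ.app U (φ' w) = φ (L.ρ.app U w)) ∧ x = (φ ⊗ₜ a, a.1 • φ')}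

/-- `q` is the class of `ι⁻¹(ψ)` in `End(V)_I / Fil^{-p}`. -/
def IsClass {p : ℤ} {U : P.Y.Opens} (q : P.Q E p U) (ψ : Module.End Γ(P.Y, U) Γ(L.W, U)) : Prop :=
  ∃ α, (α, ψ) ∈ relι L U ∧ P.mkQ E p U α = q

/-- `z` is the cocycle `((ι⁻¹(1 - f_{xy})), (ι⁻¹(∇_x - ∇)))` of a system of local lifts. The
isomorphisms `f_{xy}` between the local filtrations are only required locally on the overlaps; as
the sections of `End(V)_I / Fil^0` they define do not depend on choices, they glue. -/
def Represents (S : LocalSystem L) (z : P.Z₁ E S.𝒰) : Prop :=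
  (∀ (x y : P.Y) (O : P.Y.Opens) (hx : O ≤ S.𝒰.U x) (hy : O ≤ S.𝒰.U y)
    (f : LocalIso L (S.loc x).F (S.loc y).F O hx hy) (c : AffChart P.g) (hc : c.U ≤ O),
      IsClass L (P.ev₀ E c (hc.trans (le_inf hx hy)) (z.1.1 x y)) (1 - f.map c.U hc)) ∧
  (∀ (x : P.Y) (c : AffChart P.g) (hc : c.U ≤ S.𝒰.U x) (θ : LogDer P.g P.D c),
    ∃ ψ : Module.End Γ(P.Y, c.U) Γ(L.W, c.U),
      (∀ w, ψ w = (S.loc x).con.nab c hc θ w - L.con.nab c le_top θ w) ∧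
        IsClass L (P.ev₁ E c hc θ (z.1.2 x)) ψ)

/-- `s` is the difference class `(ι⁻¹(1 - f))` of two Hodge filtrations, for local isomorphisms `f`
from the first to the second lifting the identity; these exist locally. -/
def IsDifference (F F' : HodgeLift L) (s : P.H₀ E) : Prop :=
  (∀ y : P.Y, ∃ O : P.Y.Opens, y ∈ O ∧ Nonempty (LocalIso L F.F F'.F O le_top le_top)) ∧
  ∀ (O : P.Y.Opens) (f : LocalIso L F.F F'.F O le_top le_top) (c : AffChart P.g) (hc : c.U ≤ O),
    IsClass L (P.ev₀ E c le_top s.1) (1 - f.map c.U hc)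

end LogThickening

end

end HodgeDef

/-!
Everything is computed on charts, that is, on affine opens `U` of `Y` over affine opens of `T`. There
the sections of the lifted bundle `W` form a finite projective module, the sections of `V` are its
reduction modulo an ideal `I` of square zero, and a lift of the filtration consists of direct
summands (`Filtration.exists_projection`). Since `End(W)` is flat, `ι` identifies `End(V) ⊗ I` with
the endomorphisms of `W` that vanish modulo `I` (`SqZeroReduction.iota_injective`,
`SqZeroReduction.exists_iota_eq`). These kill `I W`, so products of two of them vanish. Any lift of
the filtration detects the filtration on `End(V) ⊗ I`: an endomorphism `ι α` lowers it by at most `p`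
if and only if the class of `α` in `End(V)_I / Fil^{-p}` vanishes (`IsClass.eq_zero_iff`). This
criterion turns every identity in the complex `𝒞` into a statement on degrees of endomorphisms
of `W`.

Local lifts exist: a compatible family of projections onto the steps of the filtration lifts to
idempotents (`SqZeroReduction.exists_idempotents`), and truncating the given connection along a
splitting gives a transverse one (`exists_griffiths`). Between two local lifts `A` and `B` on a chart
there is a filtered homomorphism `f` lifting the identity, unique up to endomorphisms of degree zero
that vanish modulo `I`. Hence the class `LocalLift.diff A B` of `1 - f` is well defined, and it is
additive, because `1 - g f = (1 - f) + (1 - g)`. As `f ∇_A - ∇_B f` has degree `-1`, its differential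
is the difference of the classes of `∇_B - ∇` and `∇_A - ∇` (`LocalLift.nabQ_diff`). As the curvature
of `∇_A` has degree `-2`, these classes are closed (`LocalLift.nabQ_conClass`). So a system of local
lifts defines a cocycle, and additivity of `diff` shows that two systems have cohomologous cocycles on
a common refinement (`LocalSystem.cls_cocycle_eq`).

If the cocycle is the coboundary of a family `g`, then the local filtrations `(1 + ψ) F x`, for `ψ` in
the class `g x`, agree on overlaps and are transverse for the given connection, so that they glue
to a global lift whose difference from `F x` is controlled by `g x` (`LocalSystem.exists_hodgeLift`).
Applied to an arbitrary system, this gives the obstruction statement. Applied to the constant system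
of a global lift, it shows that every class in `ℍ⁰(𝒞)` is a difference of two lifts, and a lift is
determined by its difference from a given one, so that the lifts form a torsor.
-/

namespace HodgeDef

/-! ### Endomorphisms along a square-zero reduction -/

section Algebra

variable {R W M : Type*} [CommRing R] [AddCommGroup W] [Module R W] [AddCommGroup M] [Module R M]

/-- `ρ : W → M` is the reduction of `W` modulo an ideal `I` of square zero. -/
structure SqZeroReduction (I : Ideal R) (ρ : W →ₗ[R] M) : Prop where
  sq : ∀ a ∈ I, ∀ b ∈ I, a * b = 0
  surj : Function.Surjective ρ
  ker : ∀ w, ρ w = 0 ↔ w ∈ I • (⊤ : Submodule R W)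

namespace SqZeroReduction

variable {I : Ideal R} {ρ : W →ₗ[R] M}

theorem smul_eq_zero (h : SqZeroReduction I ρ) {a : R} (ha : a ∈ I) {w : W} (hw : ρ w = 0) :
    a • w = 0 := by
  refine Submodule.smul_induction_on (p := fun w => a • w = 0) ((h.ker w).1 hw) ?_ ?_
  · intro b hb x _
    rw [smul_smul, h.sq a ha b hb, zero_smul]
  · intro x y hx hy
    rw [smul_add, hx, hy, add_zero]

theorem smul_red (h : SqZeroReduction I ρ) {a : R} (ha : a ∈ I) (w : W) : ρ (a • w) = 0 :=
  (h.ker _).2 (Submodule.smul_mem_smul ha trivial)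

theorem map_eq_zero (h : SqZeroReduction I ρ) (φ : Module.End R W) {w : W} (hw : ρ w = 0) :
    ρ (φ w) = 0 := by
  refine Submodule.smul_induction_on (p := fun w => ρ (φ w) = 0) ((h.ker w).1 hw) ?_ ?_
  · intro b hb x _
    rw [map_smul]
    exact h.smul_red hb _
  · intro x y hx hy
    rw [map_add, map_add, hx, hy, add_zero]

theorem map_congr (h : SqZeroReduction I ρ) (φ : Module.End R W) {w w' : W} (hw : ρ w = ρ w') :
    ρ (φ w) = ρ (φ w') := by
  rw [← sub_eq_zero, ← map_sub, ← map_sub]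
  exact h.map_eq_zero φ (by rw [map_sub, hw, sub_self])

/-- A homomorphism that vanishes modulo `I` kills everything that vanishes modulo `I`. -/
theorem apply_eq_zero (h : SqZeroReduction I ρ) {ψ : Module.End R W} (hψ : ∀ w, ρ (ψ w) = 0)
    {w : W} (hw : ρ w = 0) : ψ w = 0 := by
  refine Submodule.smul_induction_on (p := fun w => ψ w = 0) ((h.ker w).1 hw) ?_ ?_
  · intro b hb x _
    rw [map_smul]
    exact h.smul_eq_zero hb (hψ x)
  · intro x y hx hy
    rw [map_add, hx, hy, add_zero]

theorem apply_congr (h : SqZeroReduction I ρ) {ψ : Module.End R W} (hψ : ∀ w, ρ (ψ w) = 0)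
    {w w' : W} (hw : ρ w = ρ w') : ψ w = ψ w' := by
  rw [← sub_eq_zero, ← map_sub]
  exact h.apply_eq_zero hψ (by rw [map_sub, hw, sub_self])

theorem exists_red (h : SqZeroReduction I ρ) (φ' : Module.End R W) :
    ∃ φ : Module.End R M, ∀ w, φ (ρ w) = ρ (φ' w) := by
  refine ⟨(LinearMap.ker ρ).liftQ (ρ ∘ₗ φ') (fun w hw => h.map_eq_zero φ' hw) ∘ₗ
    (ρ.quotKerEquivOfSurjective h.surj).symm.toLinearMap, fun w => ?_⟩
  have : (ρ.quotKerEquivOfSurjective h.surj).symm (ρ w) = Submodule.Quotient.mk w := by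
    rw [LinearEquiv.symm_apply_eq]
    rfl
  rw [LinearMap.comp_apply, LinearEquiv.coe_coe, this]
  rfl

/-- Reduction of endomorphisms modulo `I`. -/
noncomputable def red (h : SqZeroReduction I ρ) : Module.End R W →ₗ[R] Module.End R M where
  toFun φ' := (h.exists_red φ').choose
  map_add' φ ψ := by
    ext v
    obtain ⟨w, rfl⟩ := h.surj v
    rw [(h.exists_red _).choose_spec, LinearMap.add_apply, LinearMap.add_apply,
      (h.exists_red _).choose_spec, (h.exists_red _).choose_spec, map_add]
  map_smul' r φ := by
    ext v
    obtain ⟨w, rfl⟩ := h.surj v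
    rw [(h.exists_red _).choose_spec, LinearMap.smul_apply, RingHom.id_apply,
      LinearMap.smul_apply, (h.exists_red _).choose_spec, map_smul]

theorem red_apply (h : SqZeroReduction I ρ) (φ' : Module.End R W) (w : W) :
    h.red φ' (ρ w) = ρ (φ' w) := (h.exists_red φ').choose_spec w

theorem red_eq (h : SqZeroReduction I ρ) {φ' : Module.End R W} {φ : Module.End R M}
    (hφ : ∀ w, ρ (φ' w) = φ (ρ w)) : h.red φ' = φ := by
  ext v
  obtain ⟨w, rfl⟩ := h.surj v
  rw [h.red_apply, hφ]

theorem exists_lift [Module.Projective R W] (h : SqZeroReduction I ρ) (φ : Module.End R M) :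
    ∃ φ' : Module.End R W, ∀ w, ρ (φ' w) = φ (ρ w) := by
  obtain ⟨φ', hφ⟩ := Module.projective_lifting_property ρ (φ ∘ₗ ρ) h.surj
  exact ⟨φ', fun w => LinearMap.congr_fun hφ w⟩

theorem red_surjective [Module.Projective R W] (h : SqZeroReduction I ρ) :
    Function.Surjective h.red := fun φ =>
  let ⟨φ', hφ⟩ := h.exists_lift φ
  ⟨φ', h.red_eq hφ⟩

/-- Multiples of an endomorphism by elements of `I` depend only on its reduction, so `ι` is well
defined. -/
theorem smul_lift_eq (h : SqZeroReduction I ρ) {a : R} (ha : a ∈ I) {φ ψ : Module.End R W}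
    (e : ∀ w, ρ (φ w) = ρ (ψ w)) : a • φ = a • ψ := by
  ext w
  rw [← sub_eq_zero, LinearMap.smul_apply, LinearMap.smul_apply, ← smul_sub]
  exact h.smul_eq_zero ha (by rw [map_sub, e, sub_self])

/-- The map `ι : End(M) ⊗ I → End(W)`, `φ ⊗ a ↦ a φ'` for any lift `φ'` of `φ`. -/
noncomputable def iota [Module.Projective R W] (h : SqZeroReduction I ρ) :
    Module.End R M ⊗[R] I →ₗ[R] Module.End R W :=
  TensorProduct.lift (LinearMap.mk₂ R (fun φ a => (a : R) • (h.exists_lift φ).choose)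
    (fun φ ψ a => by
      rw [← smul_add]
      refine h.smul_lift_eq a.2 fun w => ?_
      rw [(h.exists_lift _).choose_spec, LinearMap.add_apply, LinearMap.add_apply, map_add,
        (h.exists_lift _).choose_spec, (h.exists_lift _).choose_spec])
    (fun r φ a => by
      rw [smul_comm]
      refine h.smul_lift_eq a.2 fun w => ?_
      rw [(h.exists_lift _).choose_spec, LinearMap.smul_apply, LinearMap.smul_apply, map_smul,
        (h.exists_lift _).choose_spec])
    (fun φ a b => by rw [Submodule.coe_add, add_smul])
    (fun r φ a => by rw [Submodule.coe_smul, smul_assoc]))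

theorem iota_tmul [Module.Projective R W] (h : SqZeroReduction I ρ) {φ : Module.End R M}
    {φ' : Module.End R W} (hφ : ∀ w, ρ (φ' w) = φ (ρ w)) (a : I) :
    h.iota (φ ⊗ₜ a) = (a : R) • φ' := by
  refine h.smul_lift_eq a.2 fun w => ?_
  rw [(h.exists_lift _).choose_spec, hφ]

theorem _root_.Module.End.flat_of_projective [Module.Finite R W] [Module.Projective R W] :
    Module.Flat R (Module.End R W) := by
  obtain ⟨n, f, g, -, -, hfg⟩ := Module.Finite.exists_comp_eq_id_of_projective R W
  have : Module.Flat R (Fin n → W) :=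
    Module.Flat.of_linearEquiv (DFinsupp.linearEquivFunOnFintype (M := fun _ : Fin n => W)).symm
  have : Module.Flat R ((Fin n → R) →ₗ[R] W) :=
    Module.Flat.of_linearEquiv ((Pi.basisFun R (Fin n)).constr R : (Fin n → W) ≃ₗ[R] _).symm
  refine Module.Flat.of_retract (LinearMap.lcomp R W f) (LinearMap.lcomp R W g) ?_
  ext φ w
  exact congrArg φ (LinearMap.congr_fun hfg w)

/-- Endomorphisms of `M` lift to `W`, so `α` comes from an element of `End(W) ⊗ I`; as `End(W)` is flat,
the multiplication map from there to `End(W)` is injective. -/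
theorem iota_injective [Module.Finite R W] [Module.Projective R W] (h : SqZeroReduction I ρ) :
    Function.Injective h.iota := by
  rw [injective_iff_map_eq_zero]
  intro α hα
  obtain ⟨β, rfl⟩ := LinearMap.rTensor_surjective I h.red_surjective α
  have key : ∀ β : Module.End R W ⊗[R] I, h.iota (LinearMap.rTensor I h.red β) =
      TensorProduct.rid R _ (LinearMap.lTensor (Module.End R W) I.subtype β) := by
    intro β
    induction β using TensorProduct.induction_on with
    | zero => simp
    | add x y hx hy => simp only [map_add, hx, hy]
    | tmul φ a =>
      rw [LinearMap.rTensor_tmul, LinearMap.lTensor_tmul, TensorProduct.rid_tmul]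
      exact h.iota_tmul (fun w => (h.red_apply φ w).symm) a
  rw [key] at hα
  have := Module.End.flat_of_projective (R := R) (W := W)
  have inj := Module.Flat.lTensor_preserves_injective_linearMap (M := Module.End R W) I.subtype
    Subtype.val_injective
  have : β = 0 := by
    apply inj
    rw [map_zero]
    exact (LinearEquiv.map_eq_zero_iff _).1 hα
  rw [this, map_zero]

theorem red_iota [Module.Projective R W] (h : SqZeroReduction I ρ) (α : Module.End R M ⊗[R] I)
    (w : W) : ρ (h.iota α w) = 0 := by
  induction α using TensorProduct.induction_on with
  | zero => simp
  | add x y hx hy => rw [map_add, LinearMap.add_apply, map_add, hx, hy, add_zero]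
  | tmul φ a =>
    obtain ⟨φ', hφ⟩ := h.exists_lift φ
    rw [h.iota_tmul hφ]
    exact h.smul_red a.2 _

/-- The image of `ι` consists of all endomorphisms that vanish modulo `I`: such an endomorphism is a
sum of endomorphisms `w ↦ l w • u` with a linear form `l` and `u ∈ I W`. -/
theorem exists_iota_eq [Module.Finite R W] [Module.Projective R W] (h : SqZeroReduction I ρ)
    {ψ : Module.End R W} (hψ : ∀ w, ρ (ψ w) = 0) : ∃ α, h.iota α = ψ := by
  have key : ∀ u ∈ I • (⊤ : Submodule R W), ∀ l : W →ₗ[R] R,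
      l.smulRight u ∈ LinearMap.range h.iota := by
    intro u hu
    refine Submodule.smul_induction_on (p := fun u => ∀ l : W →ₗ[R] R,
      l.smulRight u ∈ LinearMap.range h.iota) hu ?_ ?_
    · intro a ha x _ l
      refine ⟨h.red (l.smulRight x) ⊗ₜ ⟨a, ha⟩, ?_⟩
      rw [h.iota_tmul (φ' := l.smulRight x) (fun w => (h.red_apply _ w).symm)]
      ext w
      rw [LinearMap.smul_apply, LinearMap.smulRight_apply, LinearMap.smulRight_apply, smul_comm]
    · intro x y hx hy l
      have : l.smulRight (x + y) = l.smulRight x + l.smulRight y := by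
        ext w
        simp
      rw [this]
      exact Submodule.add_mem _ (hx l) (hy l)
  obtain ⟨n, f, g, -, -, hfg⟩ := Module.Finite.exists_comp_eq_id_of_projective R W
  have e : ψ = ∑ k, (LinearMap.proj k ∘ₗ g).smulRight (ψ (f (Pi.single k 1))) := by
    ext w
    have h1 : w = f (g w) := (LinearMap.congr_fun hfg w).symm
    conv_lhs => rw [h1, ← Finset.univ_sum_single (g w)]
    rw [map_sum, map_sum, LinearMap.sum_apply]
    refine Finset.sum_congr rfl fun k _ => ?_
    rw [LinearMap.smulRight_apply, LinearMap.comp_apply, LinearMap.proj_apply, ← map_smul,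
      ← map_smul]
    congr 2
    rw [← Pi.single_smul, smul_eq_mul, mul_one]
  rw [e]
  exact Submodule.sum_mem _ fun k _ => key _ ((h.ker _).1 (hψ _)) _

theorem mul_eq_zero (h : SqZeroReduction I ρ) {φ ψ : Module.End R W} (hφ : ∀ w, ρ (φ w) = 0)
    (hψ : ∀ w, ρ (ψ w) = 0) : φ * ψ = 0 := by
  ext w
  exact h.apply_eq_zero hφ (hψ w)

end SqZeroReduction

/-! ### Filtered homomorphisms -/

/-- `F` is a finite filtration of `W` by direct summands whose image in `M` is the filtration
`G`. -/
structure FilteredLift (ρ : W →ₗ[R] M) (G : ℤ → Submodule R M) (F : ℤ → Submodule R W) : Prop where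
  anti : ∀ l m, l ≤ m → F m ≤ F l
  proj : ∀ l, ∃ p : Module.End R W, (∀ w, p w ∈ F l) ∧ ∀ w ∈ F l, p w = w
  map : ∀ l v, v ∈ G l ↔ ∃ w ∈ F l, ρ w = v
  bdd : ∃ N : ℕ, F (-N) = ⊤ ∧ F (N + 1) = ⊥

/-- A splitting of a finite filtration: a decomposition of the identity into endomorphisms `e k`
with image in `F (d k)`, such that `e k` kills `F m` if `d k < m`. It is obtained from arbitrary
projections `p l` onto `F l` as the differences `p l - p (l + 1)`; these need not be idempotent. -/
theorem exists_splitting {F : ℤ → Submodule R W} (p : ℤ → Module.End R W) (N : ℕ)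
    (anti : ∀ l m, l ≤ m → F m ≤ F l) (hp : ∀ l w, p l w ∈ F l) (hp' : ∀ l, ∀ w ∈ F l, p l w = w)
    (top : F (-N) = ⊤) (bot : F (N + 1) = ⊥) :
    (∀ (k : ℕ) w, (p (k - N) - p (k - N + 1)) w ∈ F (k - N)) ∧
    (∀ w, ∑ k ∈ Finset.range (2 * N + 1), (p (k - N) - p (k - N + 1)) w = w) ∧
    ∀ m, ∀ w ∈ F m, ∀ k : ℕ, (k : ℤ) - N < m → (p (k - N) - p (k - N + 1)) w = 0 := by
  refine ⟨fun k w => Submodule.sub_mem _ (hp _ _) (anti _ _ (by omega) (hp _ _)), fun w => ?_,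
    fun m w hw k hk => ?_⟩
  · have h := Finset.sum_range_sub' (fun k : ℕ => p (k - N) w) (2 * N + 1)
    have e1 : p (((0 : ℕ) : ℤ) - N) w = w := hp' _ _ (by
      rw [Nat.cast_zero, zero_sub, top]
      trivial)
    have e2 : p (((2 * N + 1 : ℕ) : ℤ) - N) w = 0 := by
      have := hp (((2 * N + 1 : ℕ) : ℤ) - N) w
      rwa [show (((2 * N + 1 : ℕ) : ℤ) - N) = N + 1 by push_cast; ring, bot,
        Submodule.mem_bot, show ((N : ℤ) + 1) = (((2 * N + 1 : ℕ) : ℤ) - N) by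
          push_cast; ring] at this
    rw [e1, e2, sub_zero] at h
    rw [← h]
    refine Finset.sum_congr rfl fun k _ => ?_
    rw [LinearMap.sub_apply]
    congr 3
    push_cast
    ring
  · rw [LinearMap.sub_apply, hp' _ _ (anti _ _ (by omega) hw), hp' _ _ (anti _ _ (by omega) hw),
      sub_self]

namespace FilteredLift

variable {I : Ideal R} {ρ : W →ₗ[R] M} {G : ℤ → Submodule R M} {F F' : ℤ → Submodule R W}

theorem exists_proj (hF : FilteredLift ρ G F) : ∃ p : ℤ → Module.End R W,
    (∀ l w, p l w ∈ F l) ∧ ∀ l, ∀ w ∈ F l, p l w = w :=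
  ⟨fun l => (hF.proj l).choose, fun l => (hF.proj l).choose_spec.1,
    fun l => (hF.proj l).choose_spec.2⟩

theorem exists_splitting (hF : FilteredLift ρ G F) :
    ∃ (n : ℕ) (d : ℕ → ℤ) (e : ℕ → Module.End R W), (∀ k w, e k w ∈ F (d k)) ∧
      (∀ w, ∑ k ∈ Finset.range n, e k w = w) ∧ ∀ m, ∀ w ∈ F m, ∀ k, d k < m → e k w = 0 := by
  obtain ⟨p, hp, hp'⟩ := hF.exists_proj
  obtain ⟨N, top, bot⟩ := hF.bdd
  exact ⟨2 * N + 1, fun k => k - N, _, HodgeDef.exists_splitting p N hF.anti hp hp' top bot⟩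

theorem red_mem (hF : FilteredLift ρ G F) {l : ℤ} {w : W} (hw : w ∈ F l) : ρ w ∈ G l :=
  (hF.map l _).2 ⟨w, hw, rfl⟩

theorem red_proj (h : SqZeroReduction I ρ) (hF : FilteredLift ρ G F) {l : ℤ}
    {p : Module.End R W} (hp : ∀ w ∈ F l, p w = w) {w : W} (hw : ρ w ∈ G l) : ρ (p w) = ρ w := by
  obtain ⟨u, hu, e⟩ := (hF.map l _).1 hw
  rw [← h.map_congr p e, hp u hu, e]

/-- Multiples by `I` depend on the filtration only through its reduction. -/
theorem smul_mem (h : SqZeroReduction I ρ) (hF : FilteredLift ρ G F) {l : ℤ} {a : R} (ha : a ∈ I)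
    {w : W} (hw : ρ w ∈ G l) : a • w ∈ F l := by
  obtain ⟨u, hu, e⟩ := (hF.map l _).1 hw
  rw [← sub_add_cancel w u, smul_add, h.smul_eq_zero ha (by rw [map_sub, e, sub_self]), zero_add]
  exact Submodule.smul_mem _ a hu

/-- Two lifts of a filtration are related by a filtered homomorphism that lifts the identity: the sum
of the `q (d k) ∘ e k`, for a splitting `e` of the first filtration and projections `q l` onto the
steps of the second one. -/
theorem exists_filtered_id (h : SqZeroReduction I ρ) (hF : FilteredLift ρ G F)
    (hF' : FilteredLift ρ G F') : ∃ f : Module.End R W, (∀ w, ρ (f w) = ρ w) ∧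
      ∀ m, ∀ w ∈ F m, f w ∈ F' m := by
  obtain ⟨n, d, e, he, hsum, hz⟩ := hF.exists_splitting
  obtain ⟨q, hq, hq'⟩ := hF'.exists_proj
  refine ⟨∑ k ∈ Finset.range n, q (d k) * e k, fun w => ?_, fun m w hw => ?_⟩
  · conv_rhs => rw [← hsum w]
    rw [LinearMap.sum_apply, map_sum, map_sum]
    refine Finset.sum_congr rfl fun k _ => ?_
    exact hF'.red_proj h (hq' _) (hF.red_mem (he k w))
  · rw [LinearMap.sum_apply]
    refine Submodule.sum_mem _ fun k _ => ?_
    rw [Module.End.mul_apply]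
    by_cases hk : d k < m
    · rw [hz m w hw k hk, map_zero]
      exact Submodule.zero_mem _
    · exact hF'.anti _ _ (not_lt.1 hk) (hq _ _)

/-- The homomorphisms of filtered modules of degree `l` are a direct summand of all
homomorphisms: `φ` is truncated to the sum of the `q (d k + l) ∘ φ ∘ e k`. -/
theorem exists_truncation (hF : FilteredLift ρ G F) (hF' : FilteredLift ρ G F') (l : ℤ) :
    ∃ T : Module.End R W →ₗ[R] Module.End R W, (∀ φ m, ∀ w ∈ F m, T φ w ∈ F' (m + l)) ∧
      ∀ φ : Module.End R W, (∀ m, ∀ w ∈ F m, φ w ∈ F' (m + l)) → T φ = φ := by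
  obtain ⟨n, d, e, he, hsum, hz⟩ := hF.exists_splitting
  obtain ⟨q, hq, hq'⟩ := hF'.exists_proj
  refine ⟨∑ k ∈ Finset.range n,
    LinearMap.mulLeft R (q (d k + l)) ∘ₗ LinearMap.mulRight R (e k), fun φ m w hw => ?_,
    fun φ hφ => ?_⟩
  · rw [LinearMap.sum_apply, LinearMap.sum_apply]
    refine Submodule.sum_mem _ fun k _ => ?_
    by_cases hk : d k < m
    · have : (LinearMap.mulLeft R (q (d k + l)) ∘ₗ LinearMap.mulRight R (e k)) φ w =
        q (d k + l) (φ (e k w)) := rfl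
      rw [this, hz m w hw k hk, map_zero, map_zero]
      exact Submodule.zero_mem _
    · exact hF'.anti _ _ (by omega) (hq (d k + l) _)
  · ext w
    conv_rhs => rw [← hsum w]
    rw [LinearMap.sum_apply, LinearMap.sum_apply, map_sum]
    refine Finset.sum_congr rfl fun k _ => ?_
    exact hq' _ _ (hφ _ _ (he k w))

variable [Module.Projective R W] (S : Submodule R (Module.End R M)) (l : ℤ)

/-- If `S` consists of endomorphisms of degree `l`, then the image of `S ⊗ I` under `ι` respects any
lifts of the filtration with degree `l`. -/
theorem iota_mem (h : SqZeroReduction I ρ) (hF : FilteredLift ρ G F) (hF' : FilteredLift ρ G F')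
    (hS : ∀ φ ∈ S, ∀ m, ∀ v ∈ G m, φ v ∈ G (m + l)) {α : Module.End R M ⊗[R] I}
    (hα : α ∈ LinearMap.range (TensorProduct.map S.subtype (LinearMap.id (M := I))))
    (m : ℤ) (w : W) (hw : w ∈ F m) : h.iota α w ∈ F' (m + l) := by
  obtain ⟨β, rfl⟩ := hα
  induction β using TensorProduct.induction_on with
  | zero =>
    rw [map_zero, map_zero]
    exact Submodule.zero_mem _
  | add x y hx hy =>
    rw [map_add, map_add]
    exact Submodule.add_mem _ hx hy
  | tmul φ a =>
    obtain ⟨φ', hφ⟩ := h.exists_lift φ.1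
    have e : TensorProduct.map S.subtype (LinearMap.id (M := I)) (φ ⊗ₜ[R] a) = φ.1 ⊗ₜ a := rfl
    rw [e, h.iota_tmul hφ]
    refine hF'.smul_mem h a.2 ?_
    rw [hφ]
    exact hS _ φ.2 _ _ (hF.red_mem hw)

/-- Conversely, if `S` contains all endomorphisms of degree `l` and `ι α` has degree `l`, then `α` comes
from `S ⊗ I`. Truncation in degree `l` fixes `ι α`, and it sends `ι (φ ⊗ a)` to `ι (φ₁ ⊗ a)` with `φ₁`
of degree `l`. -/
theorem mem_range_of_iota [Module.Finite R W] (h : SqZeroReduction I ρ) (hF : FilteredLift ρ G F)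
    (hF' : FilteredLift ρ G F') (hS : ∀ φ, (∀ m, ∀ v ∈ G m, φ v ∈ G (m + l)) → φ ∈ S)
    {α : Module.End R M ⊗[R] I} (hα : ∀ m, ∀ w ∈ F m, h.iota α w ∈ F' (m + l)) :
    α ∈ LinearMap.range (TensorProduct.map S.subtype (LinearMap.id (M := I))) := by
  obtain ⟨T, hT, hT'⟩ := hF.exists_truncation hF' l
  have key : ∀ α, ∃ β ∈ LinearMap.range (TensorProduct.map S.subtype (LinearMap.id (M := I))),
      h.iota β = T (h.iota α) := by
    intro α
    induction α using TensorProduct.induction_on with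
    | zero => exact ⟨0, Submodule.zero_mem _, by rw [map_zero, map_zero]⟩
    | add x y hx hy =>
      obtain ⟨β, hβ, e⟩ := hx
      obtain ⟨γ, hγ, e'⟩ := hy
      exact ⟨β + γ, Submodule.add_mem _ hβ hγ, by rw [map_add, map_add, map_add, e, e']⟩
    | tmul φ a =>
      obtain ⟨φ', hφ⟩ := h.exists_lift φ
      have hmem : h.red (T φ') ∈ S := by
        refine hS _ fun m v hv => ?_
        obtain ⟨w, hw, rfl⟩ := (hF.map m v).1 hv
        rw [h.red_apply]
        exact hF'.red_mem (hT _ _ _ hw)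
      refine ⟨h.red (T φ') ⊗ₜ a, ⟨(⟨_, hmem⟩ : S) ⊗ₜ a, rfl⟩, ?_⟩
      rw [h.iota_tmul (fun w => (h.red_apply _ w).symm), h.iota_tmul hφ, map_smul]
  obtain ⟨β, hβ, e⟩ := key α
  rw [hT' _ hα] at e
  rwa [← h.iota_injective e]

end FilteredLift

/-! ### Lifting filtrations -/

/-- A finite filtration by direct summands lifts, as the ranges of a compatible family of
idempotents. If `b` is idempotent modulo `I`, then `3 b ^ 2 - 2 b ^ 3` is idempotent; it is applied
to the product of the projection already constructed with a lift of the next one, so that the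
new range lies in the previous one. -/
theorem SqZeroReduction.exists_idempotents [Module.Projective R W] {I : Ideal R} {ρ : W →ₗ[R] M}
    (h : SqZeroReduction I ρ) {G : ℤ → Submodule R M} (anti : ∀ l m, l ≤ m → G m ≤ G l)
    (proj : ∀ l, ∃ p : Module.End R M, (∀ v, p v ∈ G l) ∧ ∀ v ∈ G l, p v = v)
    (N : ℕ) (top : G (-N) = ⊤) (bot : G (N + 1) = ⊥) :
    ∃ P : ℤ → Module.End R W, (∀ l m, l ≤ m → P l * P m = P m) ∧
      P (-N) = 1 ∧ P (N + 1) = 0 ∧ (∀ l w, ρ (P l w) ∈ G l) ∧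
      ∀ l w, ρ w ∈ G l → ρ (P l w) = ρ w := by
  choose p hp hp' using proj
  choose Q hQ using fun l => h.exists_lift (p l)
  let step (k : ℕ) (a : Module.End R W) : Module.End R W :=
    3 * (a * Q (k + 1 - N)) ^ 2 - 2 * (a * Q (k + 1 - N)) ^ 3
  let a : ℕ → Module.End R W := fun k => Nat.rec 1 step k
  have ha0 : a 0 = 1 := rfl
  have ha1 : ∀ k, a (k + 1) = 3 * (a k * Q (k + 1 - N)) ^ 2 - 2 * (a k * Q (k + 1 - N)) ^ 3 :=
    fun _ => rfl
  have num : ∀ (c : Module.End R W) w, (3 * c ^ 2 - 2 * c ^ 3 : Module.End R W) w =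
      c (c w) + c (c w) + c (c w) - (c (c (c w)) + c (c (c w))) := by
    intro c w
    have : 3 * c ^ 2 - 2 * c ^ 3 = c * c + c * c + c * c - (c * (c * c) + c * (c * c)) := by
      noncomm_ring
    rw [this]
    rfl
  have red : ∀ k, (∀ w, ρ (a k w) = p (k - N) (ρ w)) := by
    intro k
    induction k with
    | zero =>
      intro w
      rw [ha0, Module.End.one_apply, Nat.cast_zero, zero_sub, hp' _ _ (by rw [top]; trivial)]
    | succ k ih =>
      have hb : ∀ w, ρ ((a k * Q (k + 1 - N)) w) = p (k + 1 - N) (ρ w) := by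
        intro w
        rw [Module.End.mul_apply, ih, hQ, hp']
        exact anti _ _ (by omega) (hp _ _)
      intro w
      rw [ha1, num]
      simp only [map_sub, map_add, hb, hp' _ _ (hp _ _)]
      push_cast
      abel
  have idem : ∀ k, a k * a k = a k := by
    intro k
    cases k with
    | zero => rw [ha0, one_mul]
    | succ k =>
      rw [ha1]
      set b := a k * Q (k + 1 - N) with hb
      have hb' : ∀ w, ρ (b w) = p (k + 1 - N) (ρ w) := by
        intro w
        rw [hb, Module.End.mul_apply, red, hQ, hp']
        exact anti _ _ (by omega) (hp _ _)
      have hz : ∀ w, ρ ((b * b - b) w) = 0 := by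
        intro w
        rw [LinearMap.sub_apply, map_sub, Module.End.mul_apply, hb', hb', hp' _ _ (hp _ _), sub_self]
      have h0 := h.mul_eq_zero hz hz
      have : (3 * b ^ 2 - 2 * b ^ 3) * (3 * b ^ 2 - 2 * b ^ 3) - (3 * b ^ 2 - 2 * b ^ 3) =
          (b * b - b) * (b * b - b) * (4 * b ^ 2 - 4 * b - 3) := by
        noncomm_ring
      rwa [h0, zero_mul, sub_eq_zero] at this
  have nest : ∀ j k, j ≤ k → a j * a k = a k := by
    intro j k hjk
    induction hjk with
    | refl => exact idem j
    | @step k _ ih =>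
      rw [ha1]
      have : a j * (a k * Q (k + 1 - N)) = a k * Q (k + 1 - N) := by rw [← mul_assoc, ih]
      set b := a k * Q (k + 1 - N)
      have : a j * (3 * b ^ 2 - 2 * b ^ 3) = 3 * (a j * b) * b - 2 * (a j * b) * b ^ 2 := by
        noncomm_ring
      rw [this, ‹a j * b = b›]
      noncomm_ring
  refine ⟨fun l => a (l + N).toNat, fun l m hlm => nest _ _ (Int.toNat_le_toNat (by omega)), ?_,
    ?_, fun l w => ?_, fun l w hw => ?_⟩
  · change a (-N + N : ℤ).toNat = 1
    rw [neg_add_cancel]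
    exact ha0
  · change a ((N : ℤ) + 1 + N).toNat = 0
    rw [show ((N : ℤ) + 1 + N).toNat = 2 * N + 1 by omega]
    have hb : ∀ w, ρ ((a (2 * N) * Q ((2 * N : ℕ) + 1 - N)) w) = 0 := by
      intro w
      have := anti _ _ (show ((2 * N : ℕ) : ℤ) - N ≤ (2 * N : ℕ) + 1 - N by omega)
        (hp ((2 * N : ℕ) + 1 - N) (ρ w))
      rw [Module.End.mul_apply, red, hQ, hp' _ _ this]
      have := hp ((2 * N : ℕ) + 1 - N) (ρ w)
      rwa [show ((2 * N : ℕ) : ℤ) + 1 - N = N + 1 by push_cast; ring, bot, Submodule.mem_bot,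
        show (N : ℤ) + 1 = ((2 * N : ℕ) : ℤ) + 1 - N by push_cast; ring] at this
    have h0 := h.mul_eq_zero hb hb
    rw [ha1, pow_three, pow_two, h0, mul_zero, mul_zero, mul_zero, sub_zero]
  · change ρ (a _ w) ∈ _
    rw [red]
    by_cases hl : -(N : ℤ) ≤ l
    · have := hp l (ρ w)
      rwa [show (((l + N).toNat : ℕ) : ℤ) - N = l by omega]
    · have e : G l = ⊤ := top_le_iff.1 (top ▸ anti l (-N) (by omega))
      rw [e]
      trivial
  · change ρ (a _ w) = _
    rw [red]
    by_cases hl : -(N : ℤ) ≤ l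
    · rw [show (((l + N).toNat : ℕ) : ℤ) - N = l by omega]
      exact hp' _ _ hw
    · rw [show (((l + N).toNat : ℕ) : ℤ) - N = -N by omega]
      exact hp' _ _ (by rw [top]; trivial)

end Algebra

/-! ### Sections of sheaves of modules on affine opens -/

section Sheaf

variable {X : Scheme.{u}}

theorem resO_resO {U W W' : X.Opens} (h : W ≤ U) (h' : W' ≤ W) (r : Γ(X, U)) :
    resO h' (resO h r) = resO (h'.trans h) r := by
  have e := X.presheaf.map_comp (homOfLE h).op (homOfLE h').op
  exact (congrArg (fun t => t.hom r) e).symm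

theorem resO_self {U : X.Opens} (h : U ≤ U) (r : Γ(X, U)) : resO h r = r :=
  congrArg (fun t => t.hom r) (X.presheaf.map_id (.op U))

theorem basicOpen_resO {U W : X.Opens} (h : W ≤ U) (r : Γ(X, U)) :
    X.basicOpen (resO h r) = W ⊓ X.basicOpen r := X.basicOpen_res r (homOfLE h).op

theorem isUnit_resO {U W : X.Opens} (f : Γ(X, U)) (h : W ≤ U) (hW : W ≤ X.basicOpen f) :
    IsUnit (resO h f) := by
  have : IsUnit (resO (X.basicOpen_le f) f) := X.toRingedSpace.isUnit_res_basicOpen f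
  have := this.map (resO hW)
  rwa [resO_resO] at this

theorem resO_eq_zero {U : X.Opens} (hU : IsAffineOpen U) (f : Γ(X, U)) {W : X.Opens} (h : W ≤ U)
    (e : W = X.basicOpen f) (r : Γ(X, U)) (hr : resO h r = 0) : ∃ n : ℕ, f ^ n * r = 0 := by
  have := hU.isLocalization_of_eq_basicOpen f (homOfLE h) e
  let _ := (X.presheaf.map (homOfLE h).op).hom.toAlgebra
  obtain ⟨⟨_, n, rfl⟩, hn⟩ := (IsLocalization.map_eq_zero_iff (Submonoid.powers f) Γ(X, W) r).1 hr
  exact ⟨n, hn⟩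

theorem exists_resO_eq {U : X.Opens} (hU : IsAffineOpen U) (f : Γ(X, U)) {W : X.Opens} (h : W ≤ U)
    (e : W = X.basicOpen f) (r : Γ(X, W)) : ∃ (n : ℕ) (r' : Γ(X, U)),
      resO h r' = resO h f ^ n * r := by
  have := hU.isLocalization_of_eq_basicOpen f (homOfLE h) e
  let _ := (X.presheaf.map (homOfLE h).op).hom.toAlgebra
  obtain ⟨⟨r', ⟨_, n, rfl⟩⟩, hr⟩ := IsLocalization.surj (Submonoid.powers f) r
  refine ⟨n, r', ?_⟩
  rw [mul_comm, ← map_pow]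
  exact hr.symm

variable (V : X.Modules)

theorem resM_resM {U W W' : X.Opens} (h : W ≤ U) (h' : W' ≤ W) (v : Γ(V, U)) :
    resM V h' (resM V h v) = resM V (h'.trans h) v := by
  have e := V.presheaf.map_comp (homOfLE h).op (homOfLE h').op
  exact (congrArg (fun t => t.hom v) e).symm

theorem resM_smul {U W : X.Opens} (h : W ≤ U) (r : Γ(X, U)) (v : Γ(V, U)) :
    resM V h (r • v) = resO h r • resM V h v := V.map_smul (homOfLE h) r v

theorem resM_pow_smul {U W : X.Opens} (h : W ≤ U) (r : Γ(X, U)) (n : ℕ) (v : Γ(V, U)) :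
    resM V h (r ^ n • v) = resO h r ^ n • resM V h v := by
  rw [resM_smul, map_pow]

theorem resM_sum {U W : X.Opens} (h : W ≤ U) {ι : Type*} (s : Finset ι) (v : ι → Γ(V, U)) :
    resM V h (∑ k ∈ s, v k) = ∑ k ∈ s, resM V h (v k) := map_sum _ _ _

theorem resM_ext {U : X.Opens} (v w : Γ(V, U))
    (H : ∀ x ∈ U, ∃ (W : X.Opens) (h : W ≤ U), x ∈ W ∧ resM V h v = resM V h w) : v = w := by
  choose W h hx e using H
  refine TopCat.Sheaf.eq_of_locally_eq' ⟨V.presheaf, V.isSheaf⟩ (fun x : U => W x.1 x.2) U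
    (fun x => homOfLE (h x.1 x.2)) (fun x hxU => ?_) v w (fun x => e x.1 x.2)
  exact Opens.mem_iSup.2 ⟨⟨x, hxU⟩, hx x hxU⟩

theorem exists_glue {ι : Type*} {U : X.Opens} (W : ι → X.Opens) (h : ∀ k, W k ≤ U)
    (cover : ∀ x ∈ U, ∃ k, x ∈ W k) (s : ∀ k, Γ(V, W k))
    (compat : ∀ k l, resM V inf_le_left (s k) = resM V (inf_le_right : W k ⊓ W l ≤ W l) (s l)) :
    ∃ v : Γ(V, U), ∀ k, resM V (h k) v = s k := by
  obtain ⟨v, hv, -⟩ := TopCat.Sheaf.existsUnique_gluing' ⟨V.presheaf, V.isSheaf⟩ W U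
    (fun k => homOfLE (h k)) (fun x hxU => Opens.mem_iSup.2 (cover x hxU)) s compat
  exact ⟨v, hv⟩

/-- Every point of an affine open has a basic neighbourhood inside a given neighbourhood. -/
theorem exists_basicOpen {U : X.Opens} (hU : IsAffineOpen U) {x : X} (hx : x ∈ U) {O : X.Opens}
    (hO : x ∈ O) : ∃ f : Γ(X, U), X.basicOpen f ≤ O ∧ x ∈ X.basicOpen f :=
  hU.exists_basicOpen_le ⟨x, hO⟩ hx

/-- An affine open is covered by finitely many basic opens that are small of a given order. -/
theorem exists_basicOpen_cover {U : X.Opens} (hU : IsAffineOpen U) (Q : X.Opens → Prop)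
    (hQ : ∀ x ∈ U, ∃ O : X.Opens, x ∈ O ∧ ∀ W, W ≤ O → W ≤ U → Q W) :
    ∃ s : Finset Γ(X, U), Ideal.span (s : Set Γ(X, U)) = ⊤ ∧ (∀ f ∈ s, Q (X.basicOpen f)) ∧
      ∀ x ∈ U, ∃ f ∈ s, x ∈ X.basicOpen f := by
  have h1 : Ideal.span {f : Γ(X, U) | Q (X.basicOpen f)} = ⊤ := by
    rw [← hU.self_le_iSup_basicOpen_iff]
    intro x hx
    obtain ⟨O, hxO, hO⟩ := hQ x hx
    obtain ⟨f, hf, hxf⟩ := exists_basicOpen hU hx hxO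
    exact Opens.mem_iSup.2 ⟨⟨f, hO _ hf (X.basicOpen_le f)⟩, hxf⟩
  obtain ⟨s, hs, hs'⟩ := (Ideal.span_eq_top_iff_finite _).1 h1
  refine ⟨s, hs', fun f hf => hs hf, fun x hx => ?_⟩
  obtain ⟨f, hf⟩ := Opens.mem_iSup.1 ((hU.self_le_iSup_basicOpen_iff).2 hs' hx)
  exact ⟨f.1, f.2, hf⟩

/-- On the affine open `U`, the sections of `V` over basic opens are the localizations of the
sections over `U`. -/
structure QCAt (U : X.Opens) : Prop where
  inj : ∀ (f : Γ(X, U)) (W : X.Opens) (h : W ≤ U), W = X.basicOpen f → ∀ v : Γ(V, U),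
    resM V h v = 0 → ∃ n : ℕ, f ^ n • v = 0
  surj : ∀ (f : Γ(X, U)) (W : X.Opens) (h : W ≤ U), W = X.basicOpen f → ∀ v : Γ(V, W),
    ∃ (n : ℕ) (v' : Γ(V, U)), resM V h v' = resO h f ^ n • v

variable {V}

theorem pow_smul_eq_zero_of_le {R M : Type*} [CommRing R] [AddCommGroup M] [Module R M] {r : R}
    {v : M} {m n : ℕ} (hmn : m ≤ n) (hv : r ^ m • v = 0) : r ^ n • v = 0 := by
  rw [← Nat.sub_add_cancel hmn, pow_add, mul_smul, hv, smul_zero]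

theorem QCAt.of_basis {O U : X.Opens} (hU : IsAffineOpen U) (hUO : U ≤ O) {n : ℕ}
    (e : Fin n → Γ(V, O)) (he : ∀ (W : X.Opens) (h : W ≤ O),
      LinearIndependent Γ(X, W) (fun k => resM V h (e k)) ∧
        Submodule.span Γ(X, W) (Set.range fun k => resM V h (e k)) = ⊤) : QCAt V U where
  inj f W h hW v hv := by
    obtain ⟨c, rfl⟩ := (Submodule.mem_span_range_iff_exists_fun Γ(X, U)).1
      ((he U hUO).2 ▸ Submodule.mem_top : v ∈ Submodule.span _ _)
    simp only [resM_sum, resM_smul, resM_resM] at hv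
    have h0 := Fintype.linearIndependent_iff.1 (he W (h.trans hUO)).1 (fun k => resO h (c k)) hv
    choose m hm using fun k => resO_eq_zero hU f h hW (c k) (h0 k)
    refine ⟨Finset.univ.sup m, ?_⟩
    rw [Finset.smul_sum]
    refine Finset.sum_eq_zero fun k hk => ?_
    have := pow_smul_eq_zero_of_le (r := f) (v := c k) (Finset.le_sup (f := m) hk) (hm k)
    rw [← smul_assoc, this, zero_smul]
  surj f W h hW v := by
    obtain ⟨c, rfl⟩ := (Submodule.mem_span_range_iff_exists_fun Γ(X, W)).1
      ((he W (h.trans hUO)).2 ▸ Submodule.mem_top : v ∈ Submodule.span _ _)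
    choose m c' hm using fun k => exists_resO_eq hU f h hW (c k)
    refine ⟨Finset.univ.sup m, ∑ k, (f ^ (Finset.univ.sup m - m k) * c' k) • resM V hUO (e k), ?_⟩
    rw [resM_sum, Finset.smul_sum]
    refine Finset.sum_congr rfl fun k hk => ?_
    rw [resM_smul, resM_resM, map_mul, map_pow, hm, ← mul_assoc, ← pow_add,
      Nat.sub_add_cancel (Finset.le_sup (f := m) hk), mul_smul]

/-- Being a localization on basic opens is a local property. A section over the basic open of `f` is
extended after multiplication by a power of `f` that clears the denominators on the members of
the cover and makes the resulting sections agree on their overlaps. -/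
theorem QCAt.of_cover {U : X.Opens} (hU : IsAffineOpen U) (s : Finset Γ(X, U))
    (hs : ∀ x ∈ U, ∃ f ∈ s, x ∈ X.basicOpen f)
    (H : ∀ f ∈ s, ∀ W : X.Opens, W ≤ X.basicOpen f → IsAffineOpen W → QCAt V W) : QCAt V U := by
  have inj : ∀ (t : Finset Γ(X, U)) (O : X.Opens) (hO : O ≤ U), (∀ x ∈ O, ∃ f ∈ t, x ∈ X.basicOpen f) →
      (∀ f ∈ t, X.basicOpen f ≤ O ∧ QCAt V (X.basicOpen f)) → ∀ (f : Γ(X, U)) (v : Γ(V, O)),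
      resM V (inf_le_left : O ⊓ X.basicOpen f ≤ O) v = 0 → ∃ n : ℕ, resO hO f ^ n • v = 0 := by
    intro t O hO ht hQ f v hv
    have : ∀ g : t, ∃ n : ℕ, resM V (hQ g.1 g.2).1 (resO hO f ^ n • v) = 0 := by
      intro g
      have hle := (hQ g.1 g.2).1
      obtain ⟨n, hn⟩ := (hQ g.1 g.2).2.inj (resO (hle.trans hO) f) (X.basicOpen g.1 ⊓ X.basicOpen f)
        inf_le_left (basicOpen_resO _ _).symm (resM V hle v) (by
          have := congrArg (resM V (inf_le_inf_right (X.basicOpen f) hle)) hv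
          rw [resM_resM, map_zero] at this
          rw [resM_resM]
          exact this)
      exact ⟨n, by rw [resM_pow_smul, resO_resO, hn]⟩
    choose n hn using this
    refine ⟨Finset.univ.sup n, resM_ext V _ _ fun x hx => ?_⟩
    obtain ⟨g, hg, hxg⟩ := ht x hx
    refine ⟨X.basicOpen g, (hQ g hg).1, hxg, ?_⟩
    have := hn ⟨g, hg⟩
    rw [resM_pow_smul] at this
    rw [map_zero, resM_pow_smul]
    exact pow_smul_eq_zero_of_le (Finset.le_sup (f := n) (Finset.mem_univ ⟨g, hg⟩)) this
  refine ⟨fun f W h hW v hv => ?_, fun f W h hW v => ?_⟩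
  · obtain ⟨n, hn⟩ := inj s U le_rfl hs (fun g hg => ⟨X.basicOpen_le g,
      H g hg _ le_rfl (hU.basicOpen g)⟩) f v (by
        have := congrArg (resM V (inf_le_right.trans hW.ge : U ⊓ X.basicOpen f ≤ W)) hv
        rwa [resM_resM, map_zero] at this)
    exact ⟨n, by rwa [resO_self] at hn⟩
  · have : ∀ g : s, ∃ (n : ℕ) (v' : Γ(V, X.basicOpen g.1)),
        resM V (inf_le_left : X.basicOpen g.1 ⊓ W ≤ _) v' =
          resO ((inf_le_right : X.basicOpen g.1 ⊓ W ≤ W).trans h) f ^ n •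
            resM V (inf_le_right : X.basicOpen g.1 ⊓ W ≤ W) v := by
      intro g
      obtain ⟨n, v', hv'⟩ := (H g.1 g.2 _ le_rfl (hU.basicOpen _)).surj
        (resO (X.basicOpen_le g.1) f) (X.basicOpen g.1 ⊓ W) inf_le_left
        (by rw [basicOpen_resO, hW]) (resM V inf_le_right v)
      exact ⟨n, v', by rw [hv', resO_resO]⟩
    choose n v' hv' using this
    let N := Finset.univ.sup n
    obtain ⟨w, hw⟩ : ∃ w : ∀ g : s, Γ(V, X.basicOpen g.1), ∀ g : s,
        resM V (inf_le_left : X.basicOpen g.1 ⊓ W ≤ _) (w g) =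
          resO ((inf_le_right : X.basicOpen g.1 ⊓ W ≤ W).trans h) f ^ N •
            resM V (inf_le_right : X.basicOpen g.1 ⊓ W ≤ W) v := by
      refine ⟨fun g => resO (X.basicOpen_le g.1) f ^ (N - n g) • v' g, fun g => ?_⟩
      rw [resM_pow_smul, resO_resO, hv', smul_smul, ← pow_add,
        Nat.sub_add_cancel (Finset.le_sup (f := n) (Finset.mem_univ g))]
    have : ∀ g g' : s, ∃ m : ℕ,
        resO ((inf_le_left : X.basicOpen g.1 ⊓ X.basicOpen g'.1 ≤ _).trans (X.basicOpen_le g.1)) f ^ m •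
          (resM V (inf_le_left : X.basicOpen g.1 ⊓ X.basicOpen g'.1 ≤ _) (w g) -
            resM V inf_le_right (w g')) = 0 := by
      intro g g'
      refine inj {g.1 * g'.1} _ (inf_le_left.trans (X.basicOpen_le g.1)) ?_ ?_ f _ ?_
      · intro x hx
        exact ⟨_, Finset.mem_singleton_self _, by rwa [Scheme.basicOpen_mul]⟩
      · intro k hk
        rw [Finset.mem_singleton] at hk
        subst hk
        have := X.basicOpen_mul g.1 g'.1
        exact ⟨this.le, H g.1 g.2 _ (this.le.trans inf_le_left) (hU.basicOpen _)⟩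
      · have h1 := congrArg (resM V (le_inf (inf_le_left.trans inf_le_left)
          (inf_le_right.trans hW.ge) : X.basicOpen g.1 ⊓ X.basicOpen g'.1 ⊓ X.basicOpen f ≤ _)) (hw g)
        have h2 := congrArg (resM V (le_inf (inf_le_left.trans inf_le_right)
          (inf_le_right.trans hW.ge) : X.basicOpen g.1 ⊓ X.basicOpen g'.1 ⊓ X.basicOpen f ≤ _)) (hw g')
        rw [resM_resM, resM_pow_smul, resM_resM, resO_resO] at h1 h2
        rw [map_sub, resM_resM, resM_resM, sub_eq_zero]
        exact h1.trans h2.symm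
    choose m hm using this
    let K := Finset.univ.sup fun p : s × s => m p.1 p.2
    obtain ⟨v₁, hv₁⟩ := exists_glue V (U := U) (fun g : s => X.basicOpen g.1)
      (fun g => X.basicOpen_le g.1) (fun x hx => by
        obtain ⟨g, hg, hxg⟩ := hs x hx
        exact ⟨⟨g, hg⟩, hxg⟩) (fun g => resO (X.basicOpen_le g.1) f ^ K • w g) (fun g g' => by
        have := pow_smul_eq_zero_of_le (n := K)
          (Finset.le_sup (f := fun p : s × s => m p.1 p.2) (Finset.mem_univ (g, g'))) (hm g g')
        rw [smul_sub, sub_eq_zero] at this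
        rw [resM_pow_smul, resM_pow_smul, resO_resO, resO_resO]
        exact this)
    refine ⟨K + N, v₁, resM_ext V _ _ fun x hx => ?_⟩
    obtain ⟨g, hg, hxg⟩ := hs x (h hx)
    refine ⟨X.basicOpen g ⊓ W, inf_le_right, ⟨hxg, hx⟩, ?_⟩
    have h1 := congrArg (resM V (inf_le_left : X.basicOpen g ⊓ W ≤ _)) (hv₁ ⟨g, hg⟩)
    rw [resM_resM, resM_pow_smul, hw ⟨g, hg⟩, resO_resO, smul_smul, ← pow_add] at h1
    rw [resM_resM, resM_pow_smul, resO_resO]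
    exact h1

/-- Vector bundles are quasi-coherent. -/
theorem IsVectorBundle.qcAt (hV : IsVectorBundle V) {U : X.Opens} (hU : IsAffineOpen U) :
    QCAt V U := by
  obtain ⟨s, -, hs, hs'⟩ := exists_basicOpen_cover hU
    (fun O => ∀ W : X.Opens, W ≤ O → IsAffineOpen W → QCAt V W) (fun x _ => by
      obtain ⟨O, hx, n, e, he⟩ := hV x
      exact ⟨O, hx, fun W hW _ W' hW' hW'' => QCAt.of_basis hW'' (hW'.trans hW) e he⟩)
  exact QCAt.of_cover hU s hs' hs

end Sheaf

/-! ### Sections of vector bundles over affine opens -/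

section VectorBundle

variable {X : Scheme.{u}} {V : X.Modules}

theorem smul_left_cancel_of_isUnit {R M : Type*} [CommRing R] [AddCommGroup M] [Module R M] {r : R}
    (hr : IsUnit r) {v w : M} (h : r • v = r • w) : v = w := by
  obtain ⟨r, rfl⟩ := hr
  exact smul_left_cancel r h

/-- The module of sections of a vector bundle over an affine open is finitely generated and
projective: it is finitely presented and flat, because it is so on the members of a finite cover
by basic opens. -/
theorem IsVectorBundle.finite_projective (hV : IsVectorBundle V) {U : X.Opens}
    (hU : IsAffineOpen U) : Module.Finite Γ(X, U) Γ(V, U) ∧ Module.Projective Γ(X, U) Γ(V, U) := by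
  obtain ⟨s, hs, hsb, -⟩ := exists_basicOpen_cover hU
    (fun O => ∃ (n : ℕ) (e : Fin n → Γ(V, O)), LinearIndependent Γ(X, O) e ∧
      Submodule.span Γ(X, O) (Set.range e) = ⊤) (fun x _ => by
      obtain ⟨O, hx, n, e, he⟩ := hV x
      exact ⟨O, hx, fun W hW _ => ⟨n, _, he W hW⟩⟩)
  have q := hV.qcAt hU
  let t : Set Γ(X, U) := s
  let mod : ∀ g : t, Module Γ(X, U) Γ(V, X.basicOpen g.1) := fun g =>
    Module.compHom _ (resO (X.basicOpen_le g.1))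
  have smul_def : ∀ (g : t) (r : Γ(X, U)) (v : Γ(V, X.basicOpen g.1)),
    r • v = resO (X.basicOpen_le g.1) r • v := fun _ _ _ => rfl
  have tower : ∀ g : t, IsScalarTower Γ(X, U) Γ(X, X.basicOpen g.1) Γ(V, X.basicOpen g.1) :=
    fun g => ⟨fun r a v => by
      rw [smul_def, ← mul_smul, Algebra.smul_def]
      rfl⟩
  have loc : ∀ g : t, IsLocalization.Away g.1 Γ(X, X.basicOpen g.1) := fun g =>
    hU.isLocalization_basicOpen g.1
  let φ : ∀ g : t, Γ(V, U) →ₗ[Γ(X, U)] Γ(V, X.basicOpen g.1) := fun g =>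
    { toFun := resM V (X.basicOpen_le g.1)
      map_add' := map_add _
      map_smul' := fun r v => resM_smul V _ r v }
  have locM : ∀ g : t, IsLocalizedModule (Submonoid.powers g.1) (φ g) := fun g =>
    { map_units := by
        rintro ⟨_, n, rfl⟩
        have hu : IsUnit (resO (X.basicOpen_le g.1) (g.1 ^ n)) := by
          rw [map_pow]
          exact (isUnit_resO g.1 _ le_rfl).pow n
        rw [Module.End.isUnit_iff]
        refine ⟨fun v w hvw => smul_left_cancel_of_isUnit hu hvw, fun v => ?_⟩
        obtain ⟨r, hr⟩ := hu
        refine ⟨(r⁻¹.1 : Γ(X, X.basicOpen g.1)) • v, ?_⟩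
        change resO (X.basicOpen_le g.1) (g.1 ^ n) • (r⁻¹.1 • v) = v
        rw [← hr, smul_smul, Units.mul_inv, one_smul]
      surj := fun v => by
        obtain ⟨n, v', hv'⟩ := q.surj g.1 _ (X.basicOpen_le g.1) rfl v
        refine ⟨⟨v', ⟨_, n, rfl⟩⟩, ?_⟩
        refine Eq.trans ?_ hv'.symm
        change resO (X.basicOpen_le g.1) (g.1 ^ n) • v = _
        rw [map_pow]
      exists_of_eq := fun {v w} hvw => by
        obtain ⟨n, hn⟩ := q.inj g.1 _ (X.basicOpen_le g.1) rfl (v - w) (by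
          rw [map_sub, sub_eq_zero]
          exact hvw)
        rw [smul_sub, sub_eq_zero] at hn
        exact ⟨⟨_, n, rfl⟩, hn⟩ }
  have free : ∀ g : t, Module.Free Γ(X, X.basicOpen g.1) Γ(V, X.basicOpen g.1) ∧
      Module.Finite Γ(X, X.basicOpen g.1) Γ(V, X.basicOpen g.1) := fun g => by
    obtain ⟨n, e, h1, h2⟩ := hsb g.1 g.2
    exact ⟨Module.Free.of_basis (Module.Basis.mk h1 h2.ge),
      Module.Finite.of_basis (Module.Basis.mk h1 h2.ge)⟩
  have fp : Module.FinitePresentation Γ(X, U) Γ(V, U) :=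
    Module.FinitePresentation.of_localizationSpan' t hs
      (Rₚ := fun g => Γ(X, X.basicOpen g.1)) φ (fun g => by
        have := (free g).1
        have := (free g).2
        exact Module.finitePresentation_of_projective _ _)
  have flat : Module.Flat Γ(X, U) Γ(V, U) := by
    refine Module.flat_of_isLocalized_span (R := Γ(X, U)) _ _ t hs _ φ fun g => ?_
    have := (free g).1
    have : Module.Flat Γ(X, U) Γ(X, X.basicOpen g.1) :=
      IsLocalization.flat _ (Submonoid.powers g.1)
    exact Module.Flat.trans Γ(X, U) Γ(X, X.basicOpen g.1) _
  exact ⟨inferInstance, Module.Flat.projective_of_finitePresentation⟩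

/-! ### Filtrations over affine opens -/

variable {O : X.Opens} (F : Filtration V O)

theorem Filtration.exists_compl_cover {U : X.Opens} (hU : IsAffineOpen U) (hUO : U ≤ O) (l : ℤ) :
    ∃ s : Finset Γ(X, U), Ideal.span (s : Set Γ(X, U)) = ⊤ ∧
      (∀ f ∈ s, ∃ G : ∀ W : X.Opens, Submodule Γ(X, W) Γ(V, W),
        (∀ W (_ : W ≤ X.basicOpen f) W' (h : W' ≤ W) (v : Γ(V, W)), v ∈ G W → resM V h v ∈ G W') ∧
        ∀ W (_ : W ≤ X.basicOpen f) (hW : W ≤ O), IsCompl (F.fil l W hW) (G W)) ∧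
      ∀ x ∈ U, ∃ f ∈ s, x ∈ X.basicOpen f := by
  refine exists_basicOpen_cover hU (fun O' => ∃ G : ∀ W : X.Opens, Submodule Γ(X, W) Γ(V, W),
    (∀ W (_ : W ≤ O') W' (h : W' ≤ W) (v : Γ(V, W)), v ∈ G W → resM V h v ∈ G W') ∧
        ∀ W (_ : W ≤ O') (hW : W ≤ O), IsCompl (F.fil l W hW) (G W)) fun x hx => ?_
  obtain ⟨O', hO', hxO', G, h1, h2⟩ := F.summand l x (hUO hx)
  exact ⟨O', hxO', fun W hW _ => ⟨G, fun W₁ hW₁ W₂ h v hv => h1 W₁ (hW₁.trans hW) W₂ h v hv,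
    fun W₁ hW₁ _ => h2 W₁ (hW₁.trans hW)⟩⟩

/-- Locally on `U`, the component of `w` in a complement of the step of the filtration vanishes on the
basic open of `f`, so it is killed by a power of `f`. -/
theorem Filtration.exists_pow_smul_mem (hV : IsVectorBundle V) {U : X.Opens} (hU : IsAffineOpen U)
    (hUO : U ≤ O) (l : ℤ) (f : Γ(X, U)) {W : X.Opens} (h : W ≤ U) (hW : W = X.basicOpen f)
    (w : Γ(V, U)) (hw : resM V h w ∈ F.fil l W (h.trans hUO)) :
    ∃ n : ℕ, f ^ n • w ∈ F.fil l U hUO := by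
  obtain ⟨s, -, hG, hs⟩ := F.exists_compl_cover hU hUO l
  have : ∀ g : s, ∃ n : ℕ, resM V (X.basicOpen_le g.1) (f ^ n • w) ∈
      F.fil l _ ((X.basicOpen_le g.1).trans hUO) := by
    intro g
    obtain ⟨G, hG1, hG2⟩ := hG g.1 g.2
    have hle := X.basicOpen_le g.1
    obtain ⟨a, ha, b, hb, hab⟩ := Submodule.mem_sup.1
      ((hG2 _ le_rfl (hle.trans hUO)).sup_eq_top ▸ Submodule.mem_top :
        resM V hle w ∈ F.fil l _ (hle.trans hUO) ⊔ G _)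
    have e : X.basicOpen g.1 ⊓ W = X.basicOpen (resO hle f) := by rw [basicOpen_resO, hW]
    have hb0 : resM V (inf_le_left : X.basicOpen g.1 ⊓ W ≤ _) b = 0 := by
      have h1 := congrArg (resM V (inf_le_left : X.basicOpen g.1 ⊓ W ≤ _)) hab
      have h2 := F.res l _ _ _ (inf_le_left.trans (hle.trans hUO))
        (inf_le_right : X.basicOpen g.1 ⊓ W ≤ W) _ hw
      have h3 := F.res l _ _ _ (inf_le_left.trans (hle.trans hUO))
        (inf_le_left : X.basicOpen g.1 ⊓ W ≤ _) _ ha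
      rw [resM_resM] at h1 h2
      rw [← h1, map_add, Submodule.add_mem_iff_right _ h3] at h2
      exact Submodule.disjoint_def.1 (hG2 _ inf_le_left (inf_le_left.trans (hle.trans hUO))).disjoint
        _ h2 (hG1 _ le_rfl _ inf_le_left _ hb)
    obtain ⟨n, hn⟩ := (hV.qcAt (hU.basicOpen g.1)).inj _ _ inf_le_left e b hb0
    refine ⟨n, ?_⟩
    rw [resM_pow_smul, ← hab, smul_add, hn, add_zero]
    exact Submodule.smul_mem _ _ ha
  choose n hn using this
  refine ⟨Finset.univ.sup n, F.sheaf l U hUO _ fun x hx => ?_⟩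
  obtain ⟨g, hg, hxg⟩ := hs x hx
  refine ⟨_, X.basicOpen_le g, hxg, ?_⟩
  rw [← Nat.sub_add_cancel (Finset.le_sup (f := n) (Finset.mem_univ ⟨g, hg⟩)), pow_add, mul_smul,
    resM_pow_smul]
  exact Submodule.smul_mem _ _ (hn ⟨g, hg⟩)

/-- Sections of a step of the filtration over a basic open extend after multiplication by a power
of the function. -/
theorem Filtration.exists_res_eq (hV : IsVectorBundle V) {U : X.Opens} (hU : IsAffineOpen U)
    (hUO : U ≤ O) (l : ℤ) (f : Γ(X, U)) {W : X.Opens} (h : W ≤ U) (hW : W = X.basicOpen f)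
    (w : Γ(V, W)) (hw : w ∈ F.fil l W (h.trans hUO)) :
    ∃ (n : ℕ), ∃ w' ∈ F.fil l U hUO, resM V h w' = resO h f ^ n • w := by
  obtain ⟨n, w', hw'⟩ := (hV.qcAt hU).surj f W h hW w
  obtain ⟨m, hm⟩ := F.exists_pow_smul_mem hV hU hUO l f h hW w' (by
    rw [hw']
    exact Submodule.smul_mem _ _ hw)
  exact ⟨m + n, _, hm, by rw [resM_pow_smul, hw', smul_smul, pow_add]⟩

/-- Over an affine open, the steps of a filtration are direct summands. The scalars `r` for which
there is an endomorphism with image in the given step that acts on it as `r` form an ideal, which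
contains powers of the members of a family generating the unit ideal. -/
theorem Filtration.exists_projection (hV : IsVectorBundle V) {U : X.Opens} (hU : IsAffineOpen U)
    (hUO : U ≤ O) (l : ℤ) : ∃ p : Module.End Γ(X, U) Γ(V, U),
      (∀ w, p w ∈ F.fil l U hUO) ∧ ∀ w ∈ F.fil l U hUO, p w = w := by
  obtain ⟨s, hspan, hG, -⟩ := F.exists_compl_cover hU hUO l
  obtain ⟨fin, proj⟩ := hV.finite_projective hU
  obtain ⟨d, b, c, -, -, hbc⟩ := Module.Finite.exists_comp_eq_id_of_projective Γ(X, U) Γ(V, U)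
  have dual : ∀ w, w = ∑ k, c w k • b (Pi.single k 1) := by
    intro w
    conv_lhs => rw [← LinearMap.id_apply (R := Γ(X, U)) w, ← hbc, LinearMap.comp_apply,
      ← Finset.univ_sum_single (c w), map_sum]
    refine Finset.sum_congr rfl fun k _ => ?_
    rw [← map_smul, ← Pi.single_smul, smul_eq_mul, mul_one]
  have key : ∀ g : s, ∃ (N : ℕ) (u : Fin d → Γ(V, U)), (∀ k, u k ∈ F.fil l U hUO) ∧
      ∀ w ∈ F.fil l U hUO, resM V (X.basicOpen_le g.1) (∑ k, c w k • u k) =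
        resM V (X.basicOpen_le g.1) (g.1 ^ N • w) := by
    intro g
    obtain ⟨G, -, hG2⟩ := hG g.1 g.2
    have hle := X.basicOpen_le g.1
    have hc := hG2 _ le_rfl (hle.trans hUO)
    let π := (F.fil l _ (hle.trans hUO)).subtype ∘ₗ Submodule.projectionOnto _ _ hc
    have hπ : ∀ v ∈ F.fil l _ (hle.trans hUO), π v = v := fun v hv =>
      congrArg Subtype.val (Submodule.projectionOnto_apply_left hc ⟨v, hv⟩)
    choose n u hu hu' using fun k => F.exists_res_eq hV hU hUO l g.1 hle rfl
      (π (resM V hle (b (Pi.single k 1)))) (Subtype.mem _)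
    refine ⟨Finset.univ.sup n, fun k => g.1 ^ (Finset.univ.sup n - n k) • u k,
      fun k => Submodule.smul_mem _ _ (hu k), fun w hw => ?_⟩
    rw [resM_pow_smul, ← hπ _ (F.res l _ hUO _ (hle.trans hUO) hle _ hw)]
    conv_rhs => rw [dual w, resM_sum, map_sum, Finset.smul_sum]
    rw [resM_sum]
    refine Finset.sum_congr rfl fun k hk => ?_
    have e : ∀ z : Γ(V, X.basicOpen g.1), resO hle g.1 ^ (Finset.univ.sup n - n k) •
        resO hle g.1 ^ n k • z = resO hle g.1 ^ Finset.univ.sup n • z := fun z => by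
      rw [smul_smul, ← pow_add, Nat.sub_add_cancel (Finset.le_sup (f := n) hk)]
    rw [resM_smul, resM_pow_smul, hu', e, resM_smul, map_smul, smul_comm]
  choose N u hu hu' using key
  have inj : ∀ g : s, ∀ w ∈ F.fil l U hUO, ∃ m : ℕ,
      g.1 ^ m • (∑ k, c w k • u g k - g.1 ^ N g • w) = 0 := fun g w hw =>
    (hV.qcAt hU).inj g.1 _ (X.basicOpen_le g.1) rfl _ (by rw [map_sub, hu' g w hw, sub_self])
  -- The finitely many sections `u g k` generate the step of the filtration, so that a single power of
  -- `g` is enough for all of its sections.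
  let S : Submodule Γ(X, U) Γ(V, U) := Submodule.span _ (Set.range fun p : s × Fin d => u p.1 p.2)
  have huS : ∀ g k, u g k ∈ S := fun g k => Submodule.subset_span ⟨(g, k), rfl⟩
  have hS : F.fil l U hUO ≤ S := by
    intro w hw
    refine Submodule.mem_of_span_eq_top_of_smul_pow_mem S s hspan w fun g => ?_
    obtain ⟨m, hm⟩ := inj g w hw
    refine ⟨m + N g, ?_⟩
    rw [smul_sub, sub_eq_zero, smul_smul, ← pow_add] at hm
    rw [← hm]
    exact Submodule.smul_mem _ _ (Submodule.sum_mem _ fun k _ => Submodule.smul_mem _ _ (huS g k))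
  have uniform : ∀ g : s, ∃ m : ℕ, ∀ w ∈ F.fil l U hUO,
      g.1 ^ m • (∑ k, c w k • u g k - g.1 ^ N g • w) = 0 := by
    intro g
    choose m hm using fun p : s × Fin d => inj g (u p.1 p.2) (hu p.1 p.2)
    refine ⟨Finset.univ.sup m, fun w hw => ?_⟩
    let ψ : Module.End Γ(X, U) Γ(V, U) := g.1 ^ Finset.univ.sup m •
      (∑ k, (LinearMap.proj k ∘ₗ c).smulRight (u g k) - g.1 ^ N g • LinearMap.id)
    have hψ : ∀ w, ψ w = g.1 ^ Finset.univ.sup m • (∑ k, c w k • u g k - g.1 ^ N g • w) := by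
      intro w
      simp only [ψ, LinearMap.smul_apply, LinearMap.sub_apply, LinearMap.sum_apply]
      rfl
    rw [← hψ]
    refine (Submodule.span_le (p := LinearMap.ker ψ)).2 ?_ (hS hw)
    rintro _ ⟨p, rfl⟩
    rw [SetLike.mem_coe, LinearMap.mem_ker, hψ]
    exact pow_smul_eq_zero_of_le (Finset.le_sup (Finset.mem_univ p)) (hm p)
  let J : Ideal Γ(X, U) :=
    { carrier := {r | ∃ p : Module.End Γ(X, U) Γ(V, U),
        (∀ w, p w ∈ F.fil l U hUO) ∧ ∀ w ∈ F.fil l U hUO, p w = r • w}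
      add_mem' := by
        rintro r r' ⟨p, h1, h2⟩ ⟨p', h1', h2'⟩
        exact ⟨p + p', fun w => Submodule.add_mem _ (h1 w) (h1' w), fun w hw => by
          rw [LinearMap.add_apply, h2 w hw, h2' w hw, add_smul]⟩
      zero_mem' := ⟨0, fun w => Submodule.zero_mem _, fun w hw => by
        rw [LinearMap.zero_apply, zero_smul]⟩
      smul_mem' := by
        rintro r r' ⟨p, h1, h2⟩
        exact ⟨r • p, fun w => Submodule.smul_mem _ _ (h1 w), fun w hw => by
          rw [LinearMap.smul_apply, h2 w hw, smul_assoc]⟩ }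
  have hJ : (1 : Γ(X, U)) ∈ J := by
    refine Submodule.mem_of_span_eq_top_of_smul_pow_mem J s hspan 1 fun g => ?_
    obtain ⟨m, hm⟩ := uniform g
    refine ⟨m + N g, g.1 ^ m • ∑ k, (LinearMap.proj k ∘ₗ c).smulRight (u g k), fun w => ?_,
      fun w hw => ?_⟩
    · rw [LinearMap.smul_apply, LinearMap.sum_apply]
      exact Submodule.smul_mem _ _ (Submodule.sum_mem _ fun k _ => Submodule.smul_mem _ _ (hu g k))
    · have := hm w hw
      rw [smul_sub, sub_eq_zero, smul_smul, ← pow_add] at this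
      rw [LinearMap.smul_apply, LinearMap.sum_apply, smul_eq_mul, mul_one]
      exact this
  obtain ⟨p, h1, h2⟩ := hJ
  exact ⟨p, h1, fun w hw => by rw [h2 w hw, one_smul]⟩

end VectorBundle

/-! ### Endomorphisms of a vector bundle over an affine open -/

section SheafEnd

variable {X : Scheme.{u}} {V : X.Modules}

variable (V) in
/-- An endomorphism of the restriction of the sheaf of modules `V` to the open subset `O`. -/
@[ext]
structure SheafEnd (O : X.Opens) where
  map : ∀ U : X.Opens, U ≤ O → Module.End Γ(X, U) Γ(V, U)
  res : ∀ U hU U' hU' (h : U' ≤ U) (w : Γ(V, U)),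
    map U' hU' (resM V h w) = resM V h (map U hU w)

namespace SheafEnd

variable {O : X.Opens}

noncomputable instance : Zero (SheafEnd V O) := ⟨⟨fun _ _ => 0, fun _ _ _ _ h _ => (map_zero (resM V h)).symm⟩⟩

noncomputable instance : One (SheafEnd V O) := ⟨⟨fun _ _ => 1, fun _ _ _ _ _ _ => rfl⟩⟩

noncomputable instance : Mul (SheafEnd V O) := ⟨fun s t => ⟨fun U hU => s.map U hU * t.map U hU,
  fun U hU U' hU' h w => by
    rw [Module.End.mul_apply, t.res U hU, s.res U hU, Module.End.mul_apply]⟩⟩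

noncomputable instance : Sub (SheafEnd V O) := ⟨fun s t => ⟨fun U hU => s.map U hU - t.map U hU,
  fun U hU U' hU' h w => by
    rw [LinearMap.sub_apply, t.res U hU, s.res U hU, LinearMap.sub_apply, map_sub]⟩⟩

end SheafEnd

theorem resM_eq_of_smul {U W : X.Opens} {f : Γ(X, U)} (h : W ≤ U) (hW : W ≤ X.basicOpen f) {n : ℕ}
    {v w : Γ(V, W)} (e : resO h f ^ n • v = resO h f ^ n • w) : v = w :=
  smul_left_cancel_of_isUnit ((isUnit_resO f h hW).pow n) e

/-- Locally, sections over an open subset of an affine open `U` are fractions of sections over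
`U`. -/
theorem IsVectorBundle.exists_fraction (hV : IsVectorBundle V) {U : X.Opens} (hU : IsAffineOpen U)
    {U' : X.Opens} (hU' : U' ≤ U) (w : Γ(V, U')) {x : X} (hx : x ∈ U') {O : X.Opens} (hO : x ∈ O) :
    ∃ (f : Γ(X, U)) (_ : X.basicOpen f ≤ O) (hf : X.basicOpen f ≤ U') (n : ℕ) (u : Γ(V, U)),
      x ∈ X.basicOpen f ∧
        resM V (X.basicOpen_le f) u = resO (X.basicOpen_le f) f ^ n • resM V hf w := by
  obtain ⟨f, hf, hxf⟩ := exists_basicOpen hU (hU' hx) (O := O ⊓ U') ⟨hO, hx⟩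
  obtain ⟨n, u, hu⟩ := (hV.qcAt hU).surj f _ (X.basicOpen_le f) rfl
    (resM V (hf.trans inf_le_right) w)
  exact ⟨f, hf.trans inf_le_left, hf.trans inf_le_right, n, u, hxf, hu⟩

theorem Filtration.exists_fraction (hV : IsVectorBundle V) {O : X.Opens} (F : Filtration V O)
    {U : X.Opens} (hU : IsAffineOpen U) (hUO : U ≤ O) {U' : X.Opens} (hU' : U' ≤ U) {l : ℤ}
    {w : Γ(V, U')} (hw : w ∈ F.fil l U' (hU'.trans hUO)) {x : X} (hx : x ∈ U') {O' : X.Opens}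
    (hO' : x ∈ O') :
    ∃ (f : Γ(X, U)) (_ : X.basicOpen f ≤ O') (hf : X.basicOpen f ≤ U') (n : ℕ),
      ∃ u ∈ F.fil l U hUO, x ∈ X.basicOpen f ∧
        resM V (X.basicOpen_le f) u = resO (X.basicOpen_le f) f ^ n • resM V hf w := by
  obtain ⟨f, hf, hxf⟩ := exists_basicOpen hU (hU' hx) (O := O' ⊓ U') ⟨hO', hx⟩
  obtain ⟨n, u, hu, e⟩ := F.exists_res_eq hV hU hUO l f (X.basicOpen_le f) rfl
    (resM V (hf.trans inf_le_right) w) (F.res l _ _ _ _ _ _ hw)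
  exact ⟨f, hf.trans inf_le_left, hf.trans inf_le_right, n, u, hu, hxf, e⟩

/-- An endomorphism over an open subset of the affine open `U` is determined by its values on the
restrictions of the sections over `U`. -/
theorem SheafEnd.map_eq (hV : IsVectorBundle V) {U O : X.Opens} (hU : IsAffineOpen U) (hO : O ≤ U)
    (s t : SheafEnd V O)
    (H : ∀ u : Γ(V, U), s.map O le_rfl (resM V hO u) = t.map O le_rfl (resM V hO u))
    (U' : X.Opens) (hU' : U' ≤ O) : s.map U' hU' = t.map U' hU' := by
  ext w
  refine resM_ext V _ _ fun x hx => ?_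
  obtain ⟨f, -, hf, n, u, hxf, e⟩ := hV.exists_fraction hU (hU'.trans hO) w hx hx
  refine ⟨_, hf, hxf, resM_eq_of_smul (X.basicOpen_le f) le_rfl (n := n) ?_⟩
  rw [← s.res U' hU' _ (hf.trans hU') hf, ← t.res U' hU' _ (hf.trans hU') hf,
    ← LinearMap.map_smul, ← LinearMap.map_smul, ← e]
  have h1 := s.res O le_rfl _ (hf.trans hU') (hf.trans hU') (resM V hO u)
  have h2 := t.res O le_rfl _ (hf.trans hU') (hf.trans hU') (resM V hO u)
  rw [resM_resM] at h1 h2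
  rw [h1, h2, H]

theorem IsVectorBundle.exists_end_basicOpen (hV : IsVectorBundle V) {U : X.Opens}
    (hU : IsAffineOpen U) (φ : Module.End Γ(X, U) Γ(V, U)) (f : Γ(X, U)) :
    ∃ ψ : Module.End Γ(X, X.basicOpen f) Γ(V, X.basicOpen f),
      ∀ u, ψ (resM V (X.basicOpen_le f) u) = resM V (X.basicOpen_le f) (φ u) := by
  have q := hV.qcAt hU
  have hle := X.basicOpen_le f
  have hunit := isUnit_resO f hle le_rfl
  have cross : ∀ (m n : ℕ) (u v : Γ(V, U)),
      resO hle f ^ n • resM V hle u = resO hle f ^ m • resM V hle v →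
      resO hle f ^ n • resM V hle (φ u) = resO hle f ^ m • resM V hle (φ v) := by
    intro m n u v e
    obtain ⟨k, hk⟩ := q.inj f _ hle rfl (f ^ n • u - f ^ m • v) (by
      rw [map_sub, resM_pow_smul, resM_pow_smul, e, sub_self])
    have := congrArg (resM V hle) (congrArg φ hk)
    rw [φ.map_smul, map_sub, φ.map_smul, φ.map_smul, map_zero, map_zero, resM_pow_smul, map_sub,
      resM_pow_smul, resM_pow_smul, ← smul_zero (resO hle f ^ k)] at this
    exact sub_eq_zero.1 (resM_eq_of_smul hle le_rfl this)
  have ex : ∀ w : Γ(V, X.basicOpen f), ∃ w', ∀ (n : ℕ) (u : Γ(V, U)),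
      resM V hle u = resO hle f ^ n • w → resM V hle (φ u) = resO hle f ^ n • w' := by
    intro w
    obtain ⟨m, v, hv⟩ := q.surj f _ hle rfl w
    obtain ⟨r, hr⟩ := hunit.pow m
    refine ⟨(r⁻¹.1 : Γ(X, X.basicOpen f)) • resM V hle (φ v), fun n u hu => ?_⟩
    apply resM_eq_of_smul hle le_rfl (n := m)
    rw [cross n m u v (by rw [hu, hv, smul_smul, smul_smul, mul_comm]), smul_smul, smul_smul,
      mul_right_comm, ← hr, Units.mul_inv, one_mul]
  choose ψ hψ using ex
  refine ⟨{ toFun := ψ, map_add' := fun v w => ?_, map_smul' := fun a v => ?_ }, fun u => ?_⟩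
  · obtain ⟨m, v', hv⟩ := q.surj f _ hle rfl v
    obtain ⟨n, w', hw⟩ := q.surj f _ hle rfl w
    apply resM_eq_of_smul hle le_rfl (n := m + n)
    rw [← hψ (v + w) (m + n) (f ^ n • v' + f ^ m • w'), φ.map_add, φ.map_smul, φ.map_smul, map_add,
      resM_pow_smul, resM_pow_smul, hψ v m v' hv, hψ w n w' hw, smul_smul, smul_smul, ← pow_add,
      ← pow_add, add_comm n m, smul_add]
    rw [map_add, resM_pow_smul, resM_pow_smul, hv, hw, smul_smul, smul_smul, ← pow_add, ← pow_add,
      add_comm n m, smul_add]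
  · obtain ⟨m, v', hv⟩ := q.surj f _ hle rfl v
    obtain ⟨n, b, hb⟩ := exists_resO_eq hU f hle rfl a
    apply resM_eq_of_smul hle le_rfl (n := n + m)
    rw [← hψ (a • v) (n + m) (b • v'), φ.map_smul, resM_smul, hb, hψ v m v' hv, smul_smul,
      RingHom.id_apply, smul_smul]
    · congr 1
      ring
    · rw [resM_smul, hb, hv, smul_smul, smul_smul]
      congr 1
      ring
  · have := hψ (resM V hle u) 0 u (by simp only [pow_zero, one_smul])
    simp only [pow_zero, one_smul] at this
    exact this.symm

/-- Every endomorphism of the module of sections over an affine open extends to an endomorphism of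
the sheaf. -/
theorem IsVectorBundle.exists_sheafEnd (hV : IsVectorBundle V) {U : X.Opens}
    (hU : IsAffineOpen U) (φ : Module.End Γ(X, U) Γ(V, U)) :
    ∃ s : SheafEnd V U, s.map U le_rfl = φ := by
  choose ψ hψ using hV.exists_end_basicOpen hU φ
  have compat : ∀ (f g : Γ(X, U)) (w : Γ(V, X.basicOpen f)) (h : X.basicOpen g ≤ X.basicOpen f),
      resM V h (ψ f w) = ψ g (resM V h w) := by
    intro f g w h
    obtain ⟨n, u, hu⟩ := (hV.qcAt hU).surj f _ (X.basicOpen_le f) rfl w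
    apply resM_eq_of_smul (X.basicOpen_le g) h (n := n)
    have := congrArg (resM V h) (congrArg (ψ f) hu)
    rw [hψ, LinearMap.map_smul, resM_pow_smul, resO_resO, resM_resM] at this
    rw [← this, ← hψ, ← LinearMap.map_smul, ← resM_resM V (X.basicOpen_le f) h, hu, resM_pow_smul, resO_resO]
  have ex : ∀ (U' : X.Opens) (_ : U' ≤ U) (w : Γ(V, U')), ∃ w' : Γ(V, U'),
      ∀ (f : Γ(X, U)) (hf : X.basicOpen f ≤ U'), resM V hf w' = ψ f (resM V hf w) := by
    intro U' hU' w
    obtain ⟨w', hw'⟩ := exists_glue V (U := U')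
      (fun f : {f : Γ(X, U) // X.basicOpen f ≤ U'} => X.basicOpen f.1) (fun f => f.2)
      (fun x hx => by
        obtain ⟨f, hf, hxf⟩ := exists_basicOpen hU (hU' hx) hx
        exact ⟨⟨f, hf⟩, hxf⟩) (fun f => ψ f.1 (resM V f.2 w)) (fun f g => by
        have e : X.basicOpen f.1 ⊓ X.basicOpen g.1 = X.basicOpen (f.1 * g.1) :=
          (X.basicOpen_mul _ _).symm
        have h1 := compat f.1 (f.1 * g.1) (resM V f.2 w) (e.ge.trans inf_le_left)
        have h2 := compat g.1 (f.1 * g.1) (resM V g.2 w) (e.ge.trans inf_le_right)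
        rw [resM_resM] at h1 h2
        have h3 := congrArg (resM V e.le) (h1.trans h2.symm)
        rwa [resM_resM, resM_resM] at h3)
    exact ⟨w', fun f hf => hw' ⟨f, hf⟩⟩
  have uniq : ∀ (U' : X.Opens) (_ : U' ≤ U) (w w' : Γ(V, U')),
      (∀ (f : Γ(X, U)) (hf : X.basicOpen f ≤ U'), resM V hf w = resM V hf w') → w = w' := by
    intro U' hU' w w' H
    refine resM_ext V _ _ fun x hx => ?_
    obtain ⟨f, hf, hxf⟩ := exists_basicOpen hU (hU' hx) hx
    exact ⟨_, hf, hxf, H f hf⟩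
  choose θ hθ using ex
  refine ⟨⟨fun U' hU' => ⟨⟨θ U' hU', fun v w => ?_⟩, fun r v => ?_⟩,
    fun U₁ h₁ U₂ h₂ h w => ?_⟩, ?_⟩
  · refine uniq U' hU' _ _ fun f hf => ?_
    rw [hθ, map_add, map_add, map_add, hθ, hθ]
  · refine uniq U' hU' _ _ fun f hf => ?_
    rw [hθ, resM_smul, LinearMap.map_smul, RingHom.id_apply, resM_smul, hθ]
  · refine uniq U₂ h₂ _ _ fun f hf => ?_
    change resM V hf (θ U₂ h₂ (resM V h w)) = resM V hf (resM V h (θ U₁ h₁ w))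
    rw [hθ, resM_resM, resM_resM, hθ]
  · ext w
    refine uniq U le_rfl _ _ fun f hf => ?_
    change resM V hf (θ U le_rfl w) = resM V hf (φ w)
    rw [hθ, hψ]

/-- The extension of an endomorphism of the module of sections over an affine open. -/
noncomputable def extendEnd (hV : IsVectorBundle V) {U : X.Opens} (hU : IsAffineOpen U)
    (φ : Module.End Γ(X, U) Γ(V, U)) : SheafEnd V U := (hV.exists_sheafEnd hU φ).choose

variable {U : X.Opens}

section Extend

variable (hV : IsVectorBundle V) (hU : IsAffineOpen U)

theorem extendEnd_map (φ : Module.End Γ(X, U) Γ(V, U)) : (extendEnd hV hU φ).map U le_rfl = φ :=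
  (hV.exists_sheafEnd hU φ).choose_spec

theorem extendEnd_res (φ : Module.End Γ(X, U) Γ(V, U)) {U' : X.Opens} (h : U' ≤ U) (w : Γ(V, U)) :
    (extendEnd hV hU φ).map U' h (resM V h w) = resM V h (φ w) := by
  rw [(extendEnd hV hU φ).res U le_rfl, extendEnd_map]

theorem extendEnd_eq (φ : Module.End Γ(X, U) Γ(V, U)) (s : SheafEnd V U)
    (hs : s.map U le_rfl = φ) : extendEnd hV hU φ = s := by
  ext U' hU' w
  rw [SheafEnd.map_eq hV hU le_rfl (extendEnd hV hU φ) s (fun u => by rw [extendEnd_map, hs]) U' hU']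

theorem extendEnd_mul (φ ψ : Module.End Γ(X, U) Γ(V, U)) :
    extendEnd hV hU (φ * ψ) = extendEnd hV hU φ * extendEnd hV hU ψ :=
  extendEnd_eq hV hU _ _ (by
    change (extendEnd hV hU φ).map U le_rfl * (extendEnd hV hU ψ).map U le_rfl = _
    rw [extendEnd_map, extendEnd_map])

theorem extendEnd_sub (φ ψ : Module.End Γ(X, U) Γ(V, U)) :
    extendEnd hV hU (φ - ψ) = extendEnd hV hU φ - extendEnd hV hU ψ :=
  extendEnd_eq hV hU _ _ (by
    change (extendEnd hV hU φ).map U le_rfl - (extendEnd hV hU ψ).map U le_rfl = _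
    rw [extendEnd_map, extendEnd_map])

theorem extendEnd_one : extendEnd hV hU (1 : Module.End Γ(X, U) Γ(V, U)) = 1 :=
  extendEnd_eq hV hU _ _ rfl

theorem extendEnd_zero : extendEnd hV hU (0 : Module.End Γ(X, U) Γ(V, U)) = 0 :=
  extendEnd_eq hV hU _ _ rfl

end Extend

/-- Whether an endomorphism respects filtrations can be checked on an affine open. -/
theorem Filtration.map_mem (hV : IsVectorBundle V) (hU : IsAffineOpen U) {O₁ O₂ : X.Opens} (F₁ : Filtration V O₁) (F₂ : Filtration V O₂)
    (h₁ : U ≤ O₁) (h₂ : U ≤ O₂) (s : SheafEnd V U) (l m : ℤ)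
    (H : ∀ w ∈ F₁.fil l U h₁, s.map U le_rfl w ∈ F₂.fil m U h₂) (U' : X.Opens) (h : U' ≤ U)
    (w : Γ(V, U')) (hw : w ∈ F₁.fil l U' (h.trans h₁)) :
    s.map U' h w ∈ F₂.fil m U' (h.trans h₂) := by
  refine F₂.sheaf m U' _ _ fun x hx => ?_
  obtain ⟨f, -, hf, n, u, hu, hxf, e⟩ := F₁.exists_fraction hV hU h₁ h hw hx hx
  refine ⟨_, hf, hxf, ?_⟩
  have h3 := F₂.res m _ _ _ ((X.basicOpen_le f).trans h₂) (X.basicOpen_le f) _ (H u hu)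
  rw [← s.res U le_rfl _ (X.basicOpen_le f), e, LinearMap.map_smul, s.res U' h] at h3
  obtain ⟨r, hr⟩ := (isUnit_resO f (X.basicOpen_le f) le_rfl).pow n
  rw [← hr] at h3
  have h4 := Submodule.smul_mem _ (r⁻¹.1 : Γ(X, X.basicOpen f)) h3
  rwa [smul_smul, Units.inv_mul, one_smul] at h4

/-- Over an affine open, the members of a filtration are images of projections. -/
theorem Filtration.exists_sheaf_projection (hV : IsVectorBundle V) (hU : IsAffineOpen U)
    {O : X.Opens} (F : Filtration V O) (hUO : U ≤ O) (l : ℤ) :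
    ∃ s : SheafEnd V U, ∀ U' (h : U' ≤ U), (∀ w, s.map U' h w ∈ F.fil l U' (h.trans hUO)) ∧
      ∀ w ∈ F.fil l U' (h.trans hUO), s.map U' h w = w := by
  obtain ⟨p, hp, hp'⟩ := F.exists_projection hV hU hUO l
  obtain ⟨N, hN⟩ := F.bounded
  refine ⟨extendEnd hV hU p, fun U' h => ⟨fun w => ?_, fun w hw => ?_⟩⟩
  · refine F.map_mem hV hU F hUO hUO _ (-N) l (fun w _ => ?_) U' h w ?_
    · rw [extendEnd_map]
      exact hp w
    · rw [(hN U' _).1]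
      trivial
  · have h0 := F.map_mem hV hU F hUO hUO (extendEnd hV hU p - 1) l (N + 1) (fun w hw => ?_) U' h w hw
    · rw [(hN U' _).2] at h0
      exact sub_eq_zero.1 h0
    · change (extendEnd hV hU p).map U le_rfl w - w ∈ _
      rw [extendEnd_map, hp' w hw, sub_self]
      exact Submodule.zero_mem _

/-- A subsheaf that is the image of a projection is a direct summand. -/
theorem exists_isCompl_of_projection {O : X.Opens} (hUO : U ≤ O)
    (F : ∀ W : X.Opens, W ≤ O → Submodule Γ(X, W) Γ(V, W)) (s : SheafEnd V U)
    (h : ∀ W (hW : W ≤ U) w, s.map W hW w ∈ F W (hW.trans hUO))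
    (h' : ∀ W (hW : W ≤ U), ∀ w ∈ F W (hW.trans hUO), s.map W hW w = w) :
    ∃ G : ∀ W : X.Opens, Submodule Γ(X, W) Γ(V, W),
      (∀ W (_ : W ≤ U) W' (h : W' ≤ W) (v : Γ(V, W)), v ∈ G W → resM V h v ∈ G W') ∧
      ∀ W (hW : W ≤ U), IsCompl (F W (hW.trans hUO)) (G W) := by
  classical
  refine ⟨fun W => if hW : W ≤ U then LinearMap.ker (s.map W hW) else ⊤,
    fun W hW W' hW' v hv => ?_, fun W hW => ?_⟩
  · simp only [dif_pos hW, dif_pos (hW'.trans hW), LinearMap.mem_ker] at hv ⊢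
    rw [s.res W hW, hv, map_zero]
  · simp only [dif_pos hW]
    constructor
    · rw [Submodule.disjoint_def]
      intro w hw hw'
      rw [← h' W hW w hw, hw']
    · rw [codisjoint_iff, Submodule.eq_top_iff']
      intro w
      rw [← add_sub_cancel (s.map W hW w) w]
      refine Submodule.add_mem_sup (h W hW w) ?_
      rw [LinearMap.mem_ker, map_sub, h' W hW _ (h W hW w), sub_self]

/-- Endomorphisms over an affine open subset of an affine open `U` are determined by their values
on the restrictions of the sections over `U`. -/
theorem end_eq_of_res (hV : IsVectorBundle V) (hU : IsAffineOpen U) {U' : X.Opens} (hU' : IsAffineOpen U') (h : U' ≤ U)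
    (ψ ψ' : Module.End Γ(X, U') Γ(V, U')) (H : ∀ u, ψ (resM V h u) = ψ' (resM V h u)) : ψ = ψ' := by
  have := SheafEnd.map_eq hV hU h (extendEnd hV hU' ψ) (extendEnd hV hU' ψ') (fun u => by
    rw [extendEnd_map, extendEnd_map, H]) U' le_rfl
  rwa [extendEnd_map, extendEnd_map] at this

end SheafEnd

/-! ### Reduction to the square-zero situation on charts -/

theorem exists_affChart {X S : Scheme.{u}} (f : X ⟶ S) {x : X} {O : X.Opens} (hO : x ∈ O) :
    ∃ c : AffChart f, x ∈ c.U ∧ c.U ≤ O := by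
  obtain ⟨V, hV, hxV, -⟩ := exists_isAffineOpen_mem_and_subset (x := f x) (U := ⊤) trivial
  obtain ⟨U, hU, hxU, hle⟩ := exists_isAffineOpen_mem_and_subset (x := x) (U := O ⊓ f ⁻¹ᵁ V) ⟨hO, hxV⟩
  exact ⟨⟨U, hU, V, hV, fun y hy => (hle hy).2⟩, hxU, fun y hy => (hle hy).1⟩

namespace LogThickening

variable {P : LogThickening.{u}}

/-- The ideal of `X` has square zero, because on charts it is generated by the ideal of `S`. -/
theorem mul_eq_zero_of_mem_I (c : AffChart P.g) {a b : Γ(P.Y, c.U)} (ha : a ∈ P.I c.U)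
    (hb : b ∈ P.I c.U) : a * b = 0 := by
  have := P.closed
  have h0 : RingHom.ker (P.j.app c.V).hom ^ 2 = ⊥ := by
    have h := congrArg (fun J : P.T.IdealSheafData => J.ideal ⟨c.V, c.affV⟩) P.sq_zero
    simp only [Scheme.IdealSheafData.ideal_pow, Scheme.IdealSheafData.ideal_bot, Pi.pow_apply,
      Scheme.Hom.ker_apply, Pi.bot_apply] at h
    exact h
  have h := Ideal.mul_mem_mul (P.I_le c ha) (P.I_le c hb)
  rwa [← Ideal.map_mul, ← pow_two, h0, Ideal.map_bot, Ideal.mem_bot] at h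

theorem red_resO {U W : P.Y.Opens} (h : W ≤ U) (a : Γ(P.Y, U)) :
    P.red W (resO h a) = resO ((TopologicalSpace.Opens.map P.i.base).monotone h) (P.red U a) :=
  congrArg (fun t => t.hom a) (P.i.naturality (homOfLE h).op)

theorem resO_mem_I {U W : P.Y.Opens} (h : W ≤ U) {a : Γ(P.Y, U)} (ha : a ∈ P.I U) :
    resO h a ∈ P.I W := by
  change P.red W _ = 0
  rw [red_resO, show P.red U a = 0 from ha, map_zero]

variable {E : FilteredDeRhamBundle P.f P.D₀}

variable (P E) in
/-- Restriction of sections of `V`, regarded as a sheaf on `Y`. -/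
noncomputable abbrev resV {U W : P.Y.Opens} (h : W ≤ U) : P.M E U →+ P.M E W :=
  resM ((Scheme.Modules.pushforward P.i).obj E.V) h

theorem resV_mem {U W : P.Y.Opens} (h : W ≤ U) {l : ℤ} {v : P.M E U} (hv : v ∈ P.filM E l U) :
    resV P E h v ∈ P.filM E l W := E.F.res l _ _ _ _ _ _ hv

theorem filM_anti {l m : ℤ} (h : l ≤ m) (U : P.Y.Opens) : P.filM E m U ≤ P.filM E l U :=
  fun _ hv => E.F.anti l m h _ _ hv

theorem mem_filM_of_locally {U : P.Y.Opens} {l : ℤ} (v : P.M E U)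
    (H : ∀ x ∈ U, ∃ (W : P.Y.Opens) (h : W ≤ U), x ∈ W ∧ resV P E h v ∈ P.filM E l W) :
    v ∈ P.filM E l U := by
  refine E.F.sheaf l _ _ v fun x hx => ?_
  obtain ⟨W, h, hxW, hv⟩ := H (P.i x) hx
  exact ⟨P.i ⁻¹ᵁ W, (TopologicalSpace.Opens.map P.i.base).monotone h, hxW, hv⟩

variable (L : P.DeRhamLift E)

/-- The reduction map on sections. -/
noncomputable def rho (U : P.Y.Opens) : Γ(L.W, U) →ₗ[Γ(P.Y, U)] P.M E U where
  toFun w := L.ρ.app U w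
  map_add' := map_add _
  map_smul' r w := Scheme.Modules.Hom.app_smul L.ρ r w

theorem rho_apply (U : P.Y.Opens) (w : Γ(L.W, U)) : rho L U w = L.ρ.app U w := rfl

theorem rho_res {U W : P.Y.Opens} (h : W ≤ U) (w : Γ(L.W, U)) :
    rho L W (resM L.W h w) = resV P E h (rho L U w) :=
  congrArg (fun t => t.hom w) (L.ρ.mapPresheaf.naturality (homOfLE h).op)

/-- Whether two endomorphisms agree modulo `I` can be checked on the restrictions of sections over
an affine open. -/
theorem rho_map_congr {V O : P.Y.Opens} (hV : IsAffineOpen V) (hO : O ≤ V) (s t : SheafEnd L.W O)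
    (H : ∀ u : Γ(L.W, V), rho L O (s.map O le_rfl (resM L.W hO u)) =
      rho L O (t.map O le_rfl (resM L.W hO u))) {U : P.Y.Opens} (hU : U ≤ O) (w : Γ(L.W, U)) :
    rho L U (s.map U hU w) = rho L U (t.map U hU w) := by
  refine resM_ext ((Scheme.Modules.pushforward P.i).obj E.V) _ _ fun x hx => ?_
  obtain ⟨f, -, hf, n, u, hxf, e⟩ := L.vb.exists_fraction hV (hU.trans hO) w hx hx
  refine ⟨_, hf, hxf, resM_eq_of_smul (P.Y.basicOpen_le f) le_rfl (n := n) ?_⟩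
  have h3 := congrArg (resV P E (hf.trans hU)) (H u)
  rw [← rho_res, ← rho_res, ← s.res O le_rfl _ (hf.trans hU), ← t.res O le_rfl _ (hf.trans hU),
    resM_resM, e, map_smul, map_smul, map_smul, map_smul, s.res U hU, t.res U hU, rho_res,
    rho_res] at h3
  exact h3

theorem rho_extendEnd {V U : P.Y.Opens} (hV : IsAffineOpen V) (hU : U ≤ V)
    {f : Module.End Γ(P.Y, V) Γ(L.W, V)} (hf : ∀ w, rho L V (f w) = rho L V w) (w : Γ(L.W, U)) :
    rho L U ((extendEnd L.vb hV f).map U hU w) = rho L U w :=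
  rho_map_congr L hV le_rfl (extendEnd L.vb hV f) 1 (fun u => by
    rw [extendEnd_map, hf]
    rfl) hU w

theorem sqZero (c : AffChart P.g) : SqZeroReduction (P.I c.U) (rho L c.U) where
  sq _ ha _ hb := mul_eq_zero_of_mem_I c ha hb
  surj := L.surj c.U c.affU
  ker := L.ker c.U c.affU

theorem finiteSections (c : AffChart P.g) : Module.Finite Γ(P.Y, c.U) Γ(L.W, c.U) :=
  (L.vb.finite_projective c.affU).1

theorem projectiveSections (c : AffChart P.g) : Module.Projective Γ(P.Y, c.U) Γ(L.W, c.U) :=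
  (L.vb.finite_projective c.affU).2

attribute [local instance] finiteSections projectiveSections

variable {L}

theorem filteredLift {O : P.Y.Opens} {F : Filtration L.W O} (hF : FilLifts L F) (c : AffChart P.g)
    (h : c.U ≤ O) :
    FilteredLift (rho L c.U) (fun l => P.filM E l c.U) (fun l => F.fil l c.U h) where
  anti l m hlm := F.anti l m hlm _ _
  proj l := F.exists_projection L.vb c.affU h l
  map l v := hF l c.U h c.affU v
  bdd := let ⟨N, hN⟩ := F.bounded; ⟨N, hN c.U h⟩

/-! ### Classes of endomorphisms in the complex -/

variable (L) in
/-- The commutator of an endomorphism with the connection of the lift. -/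
noncomputable def commEnd (c : AffChart P.g) (θ : LogDer P.g P.D c)
    (ψ : Module.End Γ(P.Y, c.U) Γ(L.W, c.U)) : Module.End Γ(P.Y, c.U) Γ(L.W, c.U) where
  toFun w := L.con.nab c le_top θ (ψ w) - ψ (L.con.nab c le_top θ w)
  map_add' v w := by
    simp only [map_add]
    abel
  map_smul' r v := by
    rw [ψ.map_smul, L.con.leibniz, L.con.leibniz, map_add, ψ.map_smul, ψ.map_smul,
      RingHom.id_apply, smul_sub]
    abel

/-- The relation defining `ι` is the graph of `SqZeroReduction.iota`. -/
theorem mem_relι {c : AffChart P.g} {α : P.A E c.U} {ψ : Module.End Γ(P.Y, c.U) Γ(L.W, c.U)} :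
    (α, ψ) ∈ relι L c.U ↔ (sqZero L c).iota α = ψ := by
  have key : relι L c.U ≤
      AddSubgroup.closure (Set.range fun α : P.A E c.U => (α, (sqZero L c).iota α)) := by
    rw [relι, AddSubgroup.closure_le]
    rintro _ ⟨φ, a, φ', h, rfl⟩
    refine AddSubgroup.subset_closure ⟨φ ⊗ₜ a, ?_⟩
    rw [Prod.mk.injEq]
    exact ⟨rfl, (sqZero L c).iota_tmul h a⟩
  constructor
  · intro h
    refine AddSubgroup.closure_induction
      (p := fun (x : P.A E c.U × _) _ => (sqZero L c).iota x.1 = x.2) ?_ ?_ ?_ ?_ (key h)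
    · rintro _ ⟨α, rfl⟩
      rfl
    · exact map_zero _
    · intro x y _ _ hx hy
      rw [Prod.fst_add, map_add, hx, hy, Prod.snd_add]
    · intro x _ hx
      rw [Prod.fst_neg, map_neg, hx, Prod.snd_neg]
  · rintro rfl
    induction α using TensorProduct.induction_on with
    | zero =>
      rw [map_zero]
      exact AddSubgroup.zero_mem _
    | add x y hx hy =>
      rw [map_add]
      exact AddSubgroup.add_mem _ hx hy
    | tmul φ a =>
      obtain ⟨φ', hφ⟩ := (sqZero L c).exists_lift φ
      rw [(sqZero L c).iota_tmul hφ]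
      exact AddSubgroup.subset_closure ⟨φ, a, φ', hφ, rfl⟩

section IsClass

variable {p : ℤ} {c : AffChart P.g} {q q' : P.Q E p c.U} {ψ ψ' : Module.End Γ(P.Y, c.U) Γ(L.W, c.U)}

theorem isClass_iff : IsClass L q ψ ↔ ∃ α, (sqZero L c).iota α = ψ ∧ P.mkQ E p c.U α = q := by
  simp only [IsClass, mem_relι]

theorem IsClass.red (h : IsClass L q ψ) (w : Γ(L.W, c.U)) : rho L c.U (ψ w) = 0 := by
  obtain ⟨α, rfl, -⟩ := isClass_iff.1 h
  exact (sqZero L c).red_iota α w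

theorem IsClass.unique (h : IsClass L q ψ) (h' : IsClass L q' ψ) : q = q' := by
  obtain ⟨α, h1, rfl⟩ := isClass_iff.1 h
  obtain ⟨α', h1', rfl⟩ := isClass_iff.1 h'
  rw [(sqZero L c).iota_injective (h1.trans h1'.symm)]

theorem exists_isClass (p : ℤ) (h : ∀ w, rho L c.U (ψ w) = 0) : ∃ q : P.Q E p c.U, IsClass L q ψ := by
  obtain ⟨α, hα⟩ := (sqZero L c).exists_iota_eq h
  exact ⟨_, isClass_iff.2 ⟨α, hα, rfl⟩⟩

variable (L q) in
theorem exists_of_class : ∃ ψ : Module.End Γ(P.Y, c.U) Γ(L.W, c.U), IsClass L q ψ := by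
  obtain ⟨α, rfl⟩ := Submodule.mkQ_surjective _ q
  exact ⟨_, isClass_iff.2 ⟨α, rfl, rfl⟩⟩

theorem IsClass.add (h : IsClass L q ψ) (h' : IsClass L q' ψ') : IsClass L (q + q') (ψ + ψ') := by
  obtain ⟨α, rfl, rfl⟩ := isClass_iff.1 h
  obtain ⟨α', rfl, rfl⟩ := isClass_iff.1 h'
  exact isClass_iff.2 ⟨α + α', map_add _ _ _, map_add _ _ _⟩

theorem IsClass.smul (h : IsClass L q ψ) (r : Γ(P.Y, c.U)) : IsClass L (r • q) (r • ψ) := by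
  obtain ⟨α, rfl, rfl⟩ := isClass_iff.1 h
  exact isClass_iff.2 ⟨r • α, map_smul _ _ _, map_smul _ _ _⟩

theorem IsClass.neg (h : IsClass L q ψ) : IsClass L (-q) (-ψ) := by
  obtain ⟨α, rfl, rfl⟩ := isClass_iff.1 h
  exact isClass_iff.2 ⟨-α, map_neg _ _, map_neg _ _⟩

theorem IsClass.sub (h : IsClass L q ψ) (h' : IsClass L q' ψ') : IsClass L (q - q') (ψ - ψ') := by
  rw [sub_eq_add_neg, sub_eq_add_neg]
  exact h.add h'.neg

theorem IsClass.zero : IsClass L (0 : P.Q E p c.U) 0 :=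
  isClass_iff.2 ⟨0, map_zero _, map_zero _⟩

/-- The class of an endomorphism vanishes if and only if it has the corresponding degree with
respect to lifts of the filtration. -/
theorem IsClass.eq_zero_iff (h : IsClass L q ψ) {O O' : P.Y.Opens} {F : Filtration L.W O}
    {F' : Filtration L.W O'} (hF : FilLifts L F) (hF' : FilLifts L F') (hc : c.U ≤ O)
    (hc' : c.U ≤ O') :
    q = 0 ↔ ∀ m, ∀ w ∈ F.fil m c.U hc, ψ w ∈ F'.fil (m - p) c.U hc' := by
  obtain ⟨α, rfl, rfl⟩ := isClass_iff.1 h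
  have e : P.mkQ E p c.U α = 0 ↔ α ∈ P.filA E (-p) c.U := Submodule.Quotient.mk_eq_zero _
  rw [e]
  constructor
  · intro hα m w hw
    exact FilteredLift.iota_mem (P.filEnd E (-p) c.U) (-p) (sqZero L c) (filteredLift hF c hc)
      (filteredLift hF' c hc') (fun φ hφ => hφ) hα m w hw
  · intro H
    exact FilteredLift.mem_range_of_iota (P.filEnd E (-p) c.U) (-p) (sqZero L c)
      (filteredLift hF c hc) (filteredLift hF' c hc') (fun φ hφ => hφ) H

theorem IsClass.projQ (h : IsClass L q ψ) : IsClass L (P.projQ E p c.U q) ψ := by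
  obtain ⟨α, rfl, rfl⟩ := isClass_iff.1 h
  exact isClass_iff.2 ⟨α, rfl, rfl⟩

/-- The connection on `𝒞` is induced by the commutator with the connection of the lift. -/
theorem IsClass.nabQ (h : IsClass L q ψ) (θ : LogDer P.g P.D c) :
    IsClass L (P.nabQ E p c θ q) (commEnd L c θ ψ) := by
  obtain ⟨α, rfl, rfl⟩ := isClass_iff.1 h
  refine isClass_iff.2 ⟨P.nabA E c θ α, ?_, rfl⟩
  ext w
  change _ = L.con.nab c le_top θ ((sqZero L c).iota α w) -
    (sqZero L c).iota α (L.con.nab c le_top θ w)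
  clear h
  induction α using TensorProduct.induction_on with
  | zero => simp only [map_zero, LinearMap.zero_apply, sub_zero]
  | add x y hx hy =>
    simp only [map_add, LinearMap.add_apply, hx, hy]
    abel
  | tmul φ a =>
    obtain ⟨φ', hφ⟩ := (sqZero L c).exists_lift φ
    let κ := commEnd L c θ φ'
    have hκ : ∀ w, rho L c.U (κ w) = P.comm E c θ φ (rho L c.U w) := by
      intro w
      change rho L c.U (L.con.nab c le_top θ (φ' w) - φ' (L.con.nab c le_top θ w)) =
        P.nab E c θ (φ (rho L c.U w)) - φ (P.nab E c θ (rho L c.U w))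
      rw [map_sub, hφ, rho_apply, L.lifts, rho_apply, L.lifts, ← rho_apply, hφ]
      rfl
    rw [P.nabA_tmul, map_add, (sqZero L c).iota_tmul hκ, (sqZero L c).iota_tmul hφ,
      (sqZero L c).iota_tmul hφ]
    change a.1 • (L.con.nab c le_top θ (φ' w) - φ' (L.con.nab c le_top θ w)) + θ.1 a.1 • φ' w =
      L.con.nab c le_top θ (a.1 • φ' w) - a.1 • φ' (L.con.nab c le_top θ w)
    rw [L.con.leibniz, smul_sub]
    abel

end IsClass

section Restriction

variable {p : ℤ} {c c' : AffChart P.g} {q : P.Q E p c.U} {q' : P.Q E p c'.U}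
  {ψ : Module.End Γ(P.Y, c.U) Γ(L.W, c.U)} {ψ' : Module.End Γ(P.Y, c'.U) Γ(L.W, c'.U)}

variable (L) in
theorem exists_relA (hc : c'.U ≤ c.U) (α : P.A E c.U) : ∃ β : P.A E c'.U, (α, β) ∈ P.relA E hc ∧
    ∀ w, (sqZero L c').iota β (resM L.W hc w) = resM L.W hc ((sqZero L c).iota α w) := by
  induction α using TensorProduct.induction_on with
  | zero => exact ⟨0, AddSubgroup.zero_mem _, fun w => by simp only [map_zero, LinearMap.zero_apply]⟩
  | add x y hx hy =>
    obtain ⟨β, h1, h2⟩ := hx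
    obtain ⟨γ, h1', h2'⟩ := hy
    exact ⟨β + γ, AddSubgroup.add_mem _ h1 h1', fun w => by
      simp only [map_add, LinearMap.add_apply, h2, h2']⟩
  | tmul φ a =>
    obtain ⟨φ', hφ⟩ := (sqZero L c).exists_lift φ
    let φ'' := (extendEnd L.vb c.affU φ').map c'.U hc
    have h2 : ∀ w, φ'' (resM L.W hc w) = resM L.W hc (φ' w) := extendEnd_res L.vb c.affU φ' hc
    refine ⟨(sqZero L c').red φ'' ⊗ₜ ⟨resO hc a.1, resO_mem_I hc a.2⟩,
      AddSubgroup.subset_closure ⟨φ, _, a, _, fun v => ?_, rfl, rfl⟩, fun w => ?_⟩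
    · obtain ⟨w, rfl⟩ := (sqZero L c).surj v
      rw [← hφ]
      refine Eq.trans ?_ (rho_res L hc (φ' w))
      rw [← h2, ← (sqZero L c').red_apply, rho_res]
    · rw [(sqZero L c').iota_tmul (fun w => ((sqZero L c').red_apply φ'' w).symm),
        (sqZero L c).iota_tmul hφ, LinearMap.smul_apply, LinearMap.smul_apply, h2, resM_smul]

/-- Endomorphisms that restrict to each other have classes that restrict to each other. -/
theorem IsClass.resQ (h : IsClass L q ψ) (h' : IsClass L q' ψ') (hc : c'.U ≤ c.U)
    (e : ∀ w, ψ' (resM L.W hc w) = resM L.W hc (ψ w)) : P.ResQ E hc q q' := by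
  obtain ⟨α, rfl, rfl⟩ := isClass_iff.1 h
  obtain ⟨β, hβ, hβ'⟩ := exists_relA L hc α
  refine ⟨α, β, hβ, rfl, IsClass.unique (isClass_iff.2 ⟨β, ?_, rfl⟩) h'⟩
  exact end_eq_of_res L.vb c.affU c'.affU hc _ _ fun w => by rw [hβ', e]

/-- The map `ι` is compatible with restriction. -/
theorem iota_res {hc : c'.U ≤ c.U} {α : P.A E c.U} {β : P.A E c'.U} (h : (α, β) ∈ P.relA E hc)
    (w : Γ(L.W, c.U)) :
    (sqZero L c').iota β (resM L.W hc w) = resM L.W hc ((sqZero L c).iota α w) := by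
  refine AddSubgroup.closure_induction (p := fun (x : P.A E c.U × P.A E c'.U) _ =>
    (sqZero L c').iota x.2 (resM L.W hc w) = resM L.W hc ((sqZero L c).iota x.1 w)) ?_ ?_ ?_ ?_ h
  · rintro _ ⟨φ, χ, a, b, h1, h2, rfl⟩
    obtain ⟨φ', hφ⟩ := (sqZero L c).exists_lift φ
    have hχ : ∀ w, rho L c'.U ((extendEnd L.vb c.affU φ').map c'.U hc w) = χ (rho L c'.U w) := by
      obtain ⟨χ', hχ'⟩ := (sqZero L c').exists_lift χ
      intro w
      have h3 := rho_map_congr L c.affU hc (extendEnd L.vb c'.affU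
        ((extendEnd L.vb c.affU φ').map c'.U hc)) (extendEnd L.vb c'.affU χ') (fun u => by
          rw [extendEnd_map, extendEnd_map, hχ', extendEnd_res, rho_res, rho_res, h1, ← hφ]) le_rfl w
      rwa [extendEnd_map, extendEnd_map, hχ'] at h3
    rw [(sqZero L c').iota_tmul hχ, (sqZero L c).iota_tmul hφ, LinearMap.smul_apply,
      extendEnd_res, LinearMap.smul_apply, resM_smul, h2]
  · simp only [Prod.fst_zero, Prod.snd_zero, map_zero, LinearMap.zero_apply]
  · intro x y _ _ hx hy
    simp only [Prod.fst_add, Prod.snd_add, map_add, LinearMap.add_apply, hx, hy]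
  · intro x _ hx
    simp only [Prod.fst_neg, Prod.snd_neg, map_neg, LinearMap.neg_apply, hx]

/-- Restriction of classes is computed by restriction of endomorphisms. That it is well defined
uses that the filtration lifts locally, because the class of an endomorphism vanishes if and only
if the endomorphism respects lifted filtrations. -/
theorem IsClass.of_resQ (h : IsClass L q ψ) {hc : c'.U ≤ c.U} (hq : P.ResQ E hc q q')
    {O : P.Y.Opens} {F : Filtration L.W O} (hF : FilLifts L F) (hO : c.U ≤ O) :
    IsClass L q' ((extendEnd L.vb c.affU ψ).map c'.U hc) := by
  obtain ⟨α₀, rfl, rfl⟩ := isClass_iff.1 h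
  obtain ⟨α, β, hr, e, rfl⟩ := hq
  obtain ⟨β₀, hr₀, h₀⟩ := exists_relA L hc α₀
  have hext : (sqZero L c').iota β₀ =
      (extendEnd L.vb c.affU ((sqZero L c).iota α₀)).map c'.U hc :=
    end_eq_of_res L.vb c.affU c'.affU hc _ _ fun w => by rw [h₀, extendEnd_res]
  refine isClass_iff.2 ⟨β₀, hext, ?_⟩
  rw [← sub_eq_zero, ← map_sub]
  have hδ : IsClass L (0 : P.Q E p c.U) ((sqZero L c).iota (α₀ - α)) :=
    isClass_iff.2 ⟨_, rfl, by rw [map_sub, e, sub_self]⟩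
  have hδ' : (sqZero L c').iota (β₀ - β) =
      (extendEnd L.vb c.affU ((sqZero L c).iota (α₀ - α))).map c'.U hc :=
    end_eq_of_res L.vb c.affU c'.affU hc _ _ fun w => by
      rw [iota_res (AddSubgroup.sub_mem _ hr₀ hr), extendEnd_res]
  refine ((isClass_iff.2 ⟨_, rfl, rfl⟩ :
    IsClass L _ ((sqZero L c').iota (β₀ - β))).eq_zero_iff hF hF (hc.trans hO) (hc.trans hO)).2 ?_
  intro m w hw
  rw [hδ']
  refine F.map_mem L.vb c.affU F hO hO _ m (m - p) (fun w hw => ?_) c'.U hc w hw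
  rw [extendEnd_map]
  exact (hδ.eq_zero_iff hF hF hO hO).1 rfl m w hw

end Restriction

end LogThickening

/-! ### Restriction of logarithmic derivations -/

/-- Derivations extend along formally étale ring homomorphisms, in particular to localizations. -/
theorem exists_derivation_extension {A B : Type u} [CommRing A] [CommRing B] [Algebra A B]
    [Algebra.FormallyEtale A B] (d : Derivation ℤ A A) :
    ∃ d' : Derivation ℤ B B, ∀ a, d' (algebraMap A B a) = algebraMap A B (d a) := by
  let l : B ⊗[A] Ω[A⁄ℤ] →ₗ[B] B :=
    LinearMap.liftBaseChange B (Algebra.linearMap A B ∘ₗ d.liftKaehlerDifferential)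
  let e := KaehlerDifferential.tensorKaehlerEquivOfFormallyEtale ℤ A B
  refine ⟨(l ∘ₗ e.symm.toLinearMap).compDer (KaehlerDifferential.D ℤ B), fun a => ?_⟩
  change l (e.symm (KaehlerDifferential.D ℤ B (algebraMap A B a))) = _
  rw [KaehlerDifferential.tensorKaehlerEquivOfFormallyEtale_symm_D_algebraMap]
  change LinearMap.liftBaseChange B _ (1 ⊗ₜ _) = _
  rw [LinearMap.liftBaseChange_tmul, one_smul, LinearMap.comp_apply,
    Derivation.liftKaehlerDifferential_comp_D]
  rfl

/-- The chart given by a basic open subset of a chart. -/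
noncomputable abbrev AffChart.basicOpen {X S : Scheme.{u}} {f : X ⟶ S} (c : AffChart f) (r : Γ(X, c.U)) :
    AffChart f :=
  ⟨X.basicOpen r, c.affU.basicOpen r, c.V, c.affV, (X.basicOpen_le r).trans c.le⟩

theorem LogDer.exists_res {X S : Scheme.{u}} {f : X ⟶ S} {D : X.IdealSheafData} {c : AffChart f}
    (θ : LogDer f D c) (r : Γ(X, c.U)) :
    ∃ θ' : LogDer f D (c.basicOpen r), DerRes (X.basicOpen_le r) θ θ' := by
  have := c.affU.isLocalization_basicOpen r
  have := Algebra.FormallyEtale.of_isLocalization (Rₘ := Γ(X, X.basicOpen r)) (Submonoid.powers r)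
  obtain ⟨d, hd⟩ := exists_derivation_extension (B := Γ(X, X.basicOpen r)) θ.1
  replace hd : ∀ a, d (resO (X.basicOpen_le r) a) = resO (X.basicOpen_le r) (θ.1 a) := hd
  have hD : D.ideal ⟨X.basicOpen r, c.affU.basicOpen r⟩ =
      (D.ideal ⟨c.U, c.affU⟩).map (resO (X.basicOpen_le r)) :=
    (D.map_ideal_basicOpen ⟨c.U, c.affU⟩ r).symm
  refine ⟨⟨d, fun b => ?_, fun x hx => ?_⟩, hd⟩
  · have h := hd ((f.appLE c.V c.U c.le).hom b)
    rw [show θ.1 _ = 0 from θ.2.1 b, map_zero] at h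
    refine Eq.trans (congrArg d ?_) h
    exact congrArg (fun t => t.hom b)
      (f.appLE_map c.le (homOfLE (X.basicOpen_le r)).op).symm
  · change d x ∈ D.ideal ⟨X.basicOpen r, c.affU.basicOpen r⟩
    change x ∈ D.ideal ⟨X.basicOpen r, c.affU.basicOpen r⟩ at hx
    rw [hD] at hx ⊢
    refine Submodule.span_induction (p := fun x _ => d x ∈ _) ?_ ?_ ?_ ?_ hx
    · rintro _ ⟨b, hb, rfl⟩
      rw [hd]
      exact Ideal.mem_map_of_mem _ (θ.2.2 b hb)
    · rw [map_zero]
      exact Ideal.zero_mem _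
    · intro x y _ _ h1 h2
      rw [map_add]
      exact Ideal.add_mem _ h1 h2
    · intro a x hx h1
      rw [smul_eq_mul, Derivation.leibniz]
      exact Ideal.add_mem _ (Ideal.mul_mem_left _ _ h1) (Ideal.mul_mem_right _ _ hx)

/-! ### The classes measuring the difference of two local lifts -/

namespace LogThickening

variable {P : LogThickening.{u}} {E : FilteredDeRhamBundle P.f P.D₀} {L : P.DeRhamLift E}

attribute [local instance] finiteSections projectiveSections

namespace LocalLift

variable {O₁ O₂ O₃ : P.Y.Opens} (A : LocalLift L O₁) (B : LocalLift L O₂) (C : LocalLift L O₃)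
  (c : AffChart P.g) (h₁ : c.U ≤ O₁) (h₂ : c.U ≤ O₂) (h₃ : c.U ≤ O₃)

theorem filteredLift : FilteredLift (rho L c.U) (fun l => P.filM E l c.U)
    (fun l => A.F.fil l c.U h₁) := LogThickening.filteredLift A.lifts c h₁

/-- `f` is a homomorphism from the filtration of `A` to that of `B` that lifts the identity. -/
structure IsFilteredId (f : Module.End Γ(P.Y, c.U) Γ(L.W, c.U)) : Prop where
  red : ∀ w, rho L c.U (f w) = rho L c.U w
  fil : ∀ l, ∀ w ∈ A.F.fil l c.U h₁, f w ∈ B.F.fil l c.U h₂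

theorem exists_isFilteredId : ∃ f, IsFilteredId A B c h₁ h₂ f :=
  let ⟨f, h, h'⟩ := FilteredLift.exists_filtered_id (sqZero L c) (A.filteredLift c h₁)
    (B.filteredLift c h₂)
  ⟨f, h, h'⟩

variable {A B C c h₁ h₂ h₃}

theorem IsFilteredId.red_one_sub {f : Module.End Γ(P.Y, c.U) Γ(L.W, c.U)}
    (hf : IsFilteredId A B c h₁ h₂ f) (w : Γ(L.W, c.U)) : rho L c.U ((1 - f) w) = 0 := by
  rw [LinearMap.sub_apply, map_sub, hf.red, Module.End.one_apply, sub_self]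

/-- The class of `1 - f` does not depend on `f`, because `f' - f` vanishes modulo `I` and has degree
zero. -/
theorem IsFilteredId.isClass_congr {f f' : Module.End Γ(P.Y, c.U) Γ(L.W, c.U)}
    (hf : IsFilteredId A B c h₁ h₂ f) (hf' : IsFilteredId A B c h₁ h₂ f') {q : P.Q E 0 c.U}
    (hq : IsClass L q (1 - f)) : IsClass L q (1 - f') := by
  obtain ⟨q', hq'⟩ := exists_isClass 0 hf'.red_one_sub
  have : q - q' = 0 := by
    refine ((hq.sub hq').eq_zero_iff A.lifts B.lifts h₁ h₂).2 fun m w hw => ?_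
    rw [sub_sub_sub_cancel_left, sub_zero]
    exact Submodule.sub_mem _ (hf'.fil m w hw) (hf.fil m w hw)
  rwa [sub_eq_zero.1 this]

variable (A B c h₁ h₂)

theorem exists_diff : ∃ q : P.Q E 0 c.U, ∀ f, IsFilteredId A B c h₁ h₂ f → IsClass L q (1 - f) := by
  obtain ⟨f, hf⟩ := exists_isFilteredId A B c h₁ h₂
  obtain ⟨q, hq⟩ := exists_isClass 0 hf.red_one_sub
  exact ⟨q, fun f' hf' => hf.isClass_congr hf' hq⟩

/-- The class of `ι⁻¹(1 - f)`, for any filtered homomorphism `f` from `A` to `B` that lifts the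
identity. -/
noncomputable def diff : P.Q E 0 c.U := (exists_diff A B c h₁ h₂).choose

variable {A B c h₁ h₂}

theorem IsFilteredId.isClass_diff {f : Module.End Γ(P.Y, c.U) Γ(L.W, c.U)}
    (hf : IsFilteredId A B c h₁ h₂ f) : IsClass L (diff A B c h₁ h₂) (1 - f) :=
  (exists_diff A B c h₁ h₂).choose_spec f hf

theorem IsFilteredId.eq_diff {f : Module.End Γ(P.Y, c.U) Γ(L.W, c.U)}
    (hf : IsFilteredId A B c h₁ h₂ f) {q : P.Q E 0 c.U} (hq : IsClass L q (1 - f)) :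
    q = diff A B c h₁ h₂ := hq.unique hf.isClass_diff

variable (A B C c h₁ h₂ h₃)

theorem diff_self : diff A A c h₁ h₁ = 0 := by
  have h : IsFilteredId A A c h₁ h₁ 1 := ⟨fun _ => rfl, fun _ _ hw => hw⟩
  refine (h.eq_diff ?_).symm
  rw [sub_self]
  exact IsClass.zero

/-- Differences add up: `1 - g f = (1 - f) + (1 - g)` because `(1 - g) (1 - f)` vanishes. -/
theorem diff_add_diff : diff A B c h₁ h₂ + diff B C c h₂ h₃ = diff A C c h₁ h₃ := by
  obtain ⟨f, hf⟩ := exists_isFilteredId A B c h₁ h₂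
  obtain ⟨g, hg⟩ := exists_isFilteredId B C c h₂ h₃
  have hgf : IsFilteredId A C c h₁ h₃ (g * f) :=
    ⟨fun w => (hg.red _).trans (hf.red w), fun l w hw => hg.fil l _ (hf.fil l w hw)⟩
  refine hgf.eq_diff ?_
  have h0 := (sqZero L c).mul_eq_zero hg.red_one_sub hf.red_one_sub
  have : 1 - g * f = (1 - f) + (1 - g) := by
    rw [← sub_eq_zero, ← neg_eq_zero, ← h0]
    noncomm_ring
  rw [this]
  exact hf.isClass_diff.add hg.isClass_diff

theorem diff_resQ (c' : AffChart P.g) (hc : c'.U ≤ c.U) :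
    P.ResQ E hc (diff A B c h₁ h₂) (diff A B c' (hc.trans h₁) (hc.trans h₂)) := by
  obtain ⟨f, hf⟩ := exists_isFilteredId A B c h₁ h₂
  have hf' : IsFilteredId A B c' (hc.trans h₁) (hc.trans h₂)
      ((extendEnd L.vb c.affU f).map c'.U hc) := by
    refine ⟨fun w => ?_, fun l w hw => ?_⟩
    · exact rho_extendEnd L c.affU hc hf.red w
    · refine A.F.map_mem L.vb c.affU B.F h₁ h₂ _ l l (fun w hw => ?_) c'.U hc w hw
      rw [extendEnd_map]
      exact hf.fil l w hw
  refine hf.isClass_diff.resQ hf'.isClass_diff hc fun w => ?_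
  rw [LinearMap.sub_apply, LinearMap.sub_apply, map_sub, extendEnd_res]
  rfl

/-- The differences on charts, as a section of `𝒞⁰`. -/
noncomputable def diffSec {O : P.Y.Opens} (h₁ : O ≤ O₁) (h₂ : O ≤ O₂) : P.C₀ E O :=
  ⟨fun c => diff A B c.1 (c.2.trans h₁) (c.2.trans h₂),
    fun c c' hc => diff_resQ A B c.1 (c.2.trans h₁) (c.2.trans h₂) c'.1 hc⟩

/-- The difference between the connection of a local lift and the given one. -/
noncomputable def conEnd (θ : LogDer P.g P.D c) : Module.End Γ(P.Y, c.U) Γ(L.W, c.U) where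
  toFun w := A.con.nab c h₁ θ w - L.con.nab c le_top θ w
  map_add' v w := by
    simp only [map_add]
    abel
  map_smul' r w := by
    rw [A.con.leibniz, L.con.leibniz, add_sub_add_left_eq_sub, ← smul_sub, RingHom.id_apply]

theorem red_conEnd (θ : LogDer P.g P.D c) (w : Γ(L.W, c.U)) :
    rho L c.U (A.conEnd c h₁ θ w) = 0 := by
  change rho L c.U (A.con.nab c h₁ θ w - L.con.nab c le_top θ w) = 0
  rw [map_sub, rho_apply, A.con_lifts, rho_apply, L.lifts, sub_self]

theorem exists_conClass (θ : LogDer P.g P.D c) :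
    ∃ q : P.Q E 1 c.U, IsClass L q (A.conEnd c h₁ θ) := exists_isClass 1 (A.red_conEnd c h₁ θ)

/-- The class of `ι⁻¹(∇_A - ∇)`. -/
noncomputable def conClass : LogDer P.g P.D c →ₗ[Γ(P.Y, c.U)] P.Q E 1 c.U where
  toFun θ := (A.exists_conClass c h₁ θ).choose
  map_add' θ η := by
    refine (A.exists_conClass c h₁ (θ + η)).choose_spec.unique ?_
    have : A.conEnd c h₁ (θ + η) = A.conEnd c h₁ θ + A.conEnd c h₁ η := by
      ext w
      change A.con.nab c h₁ (θ + η) w - L.con.nab c le_top (θ + η) w =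
        (A.con.nab c h₁ θ w - L.con.nab c le_top θ w) + (A.con.nab c h₁ η w - L.con.nab c le_top η w)
      rw [A.con.add, L.con.add]
      abel
    rw [this]
    exact (A.exists_conClass c h₁ θ).choose_spec.add (A.exists_conClass c h₁ η).choose_spec
  map_smul' r θ := by
    refine (A.exists_conClass c h₁ (r • θ)).choose_spec.unique ?_
    have : A.conEnd c h₁ (r • θ) = r • A.conEnd c h₁ θ := by
      ext w
      change A.con.nab c h₁ (r • θ) w - L.con.nab c le_top (r • θ) w =
        r • (A.con.nab c h₁ θ w - L.con.nab c le_top θ w)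
      rw [A.con.smul, L.con.smul, smul_sub]
    rw [this]
    exact (A.exists_conClass c h₁ θ).choose_spec.smul r

theorem isClass_conClass (θ : LogDer P.g P.D c) :
    IsClass L (A.conClass c h₁ θ) (A.conEnd c h₁ θ) := (A.exists_conClass c h₁ θ).choose_spec

/-- The classes of `ι⁻¹(∇_A - ∇)` on charts, as a section of `𝒞¹`. -/
noncomputable def conSec {O : P.Y.Opens} (h₁ : O ≤ O₁) : P.C₁ E O :=
  ⟨fun c => A.conClass c.1 (c.2.trans h₁), fun c c' hc θ θ' hθ => by
    refine (A.isClass_conClass c.1 _ θ).resQ (A.isClass_conClass c'.1 _ θ') hc fun w => ?_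
    change A.con.nab c'.1 _ θ' (resM L.W hc w) - L.con.nab c'.1 le_top θ' (resM L.W hc w) =
      resM L.W hc (A.con.nab c.1 _ θ w - L.con.nab c.1 le_top θ w)
    rw [map_sub, A.con.res c.1 (c.2.trans h₁) c'.1 _ hc θ θ' hθ,
      L.con.res c.1 le_top c'.1 le_top hc θ θ' hθ]⟩

/-- The differential of the difference of the filtrations is the difference of the connections:
for a filtered homomorphism `f` lifting the identity, `f ∇_A - ∇_B f` lowers the filtration by at
most one. -/
theorem nabQ_diff (θ : LogDer P.g P.D c) :
    P.nabQ E 0 c θ (diff A B c h₁ h₂) = B.conClass c h₂ θ - A.conClass c h₁ θ := by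
  obtain ⟨f, hf⟩ := exists_isFilteredId A B c h₁ h₂
  have hA := A.isClass_conClass c h₁ θ
  have hB := B.isClass_conClass c h₂ θ
  let χ := commEnd L c θ (1 - f)
  have hχ := hf.isClass_diff.nabQ θ
  rw [← sub_eq_zero]
  refine ((hχ.sub (hB.sub hA)).eq_zero_iff A.lifts B.lifts h₁ h₂).2 fun m w hw => ?_
  have e1 : B.conEnd c h₂ θ (f w) = B.conEnd c h₂ θ w :=
    (sqZero L c).apply_congr (B.red_conEnd c h₂ θ) (hf.red w)
  have e2 : (1 - f) (A.conEnd c h₁ θ w) = 0 :=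
    (sqZero L c).apply_eq_zero hf.red_one_sub (A.red_conEnd c h₁ θ w)
  have e : (χ - (B.conEnd c h₂ θ - A.conEnd c h₁ θ)) w =
      f (A.con.nab c h₁ θ w) - B.con.nab c h₂ θ (f w) := by
    rw [LinearMap.sub_apply, LinearMap.sub_apply, ← e1]
    have e3 : A.conEnd c h₁ θ w = f (A.conEnd c h₁ θ w) := by
      rwa [LinearMap.sub_apply, sub_eq_zero] at e2
    rw [e3]
    change L.con.nab c le_top θ (w - f w) - (L.con.nab c le_top θ w - f (L.con.nab c le_top θ w)) -
      (B.con.nab c h₂ θ (f w) - L.con.nab c le_top θ (f w) -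
        f (A.con.nab c h₁ θ w - L.con.nab c le_top θ w)) = _
    rw [map_sub, map_sub]
    abel
  rw [e]
  exact Submodule.sub_mem _ (hf.fil _ _ (A.griffiths c h₁ θ m w hw))
    (B.griffiths c h₂ θ m _ (hf.fil m w hw))

/-- The class of `∇_A - ∇` is closed: the curvature of `∇_A` lowers the filtration by at most
two. -/
theorem nabQ_conClass (θ η : LogDer P.g P.D c) :
    P.nabQ E 1 c θ (A.conClass c h₁ η) - P.nabQ E 1 c η (A.conClass c h₁ θ) -
      P.projQ E 1 c.U (A.conClass c h₁ (LogDer.bracket θ η)) = 0 := by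
  let χ := fun θ η : LogDer P.g P.D c => commEnd L c θ (A.conEnd c h₁ η)
  have h1 := (A.isClass_conClass c h₁ η).nabQ θ
  have h2 := (A.isClass_conClass c h₁ θ).nabQ η
  have h3 := (A.isClass_conClass c h₁ (LogDer.bracket θ η)).projQ
  refine (((h1.sub h2).sub h3).eq_zero_iff A.lifts A.lifts h₁ h₁).2 fun m w hw => ?_
  have hcon : ∀ (θ : LogDer P.g P.D c) w,
      A.con.nab c h₁ θ w = L.con.nab c le_top θ w + A.conEnd c h₁ θ w := fun θ w => by
    change _ = _ + (A.con.nab c h₁ θ w - L.con.nab c le_top θ w)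
    abel
  have e0 : ∀ (θ η : LogDer P.g P.D c) w, A.conEnd c h₁ θ (A.conEnd c h₁ η w) = 0 := fun θ η w =>
    (sqZero L c).apply_eq_zero (A.red_conEnd c h₁ θ) (A.red_conEnd c h₁ η w)
  have e : (χ θ η - χ η θ - A.conEnd c h₁ (LogDer.bracket θ η)) w =
      A.con.nab c h₁ θ (A.con.nab c h₁ η w) - A.con.nab c h₁ η (A.con.nab c h₁ θ w) -
        A.con.nab c h₁ (LogDer.bracket θ η) w := by
    rw [LinearMap.sub_apply, LinearMap.sub_apply]
    change L.con.nab c le_top θ (A.conEnd c h₁ η w) - A.conEnd c h₁ η (L.con.nab c le_top θ w) -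
      (L.con.nab c le_top η (A.conEnd c h₁ θ w) - A.conEnd c h₁ θ (L.con.nab c le_top η w)) -
      A.conEnd c h₁ (LogDer.bracket θ η) w = _
    simp only [hcon, map_add, e0, ← L.integrable c le_top θ η w]
    abel
  rw [e]
  have hm : ∀ (θ η : LogDer P.g P.D c), A.con.nab c h₁ θ (A.con.nab c h₁ η w) ∈
      A.F.fil (m - (1 + 1)) c.U h₁ := fun θ η => by
    rw [← sub_sub]
    exact A.griffiths c h₁ θ _ _ (A.griffiths c h₁ η m w hw)
  exact Submodule.sub_mem _ (Submodule.sub_mem _ (hm θ η) (hm η θ))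
    (A.F.anti _ _ (by omega) _ _ (A.griffiths c h₁ _ m w hw))

end LocalLift

end LogThickening

/-! ### The obstruction class -/

namespace LogThickening

variable {P : LogThickening.{u}} {E : FilteredDeRhamBundle P.f P.D₀} {L : P.DeRhamLift E}

attribute [local instance] finiteSections projectiveSections

open LocalLift

theorem C₀_ext {O : P.Y.Opens} {s t : P.C₀ E O}
    (h : ∀ (c : AffChart P.g) (hc : c.U ≤ O), P.ev₀ E c hc s = P.ev₀ E c hc t) : s = t :=
  Subtype.ext (funext fun c => h c.1 c.2)

theorem C₁_ext {O : P.Y.Opens} {s t : P.C₁ E O}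
    (h : ∀ (c : AffChart P.g) (hc : c.U ≤ O) (θ : LogDer P.g P.D c),
      P.ev₁ E c hc θ s = P.ev₁ E c hc θ t) : s = t :=
  Subtype.ext (funext fun c => LinearMap.ext fun θ => h c.1 c.2 θ)

namespace LocalSystem

variable (S : LocalSystem L)

/-- The cocycle of a system of local lifts. -/
noncomputable def cocycle : P.Z₁ E S.𝒰 :=
  ⟨(fun x y => diffSec (S.loc x) (S.loc y) inf_le_left inf_le_right,
    fun x => (S.loc x).conSec le_rfl), by
    refine ⟨fun x y w c hx hy hw => ?_, fun x y c hx hy θ => nabQ_diff _ _ c hx hy θ,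
      fun x c hx θ η => nabQ_conClass _ c hx θ η⟩
    change diff (S.loc y) (S.loc w) c hy hw - diff (S.loc x) (S.loc w) c hx hw +
      diff (S.loc x) (S.loc y) c hx hy = 0
    rw [← diff_add_diff (S.loc x) (S.loc y) (S.loc w) c hx hy hw]
    abel⟩

theorem isFilteredId_localIso {O₁ O₂ O : P.Y.Opens} {A : LocalLift L O₁} {B : LocalLift L O₂}
    {h₁ : O ≤ O₁} {h₂ : O ≤ O₂} (f : LocalIso L A.F B.F O h₁ h₂) (c : AffChart P.g)
    (hc : c.U ≤ O) : IsFilteredId A B c (hc.trans h₁) (hc.trans h₂) (f.map c.U hc) :=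
  ⟨f.lifts c.U hc, fun l => f.fil l c.U hc⟩

theorem represents_cocycle : Represents L S S.cocycle :=
  ⟨fun _ _ _ _ _ f c hc => (isFilteredId_localIso f c hc).isClass_diff,
    fun x c hc θ => ⟨(S.loc x).conEnd c hc θ, fun _ => rfl, (S.loc x).isClass_conClass c hc θ⟩⟩

end LocalSystem

/-- On a chart, a filtered homomorphism of modules of sections lifting the identity extends to the
sheaf. -/
theorem LocalLift.exists_localIso {O₁ O₂ : P.Y.Opens} (A : LocalLift L O₁) (B : LocalLift L O₂)
    (c : AffChart P.g) (h₁ : c.U ≤ O₁) (h₂ : c.U ≤ O₂) :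
    Nonempty (LocalIso L A.F B.F c.U h₁ h₂) := by
  obtain ⟨f, hf⟩ := exists_isFilteredId A B c h₁ h₂
  refine ⟨⟨(extendEnd L.vb c.affU f).map, (extendEnd L.vb c.affU f).res, fun U hU w => ?_,
    fun l U hU w hw => ?_⟩⟩
  · exact rho_extendEnd L c.affU hU hf.red w
  · refine A.F.map_mem L.vb c.affU B.F h₁ h₂ _ l l (fun w hw => ?_) U hU w hw
    rw [extendEnd_map]
    exact hf.fil l w hw

namespace LocalSystem

variable (S : LocalSystem L)

/-- A cocycle representing a system of local lifts is determined on charts, as local isomorphisms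
exist there. -/
theorem eq_cocycle (z : P.Z₁ E S.𝒰) (hz : Represents L S z) : z = S.cocycle := by
  refine Subtype.ext (Prod.ext (funext fun x => funext fun y => C₀_ext fun c hc => ?_)
    (funext fun x => C₁_ext fun c hc θ => ?_))
  · have hx := hc.trans inf_le_left
    have hy := hc.trans inf_le_right
    obtain ⟨f⟩ := exists_localIso (S.loc x) (S.loc y) c hx hy
    exact (isFilteredId_localIso f c le_rfl).eq_diff (hz.1 x y c.U hx hy f c le_rfl)
  · obtain ⟨ψ, hψ, hq⟩ := hz.2 x c hc θ
    have : ψ = (S.loc x).conEnd c hc θ := LinearMap.ext hψ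
    rw [this] at hq
    exact hq.unique ((S.loc x).isClass_conClass c hc θ)

end LocalSystem

theorem cls_eq_cls_iff {𝒰 𝒱 : P.Cover} (z : P.Z₁ E 𝒰) (z' : P.Z₁ E 𝒱) :
    P.cls E z = P.cls E z' ↔ ∃ (𝒲 : P.Cover) (h : 𝒰 ≤ 𝒲) (h' : 𝒱 ≤ 𝒲),
      P.resZ₁ E h' z' - P.resZ₁ E h z ∈ P.B₁ E 𝒲 := by
  have key : ∀ (𝒲 : P.Cover) (h : 𝒰 ≤ 𝒲) (h' : 𝒱 ≤ 𝒲),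
      P.resH₁ E 𝒰 𝒲 h (QuotientAddGroup.mk z) = P.resH₁ E 𝒱 𝒲 h' (QuotientAddGroup.mk z') ↔
        P.resZ₁ E h' z' - P.resZ₁ E h z ∈ P.B₁ E 𝒲 := fun 𝒲 h h' => by
    refine (QuotientAddGroup.eq (s := P.B₁ E 𝒲) (a := P.resZ₁ E h z) (b := P.resZ₁ E h' z')).trans ?_
    rw [neg_add_eq_sub]
  constructor
  · intro h
    obtain ⟨𝒲, h, h', e⟩ := Quotient.exact h
    exact ⟨𝒲, h, h', (key 𝒲 h h').1 e⟩
  · rintro ⟨𝒲, h, h', e⟩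
    exact Quotient.sound ⟨𝒲, h, h', (key 𝒲 h h').2 e⟩

theorem cls_eq_zero_iff {𝒰 : P.Cover} (z : P.Z₁ E 𝒰) :
    P.cls E z = 0 ↔ ∃ (𝒲 : P.Cover) (h : 𝒰 ≤ 𝒲), P.resZ₁ E h z ∈ P.B₁ E 𝒲 := by
  have h0 : P.cls E (0 : P.Z₁ E 𝒰) = 0 := (DirectLimit.zero_def (f := P.resH₁ E) 𝒰).symm
  rw [← h0, cls_eq_cls_iff]
  constructor
  · rintro ⟨𝒲, h, h', e⟩
    rw [map_zero, zero_sub] at e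
    exact ⟨𝒲, h, (AddSubgroup.neg_mem_iff _).1 e⟩
  · rintro ⟨𝒲, h, e⟩
    refine ⟨𝒲, h, h, ?_⟩
    rw [map_zero, zero_sub]
    exact AddSubgroup.neg_mem _ e

/-- The class of the cocycle does not depend on the system of local lifts: on a common refinement
the cocycles differ by the coboundary of the differences between the local lifts. -/
theorem LocalSystem.cls_cocycle_eq (S S' : LocalSystem L) :
    P.cls E S.cocycle = P.cls E S'.cocycle := by
  obtain ⟨𝒲, h, h'⟩ := exists_ge_ge S.𝒰 S'.𝒰
  refine (cls_eq_cls_iff _ _).2 ⟨𝒲, h, h', fun x => diffSec (S.loc x) (S'.loc x) (h x) (h' x),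
    fun x y c hx hy => ?_, fun x c hx θ => ?_⟩
  · change diff (S'.loc x) (S'.loc y) c _ _ - diff (S.loc x) (S.loc y) c _ _ =
      diff (S.loc y) (S'.loc y) c (hy.trans (h y)) (hy.trans (h' y)) -
        diff (S.loc x) (S'.loc x) c (hx.trans (h x)) (hx.trans (h' x))
    have h1 := diff_add_diff (S.loc x) (S.loc y) (S'.loc y) c (hx.trans (h x)) (hy.trans (h y))
      (hy.trans (h' y))
    have h2 := diff_add_diff (S.loc x) (S'.loc x) (S'.loc y) c (hx.trans (h x)) (hx.trans (h' x))
      (hy.trans (h' y))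
    rw [sub_eq_sub_iff_add_eq_add, add_comm, h2, add_comm, h1]
  · exact (nabQ_diff (S.loc x) (S'.loc x) c (hx.trans (h x)) (hx.trans (h' x)) θ).symm
 
end LogThickening

/-! ### Gluing local filtrations -/

namespace LogThickening

variable {P : LogThickening.{u}} {E : FilteredDeRhamBundle P.f P.D₀} {L : P.DeRhamLift E}

attribute [local instance] finiteSections projectiveSections

open LocalLift

/-- Lifting a filtration can be checked locally. -/
theorem filLifts_of_locally {O : P.Y.Opens} (F : Filtration L.W O)
    (H : ∀ x ∈ O, ∀ O' : P.Y.Opens, x ∈ O' → ∃ (c : AffChart P.g) (h : c.U ≤ O),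
      x ∈ c.U ∧ c.U ≤ O' ∧ ∀ l (v : P.M E c.U), v ∈ P.filM E l c.U ↔
        ∃ w ∈ F.fil l c.U h, rho L c.U w = v) : FilLifts L F := by
  intro l U hU affU v
  constructor
  · intro hv
    obtain ⟨s, hs⟩ := F.exists_sheaf_projection L.vb affU hU l
    obtain ⟨w, rfl⟩ := L.surj U affU v
    refine ⟨s.map U le_rfl w, (hs U le_rfl).1 w, ?_⟩
    refine resM_ext ((Scheme.Modules.pushforward P.i).obj E.V) _ _ fun x hx => ?_
    obtain ⟨c, h, hxc, hc, e⟩ := H x (hU hx) U hx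
    refine ⟨c.U, hc, hxc, ?_⟩
    obtain ⟨w', hw', hv'⟩ := (e l _).1 (resV_mem hc hv)
    change resV P E hc (rho L U _) = resV P E hc (rho L U w)
    rw [← rho_res, ← s.res U le_rfl _ hc]
    replace hv' : rho L c.U w' = rho L c.U (resM L.W hc w) := by rw [hv', rho_res]; rfl
    rw [(sqZero L c).map_congr _ hv'.symm, (hs c.U hc).2 w' hw', hv', rho_res]
  · rintro ⟨w, hw, rfl⟩
    refine mem_filM_of_locally _ fun x hx => ?_
    obtain ⟨c, h, hxc, hc, e⟩ := H x (hU hx) U hx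
    exact ⟨c.U, hc, hxc, (e l _).2 ⟨_, F.res l _ _ _ h hc w hw, rho_res L hc w⟩⟩

namespace LocalLift

variable {O : P.Y.Opens} (A : LocalLift L O) (c : AffChart P.g) (h : c.U ≤ O) (l : ℤ)

/-- A lift of the whole module is the whole module, by the nilpotence of `I`. -/
theorem fil_eq_top (hl : P.filM E l c.U = ⊤) : A.F.fil l c.U h = ⊤ := by
  rw [Submodule.eq_top_iff']
  intro w
  obtain ⟨w', hw', e⟩ := (A.lifts l c.U h c.affU (rho L c.U w)).1 (hl ▸ Submodule.mem_top)
  have h0 : rho L c.U (w - w') = 0 := by rw [map_sub, rho_apply L c.U w', e, sub_self]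
  rw [← sub_add_cancel w w']
  refine Submodule.add_mem _ ?_ hw'
  refine Submodule.smul_induction_on (((sqZero L c).ker _).1 h0) (fun a ha v _ => ?_)
    fun _ _ => Submodule.add_mem _
  exact (A.filteredLift c h).smul_mem (sqZero L c) ha (hl ▸ Submodule.mem_top)

/-- A direct summand that vanishes modulo `I` is zero: the projection onto it vanishes modulo `I`, so
it kills `I W`. -/
theorem fil_eq_bot (hl : P.filM E l c.U = ⊥) : A.F.fil l c.U h = ⊥ := by
  obtain ⟨p, hp, hp'⟩ := (A.filteredLift c h).proj l
  have h0 : ∀ w ∈ A.F.fil l c.U h, rho L c.U w = 0 := fun w hw => by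
    have := (A.filteredLift c h).red_mem hw
    rwa [hl] at this
  rw [Submodule.eq_bot_iff]
  intro w hw
  rw [← hp' w hw]
  exact (sqZero L c).apply_eq_zero (fun w => h0 _ (hp w)) (h0 w hw)

/-- The computation behind the Griffiths transversality of `(1 + ψ) F`: up to terms that vanish, the
conjugate of `∇` by `1 + ψ` is `∇ + [∇, ψ]`, and this differs from `∇_A` by an endomorphism of degree
`-1`. -/
theorem one_sub_nab_mem (θ : LogDer P.g P.D c) {q : P.Q E 0 c.U}
    {ψ : Module.End Γ(P.Y, c.U) Γ(L.W, c.U)} (hψ : IsClass L q ψ)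
    (hq : IsClass L (P.nabQ E 0 c θ q) (A.conEnd c h θ)) {l : ℤ} {v : Γ(L.W, c.U)}
    (hv : (1 - ψ) v ∈ A.F.fil l c.U h) :
    (1 - ψ) (L.con.nab c le_top θ v) ∈ A.F.fil (l - 1) c.U h := by
  have hχ := hψ.nabQ θ
  have h0 := ((hχ.sub hq).eq_zero_iff A.lifts A.lifts h h).1 (sub_self _) l _ hv
  have h1 := A.griffiths c h θ l _ hv
  have h2 := Submodule.add_mem _ h1 h0
  have e : rho L c.U ((1 - ψ) v) = rho L c.U v := by
    rw [LinearMap.sub_apply, map_sub, hψ.red, sub_zero, Module.End.one_apply]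
  have e1 := (sqZero L c).apply_congr hψ.red e
  have e2 : ψ (L.con.nab c le_top θ ((1 - ψ) v)) = ψ (L.con.nab c le_top θ v) :=
    (sqZero L c).apply_congr hψ.red (by rw [rho_apply, rho_apply, L.lifts, L.lifts, ← rho_apply, e]; rfl)
  have e3 : A.con.nab c h θ ((1 - ψ) v) + (commEnd L c θ ψ - A.conEnd c h θ) ((1 - ψ) v) =
      (1 - ψ) (L.con.nab c le_top θ v) := by
    have e4 : A.conEnd c h θ ((1 - ψ) v) =
      A.con.nab c h θ ((1 - ψ) v) - L.con.nab c le_top θ ((1 - ψ) v) := rfl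
    have e5 : commEnd L c θ ψ ((1 - ψ) v) = L.con.nab c le_top θ (ψ ((1 - ψ) v)) -
      ψ (L.con.nab c le_top θ ((1 - ψ) v)) := rfl
    rw [LinearMap.sub_apply (commEnd L c θ ψ), e4, e5, e1, e2]
    simp only [LinearMap.sub_apply, Module.End.one_apply, map_sub]
    abel
  rwa [e3] at h2

end LocalLift

namespace LocalSystem

variable (S : LocalSystem L) {𝒱 : P.Cover} (h𝒱 : S.𝒰 ≤ 𝒱) (g : ∀ x, P.C₀ E (𝒱.U x))

/-- The filtration that is locally given by `(1 + ψ) (F x)`, for `ψ` in the class `g x`. -/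
def twist (l : ℤ) (U : P.Y.Opens) : Submodule Γ(P.Y, U) Γ(L.W, U) where
  carrier := {v | ∀ (x : P.Y) (c : AffChart P.g) (hx : c.U ≤ 𝒱.U x) (h : c.U ≤ U)
    (ψ : Module.End Γ(P.Y, c.U) Γ(L.W, c.U)), IsClass L (P.ev₀ E c hx (g x)) ψ →
      (1 - ψ) (resM L.W h v) ∈ (S.loc x).F.fil l c.U (hx.trans (h𝒱 x))}
  add_mem' hv hw x c hx h ψ hψ := by
    rw [map_add, map_add]
    exact Submodule.add_mem _ (hv x c hx h ψ hψ) (hw x c hx h ψ hψ)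
  zero_mem' x c hx h ψ hψ := by
    rw [map_zero, map_zero]
    exact Submodule.zero_mem _
  smul_mem' r v hv x c hx h ψ hψ := by
    rw [resM_smul, (1 - ψ).map_smul]
    exact Submodule.smul_mem _ _ (hv x c hx h ψ hψ)

variable {S g}

theorem isClass_restrict (h𝒱 : S.𝒰 ≤ 𝒱) {x : P.Y} {c c' : AffChart P.g} (hx : c.U ≤ 𝒱.U x)
    {ψ : Module.End Γ(P.Y, c.U) Γ(L.W, c.U)} (hψ : IsClass L (P.ev₀ E c hx (g x)) ψ)
    (hc : c'.U ≤ c.U) : IsClass L (P.ev₀ E c' (hc.trans hx) (g x))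
      ((extendEnd L.vb c.affU ψ).map c'.U hc) :=
  hψ.of_resQ ((g x).2 ⟨c, hx⟩ ⟨c', hc.trans hx⟩ hc) (S.loc x).lifts (hx.trans (h𝒱 x))

theorem extendEnd_one_sub_apply {c : AffChart P.g} (ψ : Module.End Γ(P.Y, c.U) Γ(L.W, c.U))
    {U : P.Y.Opens} (h : U ≤ c.U) :
    (extendEnd L.vb c.affU (1 - ψ)).map U h = 1 - (extendEnd L.vb c.affU ψ).map U h := by
  rw [extendEnd_sub, extendEnd_one]
  rfl

theorem one_sub_mul_one_add {c : AffChart P.g} {ψ : Module.End Γ(P.Y, c.U) Γ(L.W, c.U)}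
    (hψ : ∀ w, rho L c.U (ψ w) = 0) : (1 - ψ) * (1 + ψ) = 1 := by
  have h0 := (sqZero L c).mul_eq_zero hψ hψ
  rw [sub_mul, one_mul, mul_add, h0, mul_one, add_zero, add_sub_cancel_right]

theorem one_add_mul_one_sub {c : AffChart P.g} {ψ : Module.End Γ(P.Y, c.U) Γ(L.W, c.U)}
    (hψ : ∀ w, rho L c.U (ψ w) = 0) : (1 + ψ) * (1 - ψ) = 1 := by
  have h0 := (sqZero L c).mul_eq_zero hψ hψ
  rw [add_mul, one_mul, mul_sub, h0, mul_one, sub_zero, sub_add_cancel]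

variable (S g) in
/-- The differences between the local filtrations are the coboundary of `g`. -/
def IsDiffBoundary : Prop :=
  ∀ (x y : P.Y) (c : AffChart P.g) (hx : c.U ≤ 𝒱.U x) (hy : c.U ≤ 𝒱.U y),
    diff (S.loc x) (S.loc y) c (hx.trans (h𝒱 x)) (hy.trans (h𝒱 y)) =
      P.ev₀ E c hy (g y) - P.ev₀ E c hx (g x)

/-- The twisted filtrations of two members of the cover agree on overlaps. -/
theorem one_sub_apply_mem (ha : S.IsDiffBoundary h𝒱 g) {x y : P.Y} {c : AffChart P.g} (hx : c.U ≤ 𝒱.U x) (hy : c.U ≤ 𝒱.U y)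
    {ψ ψ' : Module.End Γ(P.Y, c.U) Γ(L.W, c.U)} (hψ : IsClass L (P.ev₀ E c hx (g x)) ψ)
    (hψ' : IsClass L (P.ev₀ E c hy (g y)) ψ') {l : ℤ} {v : Γ(L.W, c.U)}
    (hv : (1 - ψ) v ∈ (S.loc x).F.fil l c.U (hx.trans (h𝒱 x))) :
    (1 - ψ') v ∈ (S.loc y).F.fil l c.U (hy.trans (h𝒱 y)) := by
  obtain ⟨f, hf⟩ := exists_isFilteredId (S.loc x) (S.loc y) c (hx.trans (h𝒱 x)) (hy.trans (h𝒱 y))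
  have hd := (hψ'.sub hψ).sub hf.isClass_diff
  have h0 := (hd.eq_zero_iff (S.loc x).lifts (S.loc y).lifts (hx.trans (h𝒱 x))
    (hy.trans (h𝒱 y))).1 (by rw [ha x y c hx hy, sub_self]) l _ hv
  rw [sub_zero] at h0
  have e : rho L c.U ((1 - ψ) v) = rho L c.U v := by
    rw [LinearMap.sub_apply, map_sub, hψ.red, sub_zero, Module.End.one_apply]
  have e1 := (sqZero L c).apply_congr hψ.red e
  have e2 := (sqZero L c).apply_congr hψ'.red e
  have h1 := Submodule.sub_mem _ (hf.fil l _ hv) h0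
  have e3 : f ((1 - ψ) v) - (ψ' - ψ - (1 - f)) ((1 - ψ) v) = (1 - ψ') v := by
    simp only [LinearMap.sub_apply (ψ' - ψ), LinearMap.sub_apply ψ',
      LinearMap.sub_apply (1 : Module.End Γ(P.Y, c.U) Γ(L.W, c.U)) f, e1, e2]
    simp only [LinearMap.sub_apply, Module.End.one_apply]
    abel
  rwa [e3] at h1

/-- Membership in the twisted filtration can be tested with a single endomorphism. -/
theorem mem_twist_iff (ha : S.IsDiffBoundary h𝒱 g) {y : P.Y} {c : AffChart P.g} (hy : c.U ≤ 𝒱.U y)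
    {ψ : Module.End Γ(P.Y, c.U) Γ(L.W, c.U)} (hψ : IsClass L (P.ev₀ E c hy (g y)) ψ) {l : ℤ}
    {U : P.Y.Opens} (hU : U ≤ c.U) (v : Γ(L.W, U)) :
    v ∈ S.twist h𝒱 g l U ↔ (extendEnd L.vb c.affU (1 - ψ)).map U hU v ∈
      (S.loc y).F.fil l U ((hU.trans hy).trans (h𝒱 y)) := by
  constructor
  · intro hv
    refine (S.loc y).F.sheaf l U _ _ fun x hx => ?_
    obtain ⟨r, hr, hxr⟩ := exists_basicOpen c.affU (hU hx) hx
    refine ⟨_, hr, hxr, ?_⟩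
    have h1 := hv y (c.basicOpen r) ((hr.trans hU).trans hy) hr _
      (isClass_restrict h𝒱 hy hψ (hr.trans hU))
    rw [← extendEnd_one_sub_apply] at h1
    rwa [← (extendEnd L.vb c.affU (1 - ψ)).res U hU _ (hr.trans hU) hr]
  · intro hv x c' hx h ψ' hψ'
    have h1 := (S.loc y).F.res l _ _ _ (((h.trans hU).trans hy).trans (h𝒱 y)) h _ hv
    rw [← (extendEnd L.vb c.affU (1 - ψ)).res U hU _ (h.trans hU) h, extendEnd_one_sub_apply] at h1
    exact one_sub_apply_mem h𝒱 ha ((h.trans hU).trans hy) hx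
      (isClass_restrict h𝒱 hy hψ (h.trans hU)) hψ' h1

theorem mem_twist_chart_iff (ha : S.IsDiffBoundary h𝒱 g) {y : P.Y} {c : AffChart P.g} (hy : c.U ≤ 𝒱.U y)
    {ψ : Module.End Γ(P.Y, c.U) Γ(L.W, c.U)} (hψ : IsClass L (P.ev₀ E c hy (g y)) ψ) {l : ℤ}
    (v : Γ(L.W, c.U)) : v ∈ S.twist h𝒱 g l c.U ↔
      (1 - ψ) v ∈ (S.loc y).F.fil l c.U (hy.trans (h𝒱 y)) := by
  rw [mem_twist_iff h𝒱 ha hy hψ le_rfl, extendEnd_map]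

theorem one_add_apply_mem_twist (ha : S.IsDiffBoundary h𝒱 g) {y : P.Y} {c : AffChart P.g} (hy : c.U ≤ 𝒱.U y)
    {ψ : Module.End Γ(P.Y, c.U) Γ(L.W, c.U)} (hψ : IsClass L (P.ev₀ E c hy (g y)) ψ) {l : ℤ}
    {v : Γ(L.W, c.U)} (hv : v ∈ (S.loc y).F.fil l c.U (hy.trans (h𝒱 y))) :
    (1 + ψ) v ∈ S.twist h𝒱 g l c.U := by
  rw [mem_twist_chart_iff h𝒱 ha hy hψ, ← Module.End.mul_apply, one_sub_mul_one_add hψ.red]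
  exact hv

theorem twist_summand (ha : S.IsDiffBoundary h𝒱 g) (l : ℤ) {y : P.Y} {c : AffChart P.g} (hy : c.U ≤ 𝒱.U y) :
    ∃ G : ∀ W : P.Y.Opens, Submodule Γ(P.Y, W) Γ(L.W, W),
      (∀ W (_ : W ≤ c.U) W' (h : W' ≤ W) (v : Γ(L.W, W)), v ∈ G W → resM L.W h v ∈ G W') ∧
      ∀ W (_ : W ≤ c.U), IsCompl (S.twist h𝒱 g l W) (G W) := by
  obtain ⟨ψ, hψ⟩ := exists_of_class L (P.ev₀ E c hy (g y))
  obtain ⟨s, hs⟩ := (S.loc y).F.exists_sheaf_projection L.vb c.affU (hy.trans (h𝒱 y)) l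
  let t := extendEnd L.vb c.affU (1 + ψ)
  let t' := extendEnd L.vb c.affU (1 - ψ)
  have htt : t' * t = 1 := by
    rw [← extendEnd_mul, one_sub_mul_one_add hψ.red, extendEnd_one]
  have htt' : t * t' = 1 := by
    rw [← extendEnd_mul, one_add_mul_one_sub hψ.red, extendEnd_one]
  refine exists_isCompl_of_projection (O := ⊤) le_top (fun W _ => S.twist h𝒱 g l W) (t * (s * t'))
    (fun W hW w => ?_) fun W hW w hw => ?_
  · rw [mem_twist_iff h𝒱 ha hy hψ hW]
    change (t' * t).map W hW ((s * t').map W hW w) ∈ _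
    rw [htt]
    exact (hs W hW).1 _
  · rw [mem_twist_iff h𝒱 ha hy hψ hW] at hw
    change t.map W hW (s.map W hW (t'.map W hW w)) = w
    rw [(hs W hW).2 _ hw]
    change (t * t').map W hW w = w
    rw [htt']
    rfl

/-- The filtration obtained by gluing. -/
noncomputable def twistFiltration (ha : S.IsDiffBoundary h𝒱 g) : Filtration L.W ⊤ where
  fil l U _ := S.twist h𝒱 g l U
  res l U _ W _ h v hv x c hx hc ψ hψ := by
    rw [resM_resM]
    exact hv x c hx (hc.trans h) ψ hψ
  sheaf l U _ v H x c hx hc ψ hψ := by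
    refine (S.loc x).F.sheaf l _ _ _ fun y hy => ?_
    obtain ⟨W, hW, hyW, hv⟩ := H y (hc hy)
    obtain ⟨r, hr, hyr⟩ := exists_basicOpen c.affU hy hyW
    have hrc := P.Y.basicOpen_le r
    refine ⟨_, hrc, hyr, ?_⟩
    have h1 := hv x (c.basicOpen r) (hrc.trans hx) hr _ (isClass_restrict h𝒱 hx hψ hrc)
    rw [resM_resM, ← extendEnd_one_sub_apply] at h1
    rw [← extendEnd_res L.vb c.affU (1 - ψ) hrc, resM_resM]
    exact h1
  anti l m hlm U _ v hv x c hx h ψ hψ := (S.loc x).F.anti l m hlm _ _ (hv x c hx h ψ hψ)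
  summand l y _ := by
    obtain ⟨c, hyc, hc⟩ := exists_affChart P.g (𝒱.mem y)
    exact ⟨c.U, le_top, hyc, twist_summand h𝒱 ha l hc⟩
  bounded := by
    obtain ⟨N, hN⟩ := E.F.bounded
    have htop : ∀ U, P.filM E (-N) U = ⊤ := fun U => by
      rw [Submodule.eq_top_iff']
      intro v
      exact (Submodule.eq_top_iff'.1 (hN (P.i ⁻¹ᵁ U) le_top).1) v
    have hbot : ∀ U, P.filM E (N + 1) U = ⊥ := fun U => by
      rw [Submodule.eq_bot_iff]
      intro v hv
      exact (Submodule.eq_bot_iff _).1 (hN (P.i ⁻¹ᵁ U) le_top).2 v hv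
    refine ⟨N, fun U _ => ⟨?_, ?_⟩⟩
    · rw [Submodule.eq_top_iff']
      intro v x c hx h ψ hψ
      rw [fil_eq_top _ _ _ _ (htop _)]
      trivial
    · rw [Submodule.eq_bot_iff]
      intro v hv
      refine resM_ext _ _ _ fun x hx => ?_
      obtain ⟨c, hxc, hc⟩ := exists_affChart P.g (O := U ⊓ 𝒱.U x) ⟨hx, 𝒱.mem x⟩
      obtain ⟨ψ, hψ⟩ := exists_of_class L (P.ev₀ E c (hc.trans inf_le_right) (g x))
      refine ⟨c.U, hc.trans inf_le_left, hxc, ?_⟩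
      have h0 := hv x c (hc.trans inf_le_right) (hc.trans inf_le_left) ψ hψ
      rw [fil_eq_bot _ _ _ _ (hbot _), Submodule.mem_bot] at h0
      rw [map_zero, ← Module.End.one_apply (R := Γ(P.Y, c.U)) (resM L.W _ v),
        ← one_add_mul_one_sub hψ.red, Module.End.mul_apply, h0, map_zero]

theorem filLifts_twist (ha : S.IsDiffBoundary h𝒱 g) : FilLifts L (twistFiltration h𝒱 ha) := by
  refine filLifts_of_locally _ fun x _ O hO => ?_
  obtain ⟨c, hxc, hc⟩ := exists_affChart P.g (O := O ⊓ 𝒱.U x) ⟨hO, 𝒱.mem x⟩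
  have hx := hc.trans inf_le_right
  obtain ⟨ψ, hψ⟩ := exists_of_class L (P.ev₀ E c hx (g x))
  refine ⟨c, le_top, hxc, hc.trans inf_le_left, fun l v => ?_⟩
  refine ((S.loc x).lifts l c.U (hx.trans (h𝒱 x)) c.affU v).trans ⟨?_, ?_⟩
  · rintro ⟨w, hw, rfl⟩
    refine ⟨_, one_add_apply_mem_twist h𝒱 ha hx hψ hw, ?_⟩
    rw [LinearMap.add_apply, map_add, hψ.red, add_zero]
    rfl
  · rintro ⟨w, hw, rfl⟩
    refine ⟨_, (mem_twist_chart_iff h𝒱 ha hx hψ w).1 hw, ?_⟩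
    rw [← rho_apply, LinearMap.sub_apply, map_sub, hψ.red, sub_zero]
    rfl

/-- If the differential of `g` is the difference of the connections, then the glued filtration is
Griffiths transverse. -/
theorem griffiths_twist (ha : S.IsDiffBoundary h𝒱 g) (hb : ∀ (x : P.Y) (c : AffChart P.g) (hx : c.U ≤ 𝒱.U x)
    (θ : LogDer P.g P.D c), (S.loc x).conClass c (hx.trans (h𝒱 x)) θ =
      P.nabQ E 0 c θ (P.ev₀ E c hx (g x))) : Griffiths L.con (twistFiltration h𝒱 ha) := by
  intro c hO θ l v hv
  refine (twistFiltration h𝒱 ha).sheaf _ _ _ _ fun y hy => ?_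
  obtain ⟨r, hr, hyr⟩ := exists_basicOpen c.affU hy (𝒱.mem y)
  obtain ⟨θ', hθ'⟩ := LogDer.exists_res θ r
  have hrc := P.Y.basicOpen_le r
  refine ⟨_, hrc, hyr, ?_⟩
  rw [← L.con.res c hO (c.basicOpen r) le_top hrc θ θ' hθ']
  replace hv := (twistFiltration h𝒱 ha).res l _ le_top _ le_top hrc v hv
  obtain ⟨ψ, hψ⟩ := exists_of_class L (P.ev₀ E (c.basicOpen r) hr (g y))
  refine (mem_twist_chart_iff h𝒱 ha (c := c.basicOpen r) hr hψ _).2 ?_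
  replace hv := (mem_twist_chart_iff h𝒱 ha (c := c.basicOpen r) hr hψ _).1 hv
  have hc' : (c.basicOpen r).U ≤ S.𝒰.U y := hr.trans (h𝒱 y)
  have hB := (S.loc y).isClass_conClass (c.basicOpen r) hc' θ'
  rw [hb y _ hr θ'] at hB
  exact one_sub_nab_mem (S.loc y) (c.basicOpen r) hc' θ' hψ hB hv

end LocalSystem

end LogThickening

/-! ### Existence of local lifts -/

namespace LogThickening

variable {P : LogThickening.{u}} {E : FilteredDeRhamBundle P.f P.D₀} {L : P.DeRhamLift E}

attribute [local instance] finiteSections projectiveSections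

theorem exists_filM_projection (c : AffChart P.g) (l : ℤ) : ∃ p : P.EndV E c.U,
    (∀ v, p v ∈ P.filM E l c.U) ∧ ∀ v ∈ P.filM E l c.U, p v = v := by
  obtain ⟨p, hp, hp'⟩ := E.F.exists_projection E.vb (P.chart₀ c).affU le_top l
  exact ⟨⟨⟨p, p.map_add⟩, fun r v => p.map_smul (P.red c.U r) v⟩, hp, hp'⟩

variable (L) in
/-- On a chart the filtration lifts, to the images of idempotents that lift projections onto its
steps. -/
theorem exists_filLifts (c : AffChart P.g) : ∃ F : Filtration L.W c.U, FilLifts L F := by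
  obtain ⟨N, hN⟩ := E.F.bounded
  obtain ⟨p, hp, htop, hbot, hmem, hfix⟩ := (sqZero L c).exists_idempotents
    (G := fun l => P.filM E l c.U) (fun l m h => filM_anti h c.U) (exists_filM_projection c) N
    (Submodule.eq_top_iff'.2 fun v => Submodule.eq_top_iff'.1 (hN (P.i ⁻¹ᵁ c.U) le_top).1 v)
    ((Submodule.eq_bot_iff _).2 fun v hv =>
      (Submodule.eq_bot_iff _).1 (hN (P.i ⁻¹ᵁ c.U) le_top).2 v hv)
  let s := fun l => extendEnd L.vb c.affU (p l)
  have hs : ∀ l m, l ≤ m → ∀ U (hU : U ≤ c.U) w, (s l).map U hU ((s m).map U hU w) =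
      (s m).map U hU w := by
    intro l m h U hU w
    change (s l * s m).map U hU w = _
    rw [← extendEnd_mul, hp l m h]
  let F : Filtration L.W c.U :=
    { fil := fun l U hU => LinearMap.ker ((s l).map U hU - 1)
      res := fun l U hU W hW h v hv => by
        rw [LinearMap.mem_ker, LinearMap.sub_apply, sub_eq_zero] at hv ⊢
        rw [(s l).res U hU, hv]
        rfl
      sheaf := fun l U hU v H => by
        rw [LinearMap.mem_ker, LinearMap.sub_apply, sub_eq_zero]
        refine resM_ext _ _ _ fun x hx => ?_
        obtain ⟨W, h, hxW, hv⟩ := H x hx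
        rw [LinearMap.mem_ker, LinearMap.sub_apply, sub_eq_zero] at hv
        refine ⟨W, h, hxW, ?_⟩
        rw [← (s l).res U hU W (h.trans hU), hv]
        rfl
      anti := fun l m h U hU v hv => by
        rw [LinearMap.mem_ker, LinearMap.sub_apply, sub_eq_zero] at hv ⊢
        rw [← Module.End.one_apply (R := Γ(P.Y, U)) v, ← hv, hs l m h]
        rfl
      summand := fun l x hx => ⟨c.U, le_rfl, hx, exists_isCompl_of_projection le_rfl
        (fun U hU => LinearMap.ker ((s l).map U hU - 1)) (s l) (fun W hW w => by
          rw [LinearMap.mem_ker, LinearMap.sub_apply, hs l l le_rfl, Module.End.one_apply, sub_self])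
        (fun W hW w hw => by
          rwa [LinearMap.mem_ker, LinearMap.sub_apply, sub_eq_zero] at hw)⟩
      bounded := ⟨N, fun U hU => by
        constructor
        · rw [Submodule.eq_top_iff']
          intro v
          change v ∈ LinearMap.ker ((extendEnd L.vb c.affU (p (-N))).map U hU - 1)
          rw [htop, extendEnd_one, LinearMap.mem_ker]
          exact sub_self _
        · rw [Submodule.eq_bot_iff]
          intro v hv
          change v ∈ LinearMap.ker ((extendEnd L.vb c.affU (p (N + 1))).map U hU - 1) at hv
          rw [hbot, extendEnd_zero, LinearMap.mem_ker] at hv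
          exact (sub_eq_zero.1 hv).symm⟩ }
  refine ⟨F, filLifts_of_locally F fun x hx O hO => ?_⟩
  obtain ⟨r, hr, hxr⟩ := exists_basicOpen c.affU hx hO
  have hle := P.Y.basicOpen_le r
  have hunit := isUnit_resO r hle le_rfl
  refine ⟨c.basicOpen r, hle, hxr, hr, fun l v => ⟨fun hv => ?_, ?_⟩⟩
  · obtain ⟨n, v', hv', e⟩ := E.F.exists_res_eq E.vb (P.chart₀ c).affU le_top l (P.red c.U r)
      ((TopologicalSpace.Opens.map P.i.base).monotone hle)
      (Scheme.preimage_basicOpen P.i r) v hv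
    obtain ⟨w', rfl⟩ := (sqZero L c).surj v'
    have h0 : resO ((TopologicalSpace.Opens.map P.i.base).monotone hle) (P.red c.U r) ^ n =
        P.red _ (resO hle r ^ n) := by rw [map_pow, red_resO]
    have e' : resV P E hle (rho L c.U w') = resO hle r ^ n • v :=
      e.trans (congrArg (fun a => a • (show Γ(E.V, P.i ⁻¹ᵁ P.Y.basicOpen r) from v)) h0)
    rw [← hfix l w' hv', ← rho_res] at e'
    obtain ⟨a, ha⟩ := hunit.pow n
    refine ⟨(a⁻¹.1 : Γ(P.Y, P.Y.basicOpen r)) • resM L.W hle (p l w'), ?_, ?_⟩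
    · refine Submodule.smul_mem _ _ ?_
      refine F.res l c.U le_rfl _ hle hle _ ?_
      rw [LinearMap.mem_ker, LinearMap.sub_apply, extendEnd_map, ← Module.End.mul_apply, hp l l le_rfl]
      exact sub_self _
    · rw [map_smul, e', ← ha, smul_smul, Units.inv_mul, one_smul]
  · rintro ⟨w, hw, rfl⟩
    rw [LinearMap.mem_ker, LinearMap.sub_apply, sub_eq_zero, Module.End.one_apply] at hw
    obtain ⟨n, u, hu⟩ := (L.vb.qcAt c.affU).surj r _ hle rfl w
    have h1 := resV_mem hle (hmem l u)
    rw [← rho_res, ← extendEnd_res L.vb c.affU (p l) hle, hu, map_smul, map_smul] at h1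
    obtain ⟨a, ha⟩ := hunit.pow n
    have h2 := Submodule.smul_mem _ (a⁻¹.1 : Γ(P.Y, P.Y.basicOpen r)) h1
    rw [← ha, smul_smul, Units.inv_mul, one_smul] at h2
    rw [← hw]
    exact h2

/-- A connection for which a lifted filtration is Griffiths transverse is obtained from a given one
by truncation: if the `e k` are the components of a splitting of the filtration and `p l` is a
projection onto its `l`-th member, then `∑ p (k - 1) ∘ ∇ ∘ e k` is a connection. -/
theorem exists_griffiths {c : AffChart P.g} (F : Filtration L.W c.U) (hF : FilLifts L F) :
    ∃ con : LogConnection P.g P.D L.W c.U, ConLifts L con ∧ Griffiths con F := by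
  choose s hs using fun l => F.exists_sheaf_projection L.vb c.affU le_rfl l
  obtain ⟨N, hN⟩ := F.bounded
  let e := fun (U : P.Y.Opens) (hU : U ≤ c.U) (k : ℕ) =>
    (s (k - N)).map U hU - (s (k - N + 1)).map U hU
  have split := fun (U : P.Y.Opens) (hU : U ≤ c.U) =>
    HodgeDef.exists_splitting (F := fun l => F.fil l U hU) (fun l => (s l).map U hU) N
      (fun l m h => F.anti l m h U hU) (fun l => (hs l U hU).1) (fun l => (hs l U hU).2)
      (hN U hU).1 (hN U hU).2
  have he : ∀ U hU (k : ℕ) w, (s (k - N - 1)).map U hU (e U hU k w) = e U hU k w := fun U hU k w =>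
    (hs _ U hU).2 _ (F.anti (k - N - 1) (k - N) (by omega) U hU ((split U hU).1 k w))
  let nab : ∀ c' : AffChart P.g, c'.U ≤ c.U → LogDer P.g P.D c' → Γ(L.W, c'.U) →+ Γ(L.W, c'.U) :=
    fun c' h θ =>
      { toFun := fun v => ∑ k ∈ Finset.range (2 * N + 1),
          (s (k - N - 1)).map c'.U h (L.con.nab c' le_top θ (e c'.U h k v))
        map_zero' := Finset.sum_eq_zero fun k _ => by rw [map_zero, map_zero, map_zero]
        map_add' := fun v w => by simp only [map_add, Finset.sum_add_distrib] }
  have hnab : ∀ c' h θ v, nab c' h θ v = ∑ k ∈ Finset.range (2 * N + 1),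
      (s (k - N - 1)).map c'.U h (L.con.nab c' le_top θ (e c'.U h k v)) := fun _ _ _ _ => rfl
  refine ⟨⟨nab, fun c' h θ η v => ?_, fun c' h r θ v => ?_, fun c' h θ r v => ?_,
    fun c₁ h₁ c₂ h₂ hc θ θ' hθ v => ?_⟩, fun c' h θ w => ?_, fun c' h θ l v hv => ?_⟩
  · simp only [hnab, L.con.add, map_add, Finset.sum_add_distrib]
  · simp only [hnab, L.con.smul, map_smul, Finset.smul_sum]
  · rw [hnab, hnab]
    nth_rewrite 2 [← (split c'.U h).2.1 v]
    rw [Finset.smul_sum, Finset.smul_sum, ← Finset.sum_add_distrib]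
    refine Finset.sum_congr rfl fun k _ => ?_
    rw [map_smul, L.con.leibniz, map_add, map_smul, map_smul, he]
  · rw [hnab, hnab, resM_sum]
    refine Finset.sum_congr rfl fun k _ => ?_
    have hr : e c₂.U h₂ k (resM L.W hc v) = resM L.W hc (e c₁.U h₁ k v) := by
      change (s (k - N)).map c₂.U h₂ _ - (s (k - N + 1)).map c₂.U h₂ _ = _
      rw [(s _).res c₁.U h₁, (s _).res c₁.U h₁, ← map_sub]
      rfl
    rw [hr, L.con.res c₁ le_top c₂ le_top hc θ θ' hθ, (s _).res c₁.U h₁]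
  · change rho L c'.U (nab c' h θ w) = P.nab E c' θ (rho L c'.U w)
    rw [hnab]
    nth_rewrite 2 [← (split c'.U h).2.1 w]
    rw [map_sum, map_sum, map_sum]
    refine Finset.sum_congr rfl fun k _ => ?_
    have hlift := filteredLift hF c' h
    have hρ : rho L c'.U (L.con.nab c' le_top θ (e c'.U h k w)) =
      P.nab E c' θ (rho L c'.U (e c'.U h k w)) := L.lifts c' θ _
    refine Eq.trans (hlift.red_proj (sqZero L c') (hs _ c'.U h).2 ?_) hρ
    rw [hρ]
    exact E.griffiths (P.chart₀ c') le_top (P.redLog c' θ) (k - N) _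
      (hlift.red_mem ((split c'.U h).1 k w))
  · change nab c' h θ v ∈ _
    rw [hnab]
    refine Submodule.sum_mem _ fun k _ => ?_
    by_cases hk : (k : ℤ) - N < l
    · have h0 : e c'.U h k v = 0 := (split c'.U h).2.2 l v hv k hk
      rw [h0, map_zero, map_zero]
      exact Submodule.zero_mem _
    · exact F.anti _ _ (by omega) _ _ ((hs (k - N - 1) c'.U h).1 _)

variable (L) in
theorem nonempty_localSystem : Nonempty (LocalSystem L) := by
  choose c hc using fun y : P.Y => exists_affChart P.g (Opens.mem_top y)
  choose F hF using fun y => exists_filLifts L (c y)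
  choose con hcon hG using fun y => exists_griffiths (F y) (hF y)
  exact ⟨⟨⟨fun y => (c y).U, fun y => (hc y).1⟩, fun y => ⟨con y, hcon y, F y, hF y, hG y⟩⟩⟩

end LogThickening

/-! ### Global lifts -/

namespace LogThickening

variable {P : LogThickening.{u}} {E : FilteredDeRhamBundle P.f P.D₀} {L : P.DeRhamLift E}

attribute [local instance] finiteSections projectiveSections

open LocalLift

theorem _root_.HodgeDef.Filtration.ext_fil {X : Scheme.{u}} {V : X.Modules} {O : X.Opens}
    {F F' : Filtration V O} (h : ∀ l U hU, F.fil l U hU = F'.fil l U hU) : F = F' := by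
  have : F.fil = F'.fil := funext fun l => funext fun U => funext fun hU => h l U hU
  cases F
  cases F'
  cases this
  rfl

namespace HodgeLift

/-- A global lift, regarded as a local lift. -/
def toLocalLift (F : HodgeLift L) : LocalLift L ⊤ :=
  ⟨L.con, fun c _ => L.lifts c, F.F, F.lifts, F.griffiths⟩

/-- The system of local lifts given by a global lift. -/
def toLocalSystem (F : HodgeLift L) : LocalSystem L :=
  ⟨⟨fun _ => ⊤, fun _ => trivial⟩, fun _ => F.toLocalLift⟩

variable (F F' F'' : HodgeLift L)

theorem conClass_toLocalLift (c : AffChart P.g) (θ : LogDer P.g P.D c) :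
    F.toLocalLift.conClass c le_top θ = 0 := by
  refine (F.toLocalLift.isClass_conClass c le_top θ).unique ?_
  have : F.toLocalLift.conEnd c le_top θ = 0 := LinearMap.ext fun w => sub_self _
  rw [this]
  exact IsClass.zero

theorem cls_toLocalSystem : P.cls E F.toLocalSystem.cocycle = 0 := by
  refine (cls_eq_zero_iff _).2 ⟨_, le_rfl, 0, fun x y c hx hy => ?_, fun x c hx θ => ?_⟩
  · refine (diff_self F.toLocalLift c le_top).trans ?_
    change 0 = P.ev₀ E c hy 0 - P.ev₀ E c hx 0
    rw [map_zero, map_zero, sub_zero]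
  · refine (F.conClass_toLocalLift c θ).trans ?_
    change 0 = P.nabQ E 0 c θ (P.ev₀ E c hx 0)
    rw [map_zero, map_zero]

/-- The difference of two lifts of the filtration. -/
noncomputable def sub : P.H₀ E :=
  ⟨diffSec F'.toLocalLift F.toLocalLift le_rfl le_rfl, fun c θ => by
    refine (nabQ_diff F'.toLocalLift F.toLocalLift c le_top le_top θ).trans ?_
    rw [conClass_toLocalLift, conClass_toLocalLift, sub_zero]⟩

theorem ev₀_sub (c : AffChart P.g) :
    P.ev₀ E c le_top (sub F F').1 = diff F'.toLocalLift F.toLocalLift c le_top le_top := rfl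

theorem sub_self_eq_zero : sub F F = 0 :=
  Subtype.ext (C₀_ext fun c _ => diff_self F.toLocalLift c le_top)

theorem sub_add_sub : sub F F' + sub F' F'' = sub F F'' :=
  Subtype.ext (C₀_ext fun c hc => by
    have h := diff_add_diff F''.toLocalLift F'.toLocalLift F.toLocalLift c hc hc hc
    rw [add_comm] at h
    exact h)

variable {F F'} in
/-- If the difference vanishes, then `1 - f` respects the filtrations for every filtered homomorphism
`f` lifting the identity, hence so does the identity. -/
theorem le_of_sub_eq_zero (h : sub F F' = 0) (l : ℤ) (U : P.Y.Opens) (hU : U ≤ ⊤) :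
    F'.F.fil l U hU ≤ F.F.fil l U hU := by
  intro v hv
  refine F.F.sheaf l U hU v fun x hx => ?_
  obtain ⟨c, hxc, hc⟩ := exists_affChart P.g hx
  refine ⟨c.U, hc, hxc, ?_⟩
  replace hv := F'.F.res l U hU c.U le_top hc v hv
  obtain ⟨f, hf⟩ := exists_isFilteredId F'.toLocalLift F.toLocalLift c le_top le_top
  have h0 : diff F'.toLocalLift F.toLocalLift c le_top le_top = 0 := by
    rw [← ev₀_sub, h]
    rfl
  have h1 := (hf.isClass_diff.eq_zero_iff F'.lifts F.lifts le_top le_top).1 h0 l _ hv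
  rw [sub_zero] at h1
  have h2 := Submodule.add_mem _ h1 (hf.fil l _ hv)
  rwa [LinearMap.sub_apply, sub_add_cancel] at h2

variable {F F'} in
theorem eq_of_sub_eq_zero (h : sub F F' = 0) : F = F' := by
  have h' : sub F' F = 0 := by
    rw [← zero_add (sub F' F), ← h, sub_add_sub, sub_self_eq_zero, h]
  have e : F.F = F'.F := Filtration.ext_fil fun l U hU =>
    le_antisymm (le_of_sub_eq_zero h' l U hU) (le_of_sub_eq_zero h l U hU)
  cases F
  cases F'
  cases e
  rfl

variable {F F' F''} in
theorem eq_of_sub_eq_sub (h : sub F' F = sub F'' F) : F' = F'' := by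
  refine eq_of_sub_eq_zero ?_
  rw [← sub_add_sub F' F F'', h, sub_add_sub, sub_self_eq_zero]

end HodgeLift

/-- If the cocycle of a system of local lifts is the coboundary of `g`, then the filtrations given by
`g` glue to a global lift of the filtration. -/
theorem LocalSystem.exists_hodgeLift (S : LocalSystem L) {𝒱 : P.Cover} (h𝒱 : S.𝒰 ≤ 𝒱)
    {g : ∀ x, P.C₀ E (𝒱.U x)} (ha : S.IsDiffBoundary h𝒱 g)
    (hb : ∀ (x : P.Y) (c : AffChart P.g) (hx : c.U ≤ 𝒱.U x) (θ : LogDer P.g P.D c),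
      (S.loc x).conClass c (hx.trans (h𝒱 x)) θ = P.nabQ E 0 c θ (P.ev₀ E c hx (g x))) :
    ∃ F : HodgeLift L, ∀ (x : P.Y) (c : AffChart P.g) (hx : c.U ≤ 𝒱.U x),
      diff (S.loc x) F.toLocalLift c (hx.trans (h𝒱 x)) le_top = -P.ev₀ E c hx (g x) := by
  refine ⟨⟨twistFiltration h𝒱 ha, filLifts_twist h𝒱 ha, griffiths_twist h𝒱 ha hb⟩,
    fun x c hx => ?_⟩
  obtain ⟨ψ, hψ⟩ := exists_of_class L (P.ev₀ E c hx (g x))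
  refine (IsFilteredId.eq_diff (f := 1 + ψ) ⟨fun w => ?_, fun l w hw => ?_⟩ ?_).symm
  · rw [LinearMap.add_apply, map_add, hψ.red, add_zero, Module.End.one_apply]
  · exact one_add_apply_mem_twist h𝒱 ha hx hψ hw
  · rw [sub_add_cancel_left]
    exact hψ.neg

/-- The class of the cocycle is the obstruction to the existence of a global lift. -/
theorem LocalSystem.cls_cocycle_eq_zero_iff (S : LocalSystem L) :
    P.cls E S.cocycle = 0 ↔ Nonempty (HodgeLift L) := by
  constructor
  · intro h
    obtain ⟨𝒲, h𝒲, g, ha, hb⟩ := (cls_eq_zero_iff _).1 h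
    obtain ⟨F, -⟩ := S.exists_hodgeLift h𝒲 (g := g) ha hb
    exact ⟨F⟩
  · rintro ⟨F⟩
    rw [S.cls_cocycle_eq F.toLocalSystem, F.cls_toLocalSystem]

namespace HodgeLift

/-- Every element of `ℍ⁰(𝒞)` is the difference from `F` of another lift, which is glued from the
filtrations `(1 - ψ) F` for `ψ` in the class `s`. -/
theorem exists_sub_eq (F : HodgeLift L) (s : P.H₀ E) : ∃ F' : HodgeLift L, sub F' F = s := by
  obtain ⟨F', hF'⟩ := F.toLocalSystem.exists_hodgeLift le_rfl (g := fun _ => -s.1)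
    (fun x y c hx hy => (diff_self F.toLocalLift c le_top).trans (sub_self _).symm)
    (fun x c hx θ => by
      refine (F.conClass_toLocalLift c θ).trans ?_
      have h0 : P.nabQ E 0 c θ (P.ev₀ E c le_top (-s.1)) = 0 := by
        rw [map_neg, map_neg, s.2 c θ, neg_zero]
      exact h0.symm)
  refine ⟨F', Subtype.ext (C₀_ext fun c hc => ?_)⟩
  rcases isEmpty_or_nonempty P.Y with hY | ⟨⟨x⟩⟩
  · -- Without points, the index set of the cover is empty, but all sections vanish.
    obtain ⟨ψ, hψ⟩ := exists_of_class L (P.ev₀ E c hc (sub F' F).1)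
    obtain ⟨ψ', hψ'⟩ := exists_of_class L (P.ev₀ E c hc s.1)
    have : ψ = ψ' := LinearMap.ext fun w => resM_ext _ _ _ fun x => hY.elim x
    rw [this] at hψ
    exact hψ.unique hψ'
  · refine (hF' x c le_top).trans ?_
    change -P.ev₀ E c hc (-s.1) = _
    rw [map_neg, neg_neg]

/-- The lifts of the filtration form a torsor under `ℍ⁰(𝒞)`. -/
noncomputable abbrev addTorsor (h : Nonempty (HodgeLift L)) : AddTorsor (P.H₀ E) (HodgeLift L) where
  vadd s F := (F.exists_sub_eq s).choose
  vsub := sub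
  zero_vadd F := eq_of_sub_eq_zero (F.exists_sub_eq 0).choose_spec
  add_vadd s t F := by
    refine eq_of_sub_eq_sub (F := F) ((F.exists_sub_eq (s + t)).choose_spec.trans ?_)
    have h1 := (F.exists_sub_eq t).choose_spec
    have h2 := ((F.exists_sub_eq t).choose.exists_sub_eq s).choose_spec
    exact (congrArg₂ (· + ·) h2.symm h1.symm).trans (sub_add_sub _ _ _)
  vsub_vadd' F' F := eq_of_sub_eq_sub (F.exists_sub_eq (sub F' F)).choose_spec
  vadd_vsub' s F := (F.exists_sub_eq s).choose_spec

theorem isDifference_sub (F F' : HodgeLift L) : IsDifference L F F' (sub F' F) := by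
  refine ⟨fun y => ?_, fun O f c hc => ?_⟩
  · obtain ⟨c, hyc, -⟩ := exists_affChart P.g (Opens.mem_top y)
    exact ⟨c.U, hyc, exists_localIso F.toLocalLift F'.toLocalLift c le_top le_top⟩
  · exact (LocalSystem.isFilteredId_localIso (A := F.toLocalLift) (B := F'.toLocalLift) f c hc).isClass_diff

end HodgeLift

end LogThickening

end HodgeDef

theorem mainTheorem2 (P : HodgeDef.LogThickening.{u}) (E : HodgeDef.FilteredDeRhamBundle P.f P.D₀)
    (L : P.DeRhamLift E) :
    (Nonempty (HodgeDef.LogThickening.LocalSystem L) ∧ ∃ o : P.H₁ E,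
      (∀ S : HodgeDef.LogThickening.LocalSystem L,
        ∃! z : P.Z₁ E S.𝒰, HodgeDef.LogThickening.Represents L S z) ∧
      (∀ (S : HodgeDef.LogThickening.LocalSystem L) (z : P.Z₁ E S.𝒰),
        HodgeDef.LogThickening.Represents L S z → P.cls E z = o) ∧
      (o = 0 ↔ Nonempty (HodgeDef.LogThickening.HodgeLift L))) ∧
    (Nonempty (HodgeDef.LogThickening.HodgeLift L) →
      ∃ t : AddTorsor (P.H₀ E) (HodgeDef.LogThickening.HodgeLift L),
        ∀ F F' : HodgeDef.LogThickening.HodgeLift L,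
          HodgeDef.LogThickening.IsDifference L F F' (t.toVSub.vsub F' F)) := by
  obtain ⟨S₀⟩ := HodgeDef.LogThickening.nonempty_localSystem L
  refine ⟨⟨⟨S₀⟩, P.cls E S₀.cocycle, fun S => ⟨S.cocycle, S.represents_cocycle, S.eq_cocycle⟩,
    fun S z hz => ?_, S₀.cls_cocycle_eq_zero_iff⟩,
    fun h => ⟨HodgeDef.LogThickening.HodgeLift.addTorsor h,
      HodgeDef.LogThickening.HodgeLift.isDifference_sub⟩⟩
  rw [S.eq_cocycle z hz]
  exact S.cls_cocycle_eq S₀
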